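/- **Arc rings and bimodules.** Let $\mathcal A=\mathbb Z[X]/(X^2)$, graded with $1$ in degree $-1$ and $X$ in degree $1$, with trace $\mathrm{tr}(1)=0$, $\mathrm{tr}(X)=1$, and let $\mathcal F$ be the two-dimensional TQFT of the Frobenius ring $\mathcal A$: it assigns $\mathcal A^{\otimes I}$ to a closed 1-manifold with set of components $I$, the multiplication of $\mathcal A$ to a merging saddle and the comultiplication $\Delta(1)=1\otimes X+X\otimes 1$, $\Delta(X)=X\otimes X$ to a splitting saddle. For a graded group $M$ let $M\{d\}$ be $M$ with the grading shifted up by $d$, i.e. $M\{d\}_r=M_{r-d}$. For a sequence $s$ of $2m$ points on the line let $B(s)$ be the set of crossingless perfect matchings of $s$, let $W$ denote reflection in the horizontal axis, and put $$H(s)=\bigoplus_{a,b\in B(s)}\mathcal F(W(b)a)\{m\},$$ a graded ring; the product $\mathcal F(W(d)c)\otimes\mathcal F(W(b)a)\to\mathcal F(W(d)a)$ is induced by the cobordism that contracts $b$ with $W(b)$ if $b=c$, and is zero if $b\ne c$. For a flat tangle $T$ with bottom endpoints $s$ ($2m$ points) and top endpoints $t$, put $$\mathcal F(T)=\bigoplus_{b\in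 B(t),\,a\in B(s)}\mathcal F(W(b)Ta)\{m\},$$ a graded $(H(t),H(s))$-bimodule, the actions again being given by contraction cobordisms. **Weights and categories.** Fix integers $1\le k\le n-1$. A weight $\lambda=(\lambda_1,\dots,\lambda_n)\in\mathbb Z^n$ is admissible if $\lambda_x\in\{0,1,2\}$ for all $x$ and $\sum_x\lambda_x=2k$. Let $s(\lambda)=\{x:\lambda_x=1\}$, $H_\lambda=H(s(\lambda))$, let $\mathcal C(\lambda)$ be the category of finitely generated graded left $H_\lambda$-modules with degree-preserving homomorphisms, and let $\mathcal C=\bigoplus_\lambda\mathcal C(\lambda)$ over all admissible $\lambda$. **Functors.** For $1\le i\le n-1$ let $\epsilon_i$ have $1$ in position $i$, $-1$ in position $i+1$ and $0$ elsewhere. The functor $\mathcal E_i:\mathcal C\to\mathcal C$ is the sum over admissible $\lambda$ of functors $\mathcal C(\lambda)\to\mathcal C(\lambda+\epsilon_i)$, namely the zero functor if $\lambda+\epsilon_i$ is not admissible, and otherwise the tensor product over $H_\lambda$ with $\mathcal F(T)$, where $T$ is - $\mathrm{Id}_i^{i+1}$ (a strand from bottom point $i$ to top point $i+1$) if $(\lambda_i,\lambda_{i+1})=(1,2)$;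 - $\mathrm{Id}_{i+1}^{i}$ (a strand from bottom point $i+1$ to top point $i$) if $(\lambda_i,\lambda_{i+1})=(0,1)$; - $\cup^{i,i+1}$ (a cup joining the top points $i,i+1$) if $(\lambda_i,\lambda_{i+1})=(0,2)$; - $\cap_{i,i+1}$ (a cap joining the bottom points $i,i+1$) if $(\lambda_i,\lambda_{i+1})=(1,1)$; all other strands of $T$ being vertical. The functor $\mathcal F_i:\mathcal C\to\mathcal C$ is likewise the sum of functors $\mathcal C(\lambda)\to\mathcal C(\lambda-\epsilon_i)$: zero if $\lambda-\epsilon_i$ is not admissible, and otherwise the tensor product with $\mathcal F(\mathrm{Id}_i^{i+1})$, $\mathcal F(\mathrm{Id}_{i+1}^i)$, $\mathcal F(\cup^{i,i+1})$, $\mathcal F(\cap_{i,i+1})$ according as $(\lambda_i,\lambda_{i+1})=(1,0),(2,1),(2,0),(1,1)$. **Proposition.** For every admissible $\lambda$ and every $1\le i\le n-1$ there are the following isomorphisms of functors on $\mathcal C(\lambda)$ (that is, of functors from $\mathcal C(\lambda)$ to $\mathcal C$, where $\mathrm{Id}$ stands for the inclusion and $\mathrm{Id}\{d\}$ for the inclusion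 composed with the shift $\{d\}$): $$\begin{array}{ll} \mathcal E_i\mathcal F_i\cong\mathcal F_i\mathcal E_i\oplus\mathrm{Id}\{1\}\oplus\mathrm{Id}\{-1\}&\text{if }(\lambda_i,\lambda_{i+1})=(2,0),\\ \mathcal E_i\mathcal F_i\cong\mathcal F_i\mathcal E_i\oplus\mathrm{Id}&\text{if }\lambda_i-\lambda_{i+1}=1,\\ \mathcal E_i\mathcal F_i\cong\mathcal F_i\mathcal E_i&\text{if }\lambda_i=\lambda_{i+1},\\ \mathcal E_i\mathcal F_i\oplus\mathrm{Id}\cong\mathcal F_i\mathcal E_i&\text{if }\lambda_i-\lambda_{i+1}=-1,\\ \mathcal E_i\mathcal F_i\oplus\mathrm{Id}\{1\}\oplus\mathrm{Id}\{-1\}\cong\mathcal F_i\mathcal E_i&\text{if }(\lambda_i,\lambda_{i+1})=(0,2). \end{array}$$ -/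

import Mathlib

set_option linter.unusedSectionVars false

namespace ArcAlgebra

/-! ### Crossingless matchings and circles -/

/-- A crossingless perfect matching of the points of a linearly ordered set, given by the
fixed-point-free involution that sends each point to its partner. -/
@[ext]
structure Matching (P : Type) [LinearOrder P] where
  toFun : P → P
  invol : ∀ p, toFun (toFun p) = p
  ne : ∀ p, toFun p ≠ p
  noncross : ∀ i j l p, i < j → j < l → l < p → toFun i = l → toFun j ≠ p

instance (P : Type) [LinearOrder P] : CoeFun (Matching P) (fun _ => P → P) := ⟨Matching.toFun⟩

noncomputable instance (P : Type) [LinearOrder P] [Finite P] : Fintype (Matching P) :=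
  @Fintype.ofFinite _ (Finite.of_injective (fun a : Matching P => a.toFun)
    (fun _ _ h => Matching.ext h))

noncomputable instance (P : Type) [LinearOrder P] : DecidableEq (Matching P) :=
  Classical.decEq _

/-- If the arcs of a closed 1-manifold with marked points `V` are recorded by two
involutions `α`, `β` of `V`, this is the relation "on the same circle". -/
def sameCircle {V : Type} (α β : V → V) : Setoid V :=
  Relation.EqvGen.setoid (fun v w => w = α v ∨ w = β v)

/-- The circles of the closed 1-manifold `W(b)a`. -/
def circles {P : Type} [LinearOrder P] (b a : Matching P) : Setoid P := sameCircle b a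

/-- The number of circles. -/
noncomputable def numCircles {P : Type} (r : Setoid P) : ℕ := Nat.card (Quotient r)

/-! ### Facts about circles -/

section Surgery

variable {V : Type}

lemma sameCircle_left (α β : V → V) (v : V) : sameCircle α β v (α v) :=
  Relation.EqvGen.rel _ _ (Or.inl rfl)

lemma sameCircle_right (α β : V → V) (v : V) : sameCircle α β v (β v) :=
  Relation.EqvGen.rel _ _ (Or.inr rfl)

lemma sameCircle_le {α β : V → V} {r : Setoid V} (h1 : ∀ v, r v (α v)) (h2 : ∀ v, r v (β v))
    {v w : V} (h : sameCircle α β v w) : r v w := by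
  induction h with
  | rel x y hxy => rcases hxy with rfl | rfl
                   · exact h1 _
                   · exact h2 _
  | refl x => exact r.refl x
  | symm x y _ ih => exact r.symm ih
  | trans x y z _ _ ih1 ih2 => exact r.trans ih1 ih2

lemma sameCircle_inv {T : Type} {α β : V → V} {g : V → T} (h1 : ∀ v, g (α v) = g v)
    (h2 : ∀ v, g (β v) = g v) {v w : V} (h : sameCircle α β v w) : g v = g w :=
  sameCircle_le (r := Setoid.ker g) (fun v => (h1 v).symm) (fun v => (h2 v).symm) h

/-- Multiplying a permutation by a transposition of two points either splits a cycle or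
merges two. -/
lemma perm_surgery [Finite V] (f f' : Equiv.Perm V) (i l : V) (hil : i ≠ l)
    (h1 : f' i = f l) (h2 : f' l = f i)
    (h3 : ∀ x, (f.SameCycle i x ∨ f.SameCycle l x) → x ≠ i → x ≠ l → f' x = f x) :
    f.SameCycle i l ↔ ¬ f'.SameCycle i l := by
  classical
  constructor
  · intro h h'
    have hex : ∃ m : ℕ, 0 < m ∧ (f ^ m) i = l := by
      obtain ⟨n, hn0, -, hn⟩ := h.exists_pow_eq''
      exact ⟨n, hn0, hn⟩
    set k := Nat.find hex
    obtain ⟨hk0, hk⟩ := Nat.find_spec hex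
    have hmin : ∀ m, 0 < m → m < k → (f ^ m) i ≠ l := fun m hm hmk hml =>
      Nat.find_min hex hmk ⟨hm, hml⟩
    have hni : ∀ m, 0 < m → m ≤ k → (f ^ m) i ≠ i := by
      intro m hm hmk hmi
      rcases hmk.lt_or_eq with hlt | rfl
      · apply hmin (k - m) (by omega) (by omega)
        have : (f ^ (k - m)) ((f ^ m) i) = l := by
          rw [← Equiv.Perm.mul_apply, ← pow_add, Nat.sub_add_cancel hmk]; exact hk
        rwa [hmi] at this
      · exact hil (hmi.symm.trans hk)
    have key : ∀ t : ℕ, ∃ m, 0 < m ∧ m ≤ k ∧ (f' ^ t) l = (f ^ m) i := by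
      intro t
      induction t with
      | zero => exact ⟨k, hk0, le_rfl, by simpa using hk.symm⟩
      | succ t ih =>
        obtain ⟨m, hm0, hmk, hm⟩ := ih
        rw [pow_succ', Equiv.Perm.mul_apply, hm]
        rcases hmk.lt_or_eq with hlt | rfl
        · refine ⟨m + 1, by omega, hlt, ?_⟩
          rw [h3 _ (Or.inl ⟨m, by simp⟩) (hni m hm0 hmk) (hmin m hm0 hlt), pow_succ',
            Equiv.Perm.mul_apply]
        · refine ⟨1, one_pos, hk0, ?_⟩
          have : (f ^ k) i = l := hk
          rw [this, h2, pow_one]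
    obtain ⟨t, -, -, ht⟩ := h'.symm.exists_pow_eq''
    obtain ⟨m, hm0, hmk, hm⟩ := key t
    exact hni m hm0 hmk (hm.symm.trans ht)
  · contrapose!
    intro h
    have hex : ∃ m : ℕ, 0 < m ∧ (f ^ m) l = l :=
      ⟨orderOf f, orderOf_pos f, by rw [pow_orderOf_eq_one]; rfl⟩
    set k := Nat.find hex
    obtain ⟨hk0, hk⟩ := Nat.find_spec hex
    have hmin : ∀ m, 0 < m → m < k → (f ^ m) l ≠ l := fun m hm hmk hml =>
      Nat.find_min hex hmk ⟨hm, hml⟩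
    have hni : ∀ m : ℕ, (f ^ m) l ≠ i := fun m hm => h (Equiv.Perm.SameCycle.symm ⟨m, by simpa⟩)
    have key : ∀ m : ℕ, m + 1 ≤ k → (f' ^ (m + 1)) i = (f ^ (m + 1)) l := by
      intro m
      induction m with
      | zero => intro _; simpa using h1
      | succ m ih =>
        intro hm
        rw [pow_succ', Equiv.Perm.mul_apply, ih (by omega),
          h3 _ (Or.inr ⟨(m + 1 : ℕ), by rw [zpow_natCast]⟩) (hni _) (hmin _ (by omega) (by omega)),
          ← Equiv.Perm.mul_apply, ← pow_succ']
    have := key (k - 1) (by omega)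
    rw [Nat.sub_add_cancel hk0] at this
    exact ⟨k, by rw [zpow_natCast, this]; exact hk⟩

section
variable (α β : V → V) (hα : ∀ v, α (α v) = v) (hβ : ∀ v, β (β v) = v)

/-- Going along the 1-manifold over two arcs. -/
def walk : Equiv.Perm V where
  toFun v := α (β v)
  invFun v := β (α v)
  left_inv v := by simp [hα, hβ]
  right_inv v := by simp [hα, hβ]

lemma walk_eps [Finite V] (ε : V → Bool) (hεα : ∀ v, ε (α v) = !ε v)
    (hεβ : ∀ v, ε (β v) = !ε v)
    {v w : V} (h : (walk α β hα hβ).SameCycle v w) : ε v = ε w := by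
  have h1 : ∀ x, ε (walk α β hα hβ x) = ε x := fun x => by
    change ε (α (β x)) = _; rw [hεα, hεβ, Bool.not_not]
  obtain ⟨n, rfl⟩ := h.exists_nat_pow_eq
  induction n with
  | zero => simp
  | succ n ih => rw [pow_succ', Equiv.Perm.mul_apply, h1]; exact ih ⟨n, by simp⟩

lemma sameCircle_of_sameCycle [Finite V] {v w : V} (h : (walk α β hα hβ).SameCycle v w) :
    sameCircle α β v w := by
  obtain ⟨n, rfl⟩ := h.exists_nat_pow_eq
  clear h
  induction n with
  | zero => exact Setoid.refl' _ _
  | succ n ih =>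
    rw [pow_succ', Equiv.Perm.mul_apply]
    exact Setoid.trans' _ ih (Setoid.trans' _ (sameCircle_right α β _) (sameCircle_left α β _))

lemma sameCycle_of_sameCircle [Finite V] (ε : V → Bool) (hεα : ∀ v, ε (α v) = !ε v)
    (hεβ : ∀ v, ε (β v) = !ε v)
    {v w : V} (h : sameCircle α β v w) (he : ε v = ε w) :
    (walk α β hα hβ).SameCycle v w := by
  set f := walk α β hα hβ with hf
  have hfβ : ∀ x, f (β x) = α x := fun x => by change α (β (β x)) = _; rw [hβ]
  have hstep : ∀ x, f.SameCycle x (f x) := fun x => ⟨1, by simp⟩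
  let c : V → V := fun x => if ε x = ε v then x else β x
  let r : Setoid V := (Equiv.Perm.SameCycle.setoid f).comap c
  have hr : r v w := by
    refine sameCircle_le (r := r) (fun x => ?_) (fun x => ?_) h
    · change f.SameCycle (c x) (c (α x))
      by_cases hx : ε x = ε v
      · simp only [c, hεα, hx, if_true, Bool.not_eq_self, if_false]
        have := hstep (β (α x))
        rw [hfβ, hα] at this
        exact this.symm
      · have hx' : (!ε x) = ε v := by cases hh : ε x <;> cases hv : ε v <;> simp_all
        simp only [c, hεα, hx, hx', if_true, if_false]
        rw [← hfβ]; exact hstep _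
    · change f.SameCycle (c x) (c (β x))
      by_cases hx : ε x = ε v
      · simp only [c, hεβ, hx, if_true, Bool.not_eq_self, if_false, hβ]
        exact Equiv.Perm.SameCycle.refl _ _
      · have hx' : (!ε x) = ε v := by cases hh : ε x <;> cases hv : ε v <;> simp_all
        simp only [c, hεβ, hx, hx', if_true, if_false]
        exact Equiv.Perm.SameCycle.refl _ _
  have hr' : f.SameCycle (c v) (c w) := hr
  simpa [c, he] using hr'

end

/-- Saddle move on a 1-manifold whose circles can be oriented: replacing the arcs `i — β i`,
`k — β k` by `i — k`, `β i — β k` splits a circle if the two arcs lie on the same circle,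
and merges two circles otherwise. -/
lemma saddle_iff [Finite V] {α β β' : V → V} (hα : ∀ v, α (α v) = v) (hβ : ∀ v, β (β v) = v)
    (hβ' : ∀ v, β' (β' v) = v) {ε : V → Bool} (hεα : ∀ v, ε (α v) = !ε v)
    (hεβ : ∀ v, ε (β v) = !ε v) (hεβ' : ∀ v, ε (β' v) = !ε v) {i k : V}
    (hik : β' i = k) (hjl : β' (β i) = β k) (hne : β i ≠ k)
    (hrest : ∀ v, v ≠ i → v ≠ β i → v ≠ k → v ≠ β k → β' v = β v) :
    sameCircle α β i k ↔ ¬ sameCircle α β' i (β i) := by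
  classical
  have hk : ε k = !ε i := by rw [← hik, hεβ']
  have hl : ε (β k) = ε i := by rw [hεβ, hk, Bool.not_not]
  have hil : i ≠ β k := fun h => hne (by rw [h, hβ])
  have e1 : sameCircle α β i k ↔ (walk α β hα hβ).SameCycle i (β k) := by
    constructor
    · intro h
      exact sameCycle_of_sameCircle α β hα hβ ε hεα hεβ
        (Setoid.trans' _ h (sameCircle_right α β k)) hl.symm
    · intro h
      exact Setoid.trans' _ (sameCircle_of_sameCycle α β hα hβ h)
        (Setoid.symm' _ (sameCircle_right α β k))
  have e2 : sameCircle α β' i (β i) ↔ (walk α β' hα hβ').SameCycle i (β k) := by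
    have h0 : sameCircle α β' (β i) (β k) := by
      rw [← hjl]; exact sameCircle_right α β' _
    constructor
    · intro h
      exact sameCycle_of_sameCircle α β' hα hβ' ε hεα hεβ' (Setoid.trans' _ h h0) hl.symm
    · intro h
      exact Setoid.trans' _ (sameCircle_of_sameCycle α β' hα hβ' h) (Setoid.symm' _ h0)
  rw [e1, e2]
  refine perm_surgery _ _ i (β k) hil ?_ ?_ ?_
  · change α (β' i) = α (β (β k)); rw [hik, hβ]
  · change α (β' (β k)) = α (β i); rw [← hjl, hβ']
  · intro x hx hxi hxl
    have hεx : ε x = ε i := by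
      rcases hx with hx | hx
      · exact (walk_eps α β hα hβ ε hεα hεβ hx).symm
      · rw [← walk_eps α β hα hβ ε hεα hεβ hx, hl]
    change α (β' x) = α (β x)
    rw [hrest x hxi _ _ hxl]
    · rintro rfl; rw [hεβ] at hεx; simp at hεx
    · rintro rfl; rw [hk] at hεx; simp at hεx

/-- The sum over circles of a function that is constant on circles. -/
noncomputable def circleSum [Finite V] (r : Setoid V) (g : V → ℤ) : ℤ :=
  letI := Fintype.ofFinite (Quotient r)
  ∑ C : Quotient r, g C.out

lemma circleSum_equiv {W : Type} [Finite V] [Finite W] (r : Setoid V) (s : Setoid W)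
    (g : V → ℤ) (h : W → ℤ) (f : V → W) (hf : ∀ v w, r v w ↔ s (f v) (f w))
    (hsurj : ∀ w, ∃ v, s (f v) w) (hg : ∀ v, h (f v) = g v)
    (hh : ∀ v w, s v w → h v = h w) : circleSum r g = circleSum s h := by
  classical
  let := Fintype.ofFinite (Quotient r)
  let := Fintype.ofFinite (Quotient s)
  unfold circleSum
  let φ : Quotient r → Quotient s := Quotient.map f (fun v w hvw => (hf v w).1 hvw)
  refine Finset.sum_bij (fun C _ => φ C) (fun _ _ => Finset.mem_univ _) ?_ ?_ ?_
  · rintro ⟨v⟩ - ⟨w⟩ - h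
    exact Quotient.sound ((hf v w).2 (Quotient.exact h))
  · rintro ⟨w⟩ -
    obtain ⟨v, hv⟩ := hsurj w
    exact ⟨Quotient.mk _ v, Finset.mem_univ _, Quotient.sound hv⟩
  · rintro C -
    have : s (f C.out) (φ C).out := by
      apply Quotient.exact (s := s)
      conv_rhs => rw [Quotient.out_eq]
      conv_rhs => rw [← Quotient.out_eq C]
      rfl
    rw [← hg, hh _ _ this]

lemma circleSum_one [Finite V] (r : Setoid V) : circleSum r (fun _ => 1) = numCircles r := by
  let := Fintype.ofFinite (Quotient r)
  simp [circleSum, numCircles, Nat.card_eq_fintype_card]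

/-- Merging the classes of two unrelated points removes one circle. -/
lemma circleSum_merge [Finite V] (r R : Setoid V) (x y : V) (hxy : ¬ r x y) (hRxy : R x y)
    (hR : ∀ v w, R v w → r v w ∨ (r v x ∧ r y w) ∨ (r v y ∧ r x w)) (hrR : ∀ v w, r v w → R v w)
    (g : V → ℤ) (hg : ∀ v w, R v w → g v = g w) :
    circleSum r g = circleSum R g + g x := by
  classical
  let := Fintype.ofFinite (Quotient r)
  let := Fintype.ofFinite (Quotient R)
  unfold circleSum
  rw [← Finset.sum_erase_add _ _ (Finset.mem_univ (Quotient.mk r x))]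
  congr 1
  · let φ : Quotient r → Quotient R := Quotient.map id (fun v w hvw => hrR v w hvw)
    refine Finset.sum_bij (fun C _ => φ C) (fun _ _ => Finset.mem_univ _) ?_ ?_ ?_
    · rintro ⟨v⟩ hv ⟨w⟩ hw h
      have hv' : ¬ r v x := fun h => (Finset.mem_erase.1 hv).1 (Quotient.sound h)
      have hw' : ¬ r w x := fun h => (Finset.mem_erase.1 hw).1 (Quotient.sound h)
      rcases hR v w (Quotient.exact h) with h | h | h
      · exact Quotient.sound h
      · exact absurd h.1 hv'
      · exact absurd (r.symm h.2) hw'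
    · rintro ⟨w⟩ -
      by_cases hw : r w x
      · refine ⟨Quotient.mk r y, Finset.mem_erase.2 ⟨fun h => ?_, Finset.mem_univ _⟩, ?_⟩
        · exact hxy (r.symm (Quotient.exact h))
        · exact Quotient.sound (R.trans (R.symm hRxy) (R.symm (hrR _ _ hw)))
      · exact ⟨Quotient.mk r w, Finset.mem_erase.2 ⟨fun h => hw (Quotient.exact h),
          Finset.mem_univ _⟩, rfl⟩
    · rintro C -
      apply hg
      apply Quotient.exact (s := R)
      conv_rhs => rw [Quotient.out_eq]
      conv_rhs => rw [← Quotient.out_eq C]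
      rfl
  · exact hg _ _ (hrR _ _ (Quotient.exact (Quotient.out_eq (Quotient.mk r x))))

/-- One half of the comparison of circles before and after a saddle. -/
lemma saddle_le {α β β' : V → V} (hβ : ∀ v, β (β v) = v) {i k : V}
    (hik : β' i = k) (hjl : β' (β i) = β k)
    (hrest : ∀ v, v ≠ i → v ≠ β i → v ≠ k → v ≠ β k → β' v = β v) {v w : V}
    (h : sameCircle α β v w) :
    sameCircle α β' v w ∨ (sameCircle α β' v i ∧ sameCircle α β' (β i) w) ∨
      (sameCircle α β' v (β i) ∧ sameCircle α β' i w) := by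
  set r' := sameCircle α β' with hr'
  have hik' : r' i k := by rw [← hik]; exact sameCircle_right α β' _
  have hjl' : r' (β i) (β k) := by rw [← hjl]; exact sameCircle_right α β' _
  let R : Setoid V :=
    { r := fun v w => r' v w ∨ (r' v i ∧ r' (β i) w) ∨ (r' v (β i) ∧ r' i w)
      iseqv := by
        refine ⟨fun x => Or.inl (r'.refl x), ?_, ?_⟩
        · rintro x y (h | h | h)
          · exact Or.inl (r'.symm h)
          · exact Or.inr (Or.inr ⟨r'.symm h.2, r'.symm h.1⟩)
          · exact Or.inr (Or.inl ⟨r'.symm h.2, r'.symm h.1⟩)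
        · rintro x y z (h | h | h) (h' | h' | h')
          · exact Or.inl (r'.trans h h')
          · exact Or.inr (Or.inl ⟨r'.trans h h'.1, h'.2⟩)
          · exact Or.inr (Or.inr ⟨r'.trans h h'.1, h'.2⟩)
          · exact Or.inr (Or.inl ⟨h.1, r'.trans h.2 h'⟩)
          · exact Or.inr (Or.inl ⟨h.1, h'.2⟩)
          · exact Or.inl (r'.trans h.1 h'.2)
          · exact Or.inr (Or.inr ⟨h.1, r'.trans h.2 h'⟩)
          · exact Or.inl (r'.trans h.1 h'.2)
          · exact Or.inr (Or.inr ⟨h.1, h'.2⟩) }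
  refine sameCircle_le (r := R) (fun v => Or.inl (sameCircle_left α β' v)) (fun v => ?_) h
  change r' v (β v) ∨ (r' v i ∧ r' (β i) (β v)) ∨ (r' v (β i) ∧ r' i (β v))
  by_cases h1 : v = i
  · subst h1; exact Or.inr (Or.inl ⟨r'.refl _, r'.refl _⟩)
  by_cases h2 : v = β i
  · subst h2; rw [hβ]; exact Or.inr (Or.inr ⟨r'.refl _, r'.refl _⟩)
  by_cases h3 : v = k
  · subst h3; exact Or.inr (Or.inl ⟨r'.symm hik', hjl'⟩)
  by_cases h4 : v = β k
  · subst h4; rw [hβ]; exact Or.inr (Or.inr ⟨r'.symm hjl', hik'⟩)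
  left
  rw [← hrest v h1 h2 h3 h4]
  exact sameCircle_right α β' v

/-- The change of the number of circles under a saddle. -/
lemma circleSum_saddle [Finite V] {α β β' : V → V} (hα : ∀ v, α (α v) = v)
    (hβ : ∀ v, β (β v) = v)
    (hβ' : ∀ v, β' (β' v) = v) {ε : V → Bool} (hεα : ∀ v, ε (α v) = !ε v)
    (hεβ : ∀ v, ε (β v) = !ε v) (hεβ' : ∀ v, ε (β' v) = !ε v) {i k : V}
    (hik : β' i = k) (hjl : β' (β i) = β k) (hne : β i ≠ k)
    (hrest : ∀ v, v ≠ i → v ≠ β i → v ≠ k → v ≠ β k → β' v = β v)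
    (g : V → ℤ) (hgα : ∀ v, g (α v) = g v) (hgβ : ∀ v, g (β v) = g v)
    (hgβ' : ∀ v, g (β' v) = g v) :
    circleSum (sameCircle α β') g - circleSum (sameCircle α β) g =
      (open Classical in if sameCircle α β i k then g i else - g i) := by
  have hs := saddle_iff hα hβ hβ' hεα hεβ hεβ' hik hjl hne hrest
  have hjk : β' k = i := by rw [← hik, hβ']
  have hlj : β' (β k) = β i := by rw [← hjl, hβ']
  have l1 := fun v w => saddle_le (α := α) (v := v) (w := w) hβ hik hjl hrest
  have l2 := fun v w => saddle_le (α := α) (β := β') (β' := β) (i := i) (k := β i) (v := v)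
    (w := w) hβ' rfl (by rw [hik, hjl]) (fun v h1 h2 h3 h4 => by
      rw [hik] at h2; rw [hjl] at h4; exact (hrest v h1 h3 h2 h4).symm)
  rw [hik] at l2
  split_ifs with h
  · have h' := hs.1 h
    have hR : ∀ v w, sameCircle α β' v w → sameCircle α β v w := by
      intro v w hvw
      rcases l2 v w hvw with h0 | h0 | h0
      · exact h0
      · exact Setoid.trans' _ h0.1 (Setoid.trans' _ h h0.2)
      · exact Setoid.trans' _ h0.1 (Setoid.trans' _ (Setoid.symm' _ h) h0.2)
    rw [circleSum_merge (sameCircle α β') (sameCircle α β) i (β i) h'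
      (sameCircle_right α β i) l1 hR g (fun v w => sameCircle_inv hgα hgβ)]
    ring
  · have h' : sameCircle α β' i (β i) := by by_contra h0; exact h (hs.2 h0)
    have hR : ∀ v w, sameCircle α β v w → sameCircle α β' v w := by
      intro v w hvw
      rcases l1 v w hvw with h0 | h0 | h0
      · exact h0
      · exact Setoid.trans' _ h0.1 (Setoid.trans' _ h' h0.2)
      · exact Setoid.trans' _ h0.1 (Setoid.trans' _ (Setoid.symm' _ h') h0.2)
    rw [circleSum_merge (sameCircle α β) (sameCircle α β') i k h
      (by rw [← hik]; exact sameCircle_right α β' i) l2 hR g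
      (fun v w => sameCircle_inv hgα hgβ')]
    ring

end Surgery
end ArcAlgebra

namespace ArcAlgebra

section Parity
variable {P : Type} [LinearOrder P] [Fintype P]

/-- The parity of the position of a point. -/
def posParity (q : P) : Bool := decide (Odd (Finset.univ.filter (· < q)).card)

lemma Matching.even_between (a : Matching P) (p : P) :
    Even (Finset.univ.filter (fun x => p < x ∧ x < a p)).card := by
  have h : ((Finset.univ.filter (fun x => p < x ∧ x < a p)).card : ZMod 2) = 0 := by
    rw [Finset.cast_card]
    refine Finset.sum_involution (fun x _ => a x) (fun _ _ => by decide) (fun x _ _ => a.ne x)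
      ?_ (fun x _ => a.invol x)
    intro x hx
    simp only [Finset.mem_filter, Finset.mem_univ, true_and] at hx ⊢
    constructor
    · by_contra hlt
      rcases (not_lt.1 hlt).lt_or_eq with h | h
      · exact a.noncross (a x) p x (a p) h hx.1 hx.2 (a.invol x) rfl
      · rw [← h, a.invol] at hx; exact lt_irrefl _ hx.2
    · by_contra hlt
      rcases (not_lt.1 hlt).lt_or_eq with h | h
      · exact a.noncross p x (a p) (a x) hx.1 hx.2 h rfl rfl
      · have : p = x := by rw [← a.invol p, h, a.invol]
        exact (this ▸ hx.1).false
  exact (ZMod.natCast_eq_zero_iff_even).1 h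

lemma Matching.posParity_aux (a : Matching P) (p : P) (hp : p < a p) :
    posParity (a p) = !posParity p := by
  have : Finset.univ.filter (· < a p) = Finset.univ.filter (· < p) ∪
      insert p (Finset.univ.filter (fun x => p < x ∧ x < a p)) := by
    ext x
    simp only [Finset.mem_filter, Finset.mem_univ, true_and, Finset.mem_union, Finset.mem_insert]
    constructor
    · intro h
      rcases lt_trichotomy x p with h' | h' | h'
      · exact Or.inl h'
      · exact Or.inr (Or.inl h')
      · exact Or.inr (Or.inr ⟨h', h⟩)
    · rintro (h | h | h)
      · exact h.trans hp
      · exact h ▸ hp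
      · exact h.2
  have hc := congrArg Finset.card this
  rw [Finset.card_union_of_disjoint, Finset.card_insert_of_notMem (by simp)] at hc
  · have he := a.even_between p
    unfold posParity
    rw [hc, ← decide_not, decide_eq_decide]
    rw [Nat.odd_iff, Nat.odd_iff]; rw [Nat.even_iff] at he; omega
  · rw [Finset.disjoint_left]
    intro x hx hx'
    simp only [Finset.mem_filter, Finset.mem_univ, true_and, Finset.mem_insert] at hx hx'
    rcases hx' with h | h
    · exact (h ▸ hx).false
    · exact (hx.trans h.1).false

lemma Matching.posParity (a : Matching P) (p : P) : posParity (a p) = !posParity p := by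
  rcases lt_or_gt_of_ne (a.ne p) with h | h
  · have := a.posParity_aux (a p) (by rwa [a.invol])
    rw [a.invol] at this
    rw [this, Bool.not_not]
  · exact a.posParity_aux p h

end Parity

/-! ### Flat tangles made of cups and through-strands -/

/-- A flat tangle without caps: every bottom endpoint `p : P` is joined by a strand to the top
endpoint `emb p : Q`, and each other top endpoint `q` is joined by a cup to the adjacent top
endpoint `arc q`.  (The values of `arc` on the range of `emb` are irrelevant.)
Turning the picture upside down gives the tangles made of caps and through-strands. -/
structure CupTangle (P Q : Type) [LinearOrder P] [LinearOrder Q] where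
  emb : P ↪o Q
  arc : Q → Q
  arc_notMem : ∀ q, q ∉ Set.range emb → arc q ∉ Set.range emb
  arc_ne : ∀ q, q ∉ Set.range emb → arc q ≠ q
  arc_arc : ∀ q, q ∉ Set.range emb → arc (arc q) = q
  arc_adj : ∀ q, q ∉ Set.range emb → ∀ x, q < x → ¬ x < arc q

namespace CupTangle

variable {P Q : Type} [LinearOrder P] [LinearOrder Q]

/-- The identity tangle. -/
def id (P : Type) [LinearOrder P] : CupTangle P P where
  emb := RelEmbedding.refl _
  arc q := q
  arc_notMem q h := absurd ⟨q, rfl⟩ h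
  arc_ne q h := absurd ⟨q, rfl⟩ h
  arc_arc q h := absurd ⟨q, rfl⟩ h
  arc_adj q h := absurd ⟨q, rfl⟩ h

@[simp] lemma id_emb (p : P) : (id P).emb p = p := rfl

variable (T : CupTangle P Q)

open Classical in
/-- The partner function of the diagram `Ta`. -/
noncomputable def cupFun (a : P → P) (q : Q) : Q :=
  if h : ∃ p, T.emb p = q then T.emb (a h.choose) else T.arc q

lemma cupFun_emb (a : P → P) (p : P) : T.cupFun a (T.emb p) = T.emb (a p) := by
  have h : ∃ p', T.emb p' = T.emb p := ⟨p, rfl⟩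
  have : h.choose = p := T.emb.injective h.choose_spec
  rw [cupFun, dif_pos h, this]

lemma cupFun_off (a : P → P) (q : Q) (h : q ∉ Set.range T.emb) : T.cupFun a q = T.arc q :=
  dif_neg h

/-- The crossingless matching `Ta` obtained by putting the tangle `T` on top of the crossingless
matching `a`. -/
noncomputable def cup (a : Matching P) : Matching Q where
  toFun := T.cupFun a
  invol q := by
    by_cases h : q ∈ Set.range T.emb
    · obtain ⟨p, rfl⟩ := h
      rw [cupFun_emb, cupFun_emb, a.invol]
    · rw [T.cupFun_off _ q h, T.cupFun_off _ _ (T.arc_notMem q h), T.arc_arc q h]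
  ne q := by
    by_cases h : q ∈ Set.range T.emb
    · obtain ⟨p, rfl⟩ := h
      rw [cupFun_emb]
      exact fun h => a.ne p (T.emb.injective h)
    · rw [T.cupFun_off _ q h]; exact T.arc_ne q h
  noncross i j l p hij hjl hlp hi hj := by
    by_cases h : i ∈ Set.range T.emb
    · obtain ⟨i, rfl⟩ := h
      rw [cupFun_emb] at hi
      subst hi
      by_cases h' : j ∈ Set.range T.emb
      · obtain ⟨j, rfl⟩ := h'
        rw [cupFun_emb] at hj
        subst hj
        exact a.noncross i j _ _ (T.emb.lt_iff_lt.1 hij) (T.emb.lt_iff_lt.1 hjl)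
          (T.emb.lt_iff_lt.1 hlp) rfl rfl
      · rw [T.cupFun_off _ j h'] at hj
        exact T.arc_adj j h' _ hjl (hj ▸ hlp)
    · rw [T.cupFun_off _ i h] at hi
      exact T.arc_adj i h _ hij (hi ▸ hjl)

@[simp] lemma cup_emb (a : Matching P) (p : P) : T.cup a (T.emb p) = T.emb (a p) :=
  T.cupFun_emb a p

lemma cup_off (a : Matching P) (q : Q) (h : q ∉ Set.range T.emb) : T.cup a q = T.arc q :=
  T.cupFun_off a q h

@[simp] lemma id_cup (a : Matching P) : (id P).cup a = a := by
  ext p; exact (id P).cup_emb a p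

/-- A colouring is constant along `Ta` iff it is constant along `a` and along the cups. -/
lemma cup_inv {X : Type} {κ : Q → X} (a : Matching P) :
    (∀ q, κ (T.cup a q) = κ q) ↔
      (∀ p, κ (T.emb (a p)) = κ (T.emb p)) ∧ ∀ q, q ∉ Set.range T.emb → κ (T.arc q) = κ q := by
  constructor
  · intro h
    exact ⟨fun p => by rw [← cup_emb]; exact h _, fun q hq => by rw [← T.cup_off a q hq]; exact h q⟩
  · rintro ⟨h1, h2⟩ q
    by_cases hq : q ∈ Set.range T.emb
    · obtain ⟨p, rfl⟩ := hq
      rw [cup_emb]; exact h1 p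
    · rw [T.cup_off a q hq]; exact h2 q hq

end CupTangle

/-! ### The contraction cobordism -/

section Contraction

variable {P Q : Type} [LinearOrder P] [LinearOrder Q]

/-- In the closed 1-manifold `W(c)b ⊔ W(d)Tb`, with marked points `P` (where `c` meets `b`)
and `Q` (where `d` meets `Tb`), the arcs of `c` and of `d`. They are not affected by the
contraction of `b` with `W(b)`. -/
def outer (c : Matching P) (d : Matching Q) : P ⊕ Q → P ⊕ Q := Sum.map c d

open Classical in
/-- The other arcs of this 1-manifold after the arcs of `b` with endpoints in `S` have been
contracted: a contracted arc of `b` and its mirror image have been replaced by two vertical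
segments joining `p : P` to `T.emb p : Q`. -/
noncomputable def inner (T : CupTangle P Q) (b : Matching P) (S : Set P) : P ⊕ Q → P ⊕ Q
  | Sum.inl p => if p ∈ S then Sum.inr (T.emb p) else Sum.inl (b p)
  | Sum.inr q =>
    if h : ∃ p, T.emb p = q then
      if h.choose ∈ S then Sum.inl h.choose else Sum.inr (T.emb (b h.choose))
    else Sum.inr (T.arc q)

open Classical in
/-- Contract the arcs of `b` whose left endpoints are listed, one after another, starting with
the 1-manifold in which the arcs with endpoints in `S` are already contracted. Each contraction
is a saddle: it splits a circle if the arc of `b` and its mirror image lie on the same circle,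
and merges two circles otherwise. This is the list of (left endpoints of) the arcs whose
contraction splits a circle. -/
noncomputable def splittings (T : CupTangle P Q) (c b : Matching P) (d : Matching Q) :
    List P → Set P → List P
  | [], _ => []
  | p :: l, S =>
    if sameCircle (outer c d) (inner T b S) (Sum.inl p) (Sum.inr (T.emb p)) then
      p :: splittings T c b d l (S ∪ {p, b p})
    else splittings T c b d l (S ∪ {p, b p})

/-- The left endpoints of the arcs of a matching, from left to right. -/
noncomputable def Matching.leftEnds [Fintype P] (b : Matching P) : List P :=
  (Finset.univ.filter (fun p => p < b p)).sort

/-- The contraction cobordism from `W(c)b ⊔ W(d)Tb` to `W(d)Tc` acts by merging variables and by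
multiplication by this polynomial: a saddle merging two circles acts by the multiplication
`𝒜 ⊗ 𝒜 → 𝒜`, and a saddle splitting a circle acts by the comultiplication
`Δ f = f (X ⊗ 1 + 1 ⊗ X)`. -/
noncomputable def theta [Fintype P] (T : CupTangle P Q) (c b : Matching P) (d : Matching Q) :
    MvPolynomial Q ℤ :=
  ((splittings T c b d b.leftEnds ∅).map
    (fun p => MvPolynomial.X (T.emb p) + MvPolynomial.X (T.emb (b p)))).prod

/-! ### Facts about the contraction cobordism -/

section
variable (T : CupTangle P Q) (b : Matching P) {S : Set P}

lemma inner_inl_mem {p : P} (h : p ∈ S) : inner T b S (Sum.inl p) = Sum.inr (T.emb p) := by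
  simp [inner, h]

lemma inner_inl_notMem {p : P} (h : p ∉ S) : inner T b S (Sum.inl p) = Sum.inl (b p) := by
  simp [inner, h]

lemma inner_emb_mem {p : P} (h : p ∈ S) : inner T b S (Sum.inr (T.emb p)) = Sum.inl p := by
  have h' : ∃ p', T.emb p' = T.emb p := ⟨p, rfl⟩
  have h2 : h'.choose = p := T.emb.injective h'.choose_spec
  rw [inner, dif_pos h', h2, if_pos h]

lemma inner_emb_notMem {p : P} (h : p ∉ S) :
    inner T b S (Sum.inr (T.emb p)) = Sum.inr (T.emb (b p)) := by
  have h' : ∃ p', T.emb p' = T.emb p := ⟨p, rfl⟩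
  have h2 : h'.choose = p := T.emb.injective h'.choose_spec
  rw [inner, dif_pos h', h2, if_neg h]

lemma inner_off {q : Q} (h : q ∉ Set.range T.emb) :
    inner T b S (Sum.inr q) = Sum.inr (T.arc q) := by
  rw [inner, dif_neg (by simpa using h)]

lemma inner_cases {C : P ⊕ Q → Prop} (S : Set P) (h1 : ∀ p, p ∈ S → C (Sum.inl p))
    (h2 : ∀ p, p ∉ S → C (Sum.inl p)) (h3 : ∀ p, p ∈ S → C (Sum.inr (T.emb p)))
    (h4 : ∀ p, p ∉ S → C (Sum.inr (T.emb p)))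
    (h5 : ∀ q, q ∉ Set.range T.emb → C (Sum.inr q)) (v : P ⊕ Q) : C v := by
  rcases v with p | q
  · by_cases h : p ∈ S
    · exact h1 p h
    · exact h2 p h
  · by_cases hq : q ∈ Set.range T.emb
    · obtain ⟨p, rfl⟩ := hq
      by_cases h : p ∈ S
      · exact h3 p h
      · exact h4 p h
    · exact h5 q hq

lemma inner_invol (hS : ∀ p, p ∈ S → b p ∈ S) (v : P ⊕ Q) :
    inner T b S (inner T b S v) = v := by
  have hS' : ∀ p, p ∉ S → b p ∉ S := fun p hp h => hp (by simpa [b.invol] using hS _ h)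
  induction v using inner_cases T S with
  | h1 p h => rw [inner_inl_mem T b h, inner_emb_mem T b h]
  | h2 p h => rw [inner_inl_notMem T b h, inner_inl_notMem T b (hS' p h), b.invol]
  | h3 p h => rw [inner_emb_mem T b h, inner_inl_mem T b h]
  | h4 p h => rw [inner_emb_notMem T b h, inner_emb_notMem T b (hS' p h), b.invol]
  | h5 q h => rw [inner_off T b h, inner_off T b (T.arc_notMem q h), T.arc_arc q h]

/-- An orientation of the circles: the parity of the position. -/
def orient [Fintype Q] (T : CupTangle P Q) : P ⊕ Q → Bool :=
  Sum.elim (fun p => !posParity (T.emb p)) posParity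

lemma orient_outer [Fintype Q] (c : Matching P) (d : Matching Q) (v : P ⊕ Q) :
    orient T (outer c d v) = !orient T v := by
  rcases v with p | q
  · simp only [outer, orient, Sum.map_inl, Sum.elim_inl]
    rw [← T.cup_emb, Matching.posParity]
  · simp only [outer, orient, Sum.map_inr, Sum.elim_inr]
    rw [Matching.posParity]

lemma orient_inner [Fintype Q] (v : P ⊕ Q) : orient T (inner T b S v) = !orient T v := by
  induction v using inner_cases T S with
  | h1 p h => rw [inner_inl_mem T b h]; simp [orient]
  | h2 p h => rw [inner_inl_notMem T b h]; simp only [orient, Sum.elim_inl]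
              rw [← T.cup_emb, Matching.posParity]
  | h3 p h => rw [inner_emb_mem T b h]; simp [orient]
  | h4 p h => rw [inner_emb_notMem T b h]; simp only [orient, Sum.elim_inr]
              rw [← T.cup_emb, Matching.posParity]
  | h5 q h => rw [inner_off T b h]; simp only [orient, Sum.elim_inr]
              rw [← T.cup_off b q h, Matching.posParity]

lemma outer_invol (c : Matching P) (d : Matching Q) (v : P ⊕ Q) :
    outer c d (outer c d v) = v := by
  rcases v with p | q
  · simp [outer, c.invol]
  · simp [outer, d.invol]

/-- `g` is constant along strands and arcs. -/
structure Compat {X : Type} (c : Matching P) (d : Matching Q) (g : P ⊕ Q → X) : Prop where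
  outer : ∀ v, g (outer c d v) = g v
  vert : ∀ p, g (Sum.inr (T.emb p)) = g (Sum.inl p)
  arc : ∀ q, q ∉ Set.range T.emb → g (Sum.inr (T.arc q)) = g (Sum.inr q)

lemma Compat.inner {X : Type} {c : Matching P} {d : Matching Q} {g : P ⊕ Q → X}
    (hg : Compat T c d g) (hb : ∀ p, p ∉ S → g (Sum.inl (b p)) = g (Sum.inl p)) (v : P ⊕ Q) :
    g (inner T b S v) = g v := by
  induction v using inner_cases T S with
  | h1 p h => rw [inner_inl_mem T b h, hg.vert]
  | h2 p h => rw [inner_inl_notMem T b h, hb p h]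
  | h3 p h => rw [inner_emb_mem T b h, hg.vert]
  | h4 p h => rw [inner_emb_notMem T b h, hg.vert, hg.vert, hb p h]
  | h5 q h => rw [inner_off T b h, hg.arc q h]


lemma closed_insert (hS : ∀ p, p ∈ S → b p ∈ S) (p : P) :
    ∀ x, x ∈ S ∪ {p, b p} → b x ∈ S ∪ {p, b p} := by
  rintro x (hx | rfl | rfl)
  · exact Or.inl (hS x hx)
  · exact Or.inr (Or.inr rfl)
  · exact Or.inr (Or.inl (b.invol _))

lemma inner_insert_ne {p : P} (v : P ⊕ Q)
    (h1 : v ≠ Sum.inl p) (h2 : v ≠ Sum.inl (b p)) (h3 : v ≠ Sum.inr (T.emb p))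
    (h4 : v ≠ Sum.inr (T.emb (b p))) : inner T b (S ∪ {p, b p}) v = inner T b S v := by
  have aux : ∀ x, x ∉ S → x ≠ p → x ≠ b p → x ∉ S ∪ {p, b p} := by
    rintro x hx hxp hxb (h | h | h)
    · exact hx h
    · exact hxp h
    · exact hxb h
  induction v using inner_cases T S with
  | h1 x h => rw [inner_inl_mem T b h, inner_inl_mem T b (Or.inl h)]
  | h2 x h => rw [inner_inl_notMem T b h, inner_inl_notMem T b
                (aux x h (fun e => h1 (e ▸ rfl)) (fun e => h2 (e ▸ rfl)))]
  | h3 x h => rw [inner_emb_mem T b h, inner_emb_mem T b (Or.inl h)]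
  | h4 x h => rw [inner_emb_notMem T b h, inner_emb_notMem T b
                (aux x h (fun e => h3 (e ▸ rfl)) (fun e => h4 (e ▸ rfl)))]
  | h5 q h => rw [inner_off T b h, inner_off T b h]

lemma step_data {p : P} (hp : p ∉ S) :
    inner T b (S ∪ {p, b p}) (Sum.inl p) = Sum.inr (T.emb p) ∧
    inner T b S (Sum.inl p) = Sum.inl (b p) ∧
    inner T b S (Sum.inr (T.emb p)) = Sum.inr (T.emb (b p)) ∧
    inner T b (S ∪ {p, b p}) (inner T b S (Sum.inl p)) = inner T b S (Sum.inr (T.emb p)) := by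
  have h1 := inner_inl_notMem T b hp
  have h2 := inner_emb_notMem T b hp
  refine ⟨inner_inl_mem T b (Or.inr (Or.inl rfl)), h1, h2, ?_⟩
  rw [h1, h2, inner_inl_mem T b (Or.inr (Or.inr rfl))]

lemma tail_ok {p : P} {l : List P} (hl : (p :: l).Nodup) (hlt : ∀ x ∈ p :: l, x < b x)
    (hlS : ∀ x ∈ p :: l, x ∉ S) : ∀ x ∈ l, x ∉ S ∪ {p, b p} := by
  rintro x hx (h | h | h)
  · exact hlS x (List.mem_cons_of_mem _ hx) h
  · exact (List.nodup_cons.1 hl).1 (h ▸ hx)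
  · have h1 := hlt x (List.mem_cons_of_mem _ hx)
    have h2 := hlt p List.mem_cons_self
    rw [Set.mem_singleton_iff.1 h, b.invol] at h1
    exact (h1.trans h2).false

variable [Fintype Q] (c : Matching P) (d : Matching Q)

lemma step_iff [Finite P] (hS : ∀ p, p ∈ S → b p ∈ S) {p : P} (hp : p ∉ S) :
    sameCircle (outer c d) (inner T b S) (Sum.inl p) (Sum.inr (T.emb p)) ↔
      ¬ sameCircle (outer c d) (inner T b (S ∪ {p, b p})) (Sum.inl p) (Sum.inl (b p)) := by
  obtain ⟨h1, h2, h3, h4⟩ := step_data T b hp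
  have := saddle_iff (outer_invol c d) (inner_invol T b hS)
    (inner_invol T b (closed_insert b hS p)) (orient_outer T c d) (orient_inner T b)
    (orient_inner T b) h1 h4 (by rw [h2]; simp)
    (fun v e1 e2 e3 e4 => inner_insert_ne T b v e1 (h2 ▸ e2) e3 (h3 ▸ e4))
  rwa [h2] at this

open Classical in
lemma step_sum [Finite P] (hS : ∀ p, p ∈ S → b p ∈ S) {p : P} (hp : p ∉ S) {g : P ⊕ Q → ℤ}
    (hg : Compat T c d g) (hb : ∀ p, g (Sum.inl (b p)) = g (Sum.inl p)) :
    circleSum (sameCircle (outer c d) (inner T b (S ∪ {p, b p}))) g -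
      circleSum (sameCircle (outer c d) (inner T b S)) g =
    if sameCircle (outer c d) (inner T b S) (Sum.inl p) (Sum.inr (T.emb p)) then
      g (Sum.inl p) else - g (Sum.inl p) := by
  obtain ⟨h1, h2, h3, h4⟩ := step_data T b hp
  exact circleSum_saddle (outer_invol c d) (inner_invol T b hS)
    (inner_invol T b (closed_insert b hS p)) (orient_outer T c d) (orient_inner T b)
    (orient_inner T b) h1 h4 (by rw [h2]; simp)
    (fun v e1 e2 e3 e4 => inner_insert_ne T b v e1 (h2 ▸ e2) e3 (h3 ▸ e4)) g
    hg.outer (hg.inner T b (fun p _ => hb p)) (hg.inner T b (fun p _ => hb p))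

lemma splittings_sum [Finite P] {g : P ⊕ Q → ℤ} (hg : Compat T c d g)
    (hb : ∀ p, g (Sum.inl (b p)) = g (Sum.inl p)) (l : List P) :
    ∀ S : Set P, (∀ p, p ∈ S → b p ∈ S) → l.Nodup → (∀ x ∈ l, x < b x) → (∀ x ∈ l, x ∉ S) →
    2 * ((splittings T c b d l S).map (fun p => g (Sum.inl p))).sum =
      (l.map (fun p => g (Sum.inl p))).sum +
      circleSum (sameCircle (outer c d) (inner T b (S ∪ {x | x ∈ l ∨ b x ∈ l}))) g -
      circleSum (sameCircle (outer c d) (inner T b S)) g := by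
  induction l with
  | nil => intro S _ _ _ _; simp [splittings]
  | cons p l ih =>
    intro S hS hl hlt hlS
    have ih' := ih (S ∪ {p, b p}) (closed_insert b hS p) (List.nodup_cons.1 hl).2
      (fun x hx => hlt x (List.mem_cons_of_mem _ hx)) (tail_ok b hl hlt hlS)
    have hs := step_sum T b c d hS (hlS p List.mem_cons_self) hg hb
    have hset : S ∪ {p, b p} ∪ {x | x ∈ l ∨ b x ∈ l} = S ∪ {x | x ∈ p :: l ∨ b x ∈ p :: l} := by
      ext x
      have : x = b p ↔ b x = p :=
        ⟨fun h => by rw [h, b.invol], fun h => by rw [← h, b.invol]⟩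
      simp only [Set.mem_union, Set.mem_insert_iff, Set.mem_singleton_iff, Set.mem_ofPred_eq,
        List.mem_cons, this]
      tauto
    rw [hset] at ih'
    rw [splittings]
    split_ifs at hs ⊢ with h
    · simp only [List.map_cons, List.sum_cons]; linarith
    · simp only [List.map_cons, List.sum_cons]; linarith

lemma splittings_bad [Finite P] {X : Type} {κ : P ⊕ Q → X} (hκ : Compat T c d κ) (l : List P) :
    ∀ S : Set P, (∀ p, p ∈ S → b p ∈ S) → l.Nodup → (∀ x ∈ l, x < b x) → (∀ x ∈ l, x ∉ S) →
    (∀ p, p ∉ S → p ∉ l → b p ∉ l → κ (Sum.inl (b p)) = κ (Sum.inl p)) →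
    (∃ p ∈ l, κ (Sum.inl (b p)) ≠ κ (Sum.inl p)) →
    ∃ p ∈ splittings T c b d l S, κ (Sum.inl (b p)) ≠ κ (Sum.inl p) := by
  induction l with
  | nil => rintro S _ _ _ _ _ ⟨p, hp, -⟩; simp at hp
  | cons p l ih =>
    intro S hS hl hlt hlS hout hbad
    by_cases hbad' : ∃ p ∈ l, κ (Sum.inl (b p)) ≠ κ (Sum.inl p)
    · obtain ⟨x, hx, hx'⟩ := ih (S ∪ {p, b p}) (closed_insert b hS p) (List.nodup_cons.1 hl).2
        (fun x hx => hlt x (List.mem_cons_of_mem _ hx)) (tail_ok b hl hlt hlS)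
        (fun x hx hxl hbl => hout x (fun h => hx (Or.inl h))
          (by
            rw [List.mem_cons, not_or]
            exact ⟨fun h => hx (Or.inr (Or.inl h)), hxl⟩)
          (by
            rw [List.mem_cons, not_or]
            exact ⟨fun h => hx (Or.inr (Or.inr (by
              rw [Set.mem_singleton_iff, ← h, b.invol]))), hbl⟩)) hbad'
      refine ⟨x, ?_, hx'⟩
      rw [splittings]
      split_ifs
      · exact List.mem_cons_of_mem _ hx
      · exact hx
    · push Not at hbad'
      obtain ⟨x, hx, hx'⟩ := hbad
      rcases List.mem_cons.1 hx with rfl | hxl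
      · refine ⟨x, ?_, hx'⟩
        rw [splittings, if_pos]
        · exact List.mem_cons_self
        · rw [step_iff T b c d hS (hlS x List.mem_cons_self)]
          intro h
          apply hx'
          refine (sameCircle_inv (g := κ) hκ.outer (hκ.inner T b ?_) h).symm
          intro y hy
          by_cases hyl : y ∈ l
          · exact hbad' y hyl
          by_cases hbl : b y ∈ l
          · have := hbad' _ hbl
            rw [b.invol] at this
            exact this.symm
          · refine hout y (fun h => hy (Or.inl h)) ?_ ?_
            · rw [List.mem_cons, not_or]
              exact ⟨fun h => hy (Or.inr (Or.inl h)), hyl⟩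
            · rw [List.mem_cons, not_or]
              exact ⟨fun h => hy (Or.inr (Or.inr (by
                rw [Set.mem_singleton_iff, ← h, b.invol]))), hbl⟩
      · exact absurd (hbad' x hxl) hx'

end
end Contraction
end ArcAlgebra

namespace ArcAlgebra

/-! ### The two-dimensional TQFT on closed 1-manifolds -/

section TQFT

variable {P : Type}

/-- The ideal generated by `X_p ^ 2` and by `X_p - X_q` for `p`, `q` on the same circle. -/
noncomputable def relIdeal (r : Setoid P) : Ideal (MvPolynomial P ℤ) :=
  Ideal.span ({f | ∃ p, f = MvPolynomial.X p ^ 2} ∪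
    {f | ∃ p q, r p q ∧ f = MvPolynomial.X p - MvPolynomial.X q})

/-- The abelian group `𝒜 ^ {⊗ I}`, `𝒜 = ℤ[X]/(X ^ 2)`, assigned to a closed 1-manifold all of
whose circles contain marked points from `P`; here `r` is the relation "on the same circle", `I`
is the set of circles, and the class of `X_p` is the generator `X` in the tensor factor of the
circle through `p`. -/
noncomputable abbrev TQFT (r : Setoid P) : Type := MvPolynomial P ℤ ⧸ relIdeal r

/-- The quotient map. -/
noncomputable abbrev TQFT.mk (r : Setoid P) : MvPolynomial P ℤ →+* TQFT r := Ideal.Quotient.mk (relIdeal r)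

/-- The grading with `1 ∈ 𝒜` in degree `-1` and `X ∈ 𝒜` in degree `1`: a monomial of degree `k` in
the variables has degree `2 k - (number of circles)`. -/
noncomputable def TQFT.degree (r : Setoid P) (n : ℤ) : AddSubgroup (TQFT r) :=
  AddSubgroup.closure {y | ∃ (f : MvPolynomial P ℤ) (k : ℕ), f.IsHomogeneous k ∧
    2 * (k : ℤ) - numCircles r = n ∧ y = TQFT.mk r f}

lemma TQFT.mk_surj {r : Setoid P} (x : TQFT r) : ∃ f, TQFT.mk r f = x :=
  Ideal.Quotient.mk_surjective x

lemma TQFT.mk_X {r : Setoid P} {p q : P} (h : r p q) :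
    TQFT.mk r (MvPolynomial.X p) = TQFT.mk r (MvPolynomial.X q) :=
  Ideal.Quotient.eq.2 (Ideal.subset_span (Or.inr ⟨p, q, h, rfl⟩))

lemma TQFT.mk_X_sq (r : Setoid P) (p : P) : TQFT.mk r (MvPolynomial.X p ^ 2) = 0 :=
  Ideal.Quotient.eq_zero_iff_mem.2 (Ideal.subset_span (Or.inl ⟨p, rfl⟩))

lemma TQFT.mk_rename_out (r : Setoid P) (f : MvPolynomial P ℤ) :
    TQFT.mk r (MvPolynomial.rename (fun p => (Quotient.mk r p).out) f) = TQFT.mk r f := by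
  have : (TQFT.mk r).comp (MvPolynomial.rename
      (fun p => (Quotient.mk r p).out) : MvPolynomial P ℤ →ₐ[ℤ] MvPolynomial P ℤ).toRingHom =
      TQFT.mk r := by
    apply MvPolynomial.ringHom_ext
    · intro n; simp
    · intro p
      simp only [AlgHom.toRingHom_eq_coe, RingHom.coe_comp, RingHom.coe_coe, Function.comp_apply,
        MvPolynomial.rename_X]
      exact TQFT.mk_X (Quotient.exact (Quotient.out_eq _))
  exact congrArg (fun φ => φ f) this

/-- Evaluation of polynomials at the points `X_p = ± t`. -/
noncomputable def ev (κ : P → Bool) : MvPolynomial P ℤ →ₐ[ℤ] Polynomial ℤ :=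
  MvPolynomial.aeval (fun p => if κ p then Polynomial.X else -Polynomial.X)

lemma ev_X (κ : P → Bool) (p : P) :
    ev κ (MvPolynomial.X p) = if κ p then Polynomial.X else -Polynomial.X := by
  simp [ev]

lemma ev_rename {Q : Type} (e : P → Q) (κ : Q → Bool) (f : MvPolynomial P ℤ) :
    ev κ (MvPolynomial.rename e f) = ev (κ ∘ e) f := by
  simp [ev, MvPolynomial.aeval_rename, Function.comp_def]

/-- A polynomial which vanishes at all colourings by `± t` of the circles vanishes in `TQFT r`. -/
lemma mk_eq_zero_of_ev [Finite P] (r : Setoid P) (f : MvPolynomial P ℤ)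
    (h : ∀ κ : P → Bool, (∀ p q, r p q → κ p = κ q) → ev κ f = 0) : TQFT.mk r f = 0 := by
  classical
  rw [← TQFT.mk_rename_out]
  set ρ : P → P := fun p => (Quotient.mk r p).out with hρ
  set f' := MvPolynomial.rename ρ f with hf'
  let S : P → Finset (Polynomial ℤ) := fun _ => {Polynomial.X, -Polynomial.X}
  have hXne : (Polynomial.X : Polynomial ℤ) ≠ -Polynomial.X := by
    intro h
    have := congrArg (fun p => Polynomial.coeff p 1) h
    simp at this
  obtain ⟨c, -, hc⟩ := MvPolynomial.combinatorial_nullstellensatz_exists_linearCombination S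
    (fun _ => ⟨Polynomial.X, by simp [S]⟩) (MvPolynomial.map Polynomial.C f') (by
      intro x hx
      have hx' : ∀ p, x p = if decide (x p = Polynomial.X) then Polynomial.X else -Polynomial.X := by
        intro p
        have := hx p
        simp only [S, Finset.mem_insert, Finset.mem_singleton] at this
        rcases this with h | h
        · simp [h]
        · rw [h]; simp [hXne.symm]
      have key : MvPolynomial.eval x (MvPolynomial.map Polynomial.C f') =
          ev (fun p => decide (x p = Polynomial.X)) f' := by
        rw [ev, MvPolynomial.eval_map, MvPolynomial.aeval_def]
        congr 1
        funext p; exact hx' p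
      rw [key, hf', ev_rename]
      apply h
      intro p q hpq
      simp only [Function.comp_apply, hρ]
      rw [Quotient.sound (s := r) hpq])
  have h0 := congrArg (MvPolynomial.map (Polynomial.evalRingHom (0 : ℤ))) hc
  rw [MvPolynomial.map_map, Finsupp.linearCombination_apply, Finsupp.sum, map_sum] at h0
  have hid : (Polynomial.evalRingHom (0 : ℤ)).comp Polynomial.C = RingHom.id ℤ := by
    ext; simp
  rw [hid, MvPolynomial.map_id] at h0
  rw [h0, map_sum]
  apply Finset.sum_eq_zero
  intro i _
  have hprod : MvPolynomial.map (Polynomial.evalRingHom (0 : ℤ))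
      (∏ s ∈ S i, (MvPolynomial.X i - MvPolynomial.C s)) = MvPolynomial.X i ^ 2 := by
    rw [Finset.prod_insert (by simpa using hXne), Finset.prod_singleton]
    simp [sq]
  rw [smul_eq_mul, map_mul, hprod, map_mul, TQFT.mk_X_sq, mul_zero]

lemma mk_eq_of_ev [Finite P] (r : Setoid P) (f f' : MvPolynomial P ℤ)
    (h : ∀ κ : P → Bool, (∀ p q, r p q → κ p = κ q) → ev κ f = ev κ f') :
    TQFT.mk r f = TQFT.mk r f' := by
  rw [← sub_eq_zero, ← map_sub]
  exact mk_eq_zero_of_ev r _ (fun κ hκ => by rw [map_sub, h κ hκ, sub_self])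

end TQFT

/-! ### Evaluation of the contraction polynomial -/

section Eval

lemma circleSum_sum {V W : Type} [Finite V] [Finite W] (α β : V → V) (α' β' : W → W)
    (g : V ⊕ W → ℤ)
    (hg1 : ∀ v w, sameCircle α β v w → g (Sum.inl v) = g (Sum.inl w))
    (hg2 : ∀ v w, sameCircle α' β' v w → g (Sum.inr v) = g (Sum.inr w)) :
    circleSum (sameCircle (Sum.map α α') (Sum.map β β')) g =
      circleSum (sameCircle α β) (fun v => g (Sum.inl v)) +
      circleSum (sameCircle α' β') (fun w => g (Sum.inr w)) := by
  classical
  set r := sameCircle (Sum.map α α') (Sum.map β β') with hr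
  set s1 := sameCircle α β with hs1
  set s2 := sameCircle α' β' with hs2
  let := Fintype.ofFinite (Quotient r)
  let := Fintype.ofFinite (Quotient s1)
  let := Fintype.ofFinite (Quotient s2)
  unfold circleSum
  have h1 : ∀ v w, s1 v w → r (Sum.inl v) (Sum.inl w) := fun v w h =>
    sameCircle_le (r := r.comap Sum.inl) (fun v => sameCircle_left _ _ (Sum.inl v))
      (fun v => sameCircle_right _ _ (Sum.inl v)) h
  have h2 : ∀ v w, s2 v w → r (Sum.inr v) (Sum.inr w) := fun v w h =>
    sameCircle_le (r := r.comap Sum.inr) (fun v => sameCircle_left _ _ (Sum.inr v))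
      (fun v => sameCircle_right _ _ (Sum.inr v)) h
  let G : V ⊕ W → Quotient s1 ⊕ Quotient s2 := Sum.map (Quotient.mk s1) (Quotient.mk s2)
  have hG : ∀ x y, r x y → G x = G y := fun x y h => by
    refine sameCircle_inv (g := G) ?_ ?_ h
    · rintro (v | v)
      · exact congrArg Sum.inl (Quotient.sound (s1.symm (sameCircle_left α β v)))
      · exact congrArg Sum.inr (Quotient.sound (s2.symm (sameCircle_left α' β' v)))
    · rintro (v | v)
      · exact congrArg Sum.inl (Quotient.sound (s1.symm (sameCircle_right α β v)))
      · exact congrArg Sum.inr (Quotient.sound (s2.symm (sameCircle_right α' β' v)))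
  let φ : Quotient r → Quotient s1 ⊕ Quotient s2 := Quotient.lift G hG
  have hφ : Function.Bijective φ := by
    constructor
    · rintro ⟨v | v⟩ ⟨w | w⟩ h
      · exact Quotient.sound (h1 v w (Quotient.exact (Sum.inl_injective h)))
      · exact absurd h (by simp [φ, G])
      · exact absurd h (by simp [φ, G])
      · exact Quotient.sound (h2 v w (Quotient.exact (Sum.inr_injective h)))
    · rintro (v | v)
      · obtain ⟨v, rfl⟩ := Quotient.exists_rep v
        exact ⟨Quotient.mk r (Sum.inl v), rfl⟩
      · obtain ⟨v, rfl⟩ := Quotient.exists_rep v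
        exact ⟨Quotient.mk r (Sum.inr v), rfl⟩
  let H : Quotient s1 ⊕ Quotient s2 → ℤ :=
    Sum.elim (fun C => g (Sum.inl C.out)) (fun C => g (Sum.inr C.out))
  refine (Fintype.sum_bijective φ hφ (fun C => g C.out) H (fun C => ?_)).trans
    (Fintype.sum_sum_type H)
  have hC : φ C = G C.out := by
    conv_lhs => rw [← Quotient.out_eq C]
    rfl
  rw [hC]
  rcases C.out with v | v
  · exact hg1 _ _ (s1.symm (Quotient.exact (Quotient.out_eq (Quotient.mk s1 v))))
  · exact hg2 _ _ (s2.symm (Quotient.exact (Quotient.out_eq (Quotient.mk s2 v))))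

variable {P Q : Type} [LinearOrder P] [LinearOrder Q] [Fintype P] [Fintype Q]
  (T : CupTangle P Q) (c b : Matching P) (d : Matching Q)

lemma mem_leftEnds (p : P) : p ∈ b.leftEnds ↔ p < b p := by
  simp [Matching.leftEnds]

lemma nodup_leftEnds : b.leftEnds.Nodup := Finset.sort_nodup _ _

lemma leftEnds_or (p : P) : p ∈ b.leftEnds ∨ b p ∈ b.leftEnds := by
  rw [mem_leftEnds, mem_leftEnds, b.invol]
  exact (lt_or_gt_of_ne (b.ne p)).symm

/-- The weighted number of arcs of a matching. -/
noncomputable def arcSum (g : P → ℤ) : ℤ := (b.leftEnds.map g).sum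

lemma circleSum_end (g : P ⊕ Q → ℤ) (hg : Compat T c d g) :
    circleSum (sameCircle (outer c d) (inner T b Set.univ)) g =
      circleSum (circles d (T.cup c)) (fun q => g (Sum.inr q)) := by
  have hin := fun p => inner_inl_mem T b (S := Set.univ) (p := p) trivial
  have hin' := fun p => inner_emb_mem T b (S := Set.univ) (p := p) trivial
  set r := sameCircle (outer c d) (inner T b Set.univ) with hr
  have hvert : ∀ p, r (Sum.inl p) (Sum.inr (T.emb p)) := fun p => by
    rw [← hin]; exact sameCircle_right _ _ _
  have hv : ∀ v, r v (Sum.inr (Sum.elim T.emb (fun q => q) v)) := by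
    rintro (p | q)
    · exact hvert p
    · exact r.refl _
  refine circleSum_equiv r (circles d (T.cup c)) g _ (Sum.elim T.emb (fun q => q))
    (fun v w => ⟨fun h => ?_, fun h => ?_⟩) (fun q => ⟨Sum.inr q, Setoid.refl' _ q⟩) ?_ ?_
  · refine sameCircle_le (r := (circles d (T.cup c)).comap (Sum.elim T.emb (fun q => q))) ?_ ?_ h
    · rintro (p | q)
      · change circles d (T.cup c) (T.emb p) (T.emb (c p))
        rw [← T.cup_emb]; exact sameCircle_right _ _ _
      · exact sameCircle_left _ _ _
    · intro v
      induction v using inner_cases T Set.univ with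
      | h1 p _ => rw [hin]; exact Setoid.refl' (circles d (T.cup c)) (T.emb p)
      | h2 p h => exact absurd trivial h
      | h3 p _ => rw [hin']; exact Setoid.refl' (circles d (T.cup c)) (T.emb p)
      | h4 p h => exact absurd trivial h
      | h5 q h =>
        rw [inner_off T b h]
        change circles d (T.cup c) q (T.arc q)
        rw [← T.cup_off c q h]; exact sameCircle_right _ _ _
  · have : ∀ q q', circles d (T.cup c) q q' → r (Sum.inr q) (Sum.inr q') := fun q q' h => by
      refine sameCircle_le (r := r.comap Sum.inr) (fun q => ?_) (fun q => ?_) h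
      · exact sameCircle_left (outer c d) _ (Sum.inr q)
      · change r (Sum.inr q) (Sum.inr (T.cup c q))
        by_cases hq : q ∈ Set.range T.emb
        · obtain ⟨p, rfl⟩ := hq
          rw [T.cup_emb]
          exact r.trans (r.symm (hvert p)) (r.trans (sameCircle_left _ _ (Sum.inl p)) (hvert _))
        · rw [T.cup_off c q hq, ← inner_off T b hq]; exact sameCircle_right _ _ _
    exact r.trans (hv v) (r.trans (this _ _ h) (r.symm (hv w)))
  · rintro (p | q)
    · exact hg.vert p
    · rfl
  · intro q q' h
    refine sameCircle_inv (g := fun q => g (Sum.inr q)) (fun q => hg.outer (Sum.inr q)) ?_ h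
    exact (T.cup_inv (κ := fun q => g (Sum.inr q)) c).2 ⟨fun p => by
      rw [hg.vert, hg.vert]; exact hg.outer (Sum.inl p), hg.arc⟩

lemma circleSum_start (g : P ⊕ Q → ℤ) (hg : Compat T c d g)
    (hb : ∀ p, g (Sum.inl (b p)) = g (Sum.inl p)) :
    circleSum (sameCircle (outer c d) (inner T b ∅)) g =
      circleSum (circles c b) (fun p => g (Sum.inl p)) +
      circleSum (circles d (T.cup b)) (fun q => g (Sum.inr q)) := by
  have : inner T b ∅ = Sum.map b (T.cup b) := by
    funext v
    induction v using inner_cases T ∅ with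
    | h1 p h => exact absurd h (Set.notMem_empty p)
    | h2 p h => rw [inner_inl_notMem T b h]; rfl
    | h3 p h => exact absurd h (Set.notMem_empty p)
    | h4 p h => rw [inner_emb_notMem T b h]; simp
    | h5 q h => rw [inner_off T b h]; simp [T.cup_off b q h]
  rw [this]
  refine circleSum_sum _ _ _ _ g (fun v w h => ?_) (fun v w h => ?_)
  · exact sameCircle_inv (g := fun p => g (Sum.inl p)) (fun p => hg.outer (Sum.inl p)) hb h
  · exact sameCircle_inv (g := fun q => g (Sum.inr q)) (fun p => hg.outer (Sum.inr p))
      ((T.cup_inv (κ := fun q => g (Sum.inr q)) b).2 ⟨fun p => by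
      rw [hg.vert, hg.vert]; exact hb p, hg.arc⟩) h

/-- The weighted number of splittings, doubled. -/
noncomputable def thetaSum (g : Q → ℤ) : ℤ :=
  arcSum b (g ∘ T.emb) + circleSum (circles d (T.cup c)) g -
    circleSum (circles c b) (g ∘ T.emb) - circleSum (circles d (T.cup b)) g

/-- `κ` is constant along the arcs of a matching. -/
def Inv {P X : Type} [LinearOrder P] (κ : P → X) (a : Matching P) : Prop := ∀ p, κ (a p) = κ p

lemma inv_circles {P X : Type} [LinearOrder P] {κ : P → X} {b a : Matching P} :
    (∀ p q, circles b a p q → κ p = κ q) ↔ Inv κ b ∧ Inv κ a :=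
  ⟨fun h => ⟨fun p => (h _ _ (sameCircle_left _ _ p)).symm,
    fun p => (h _ _ (sameCircle_right _ _ p)).symm⟩,
   fun h _ _ hpq => sameCircle_inv h.1 h.2 hpq⟩

lemma compat_of_inv {X : Type} {g : Q → X} (hd : Inv g d) (hc : Inv g (T.cup c)) :
    Compat T c d (Sum.elim (g ∘ T.emb) g) where
  outer := by
    rintro (p | q)
    · exact ((T.cup_inv c).1 hc).1 p
    · exact hd q
  vert p := rfl
  arc := ((T.cup_inv c).1 hc).2

lemma splittings_length (g : Q → ℤ) (hd : Inv g d) (hc : Inv g (T.cup c))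
    (hb : Inv g (T.cup b)) :
    2 * ((splittings T c b d b.leftEnds ∅).map (fun p => g (T.emb p))).sum =
      thetaSum T c b d g := by
  have hg := compat_of_inv T c d hd hc
  have hb' : ∀ p, g (T.emb (b p)) = g (T.emb p) := ((T.cup_inv b).1 hb).1
  have := splittings_sum T b c d hg hb' b.leftEnds ∅ (fun p h => absurd h (Set.notMem_empty p))
    (nodup_leftEnds b) (fun x hx => (mem_leftEnds b x).1 hx) (fun x _ => Set.notMem_empty x)
  have huniv : (∅ : Set P) ∪ {x | x ∈ b.leftEnds ∨ b x ∈ b.leftEnds} = Set.univ :=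
    Set.eq_univ_of_forall (fun x => Or.inr (leftEnds_or b x))
  rw [huniv, circleSum_end T c b d _ hg, circleSum_start T c b d _ hg hb'] at this
  simp only [Sum.elim_inl, Sum.elim_inr] at this
  unfold thetaSum arcSum
  have e : (fun p => g (T.emb p)) = g ∘ T.emb := rfl
  simp only [Function.comp_apply, e] at this ⊢
  rw [this]
  simp only [Function.comp_def]
  ring

/-- The value of a monomial expression in `2 t` and `-1` whose exponents are recorded doubled. -/
def IsWt (F : Polynomial ℤ) (N M : ℤ) : Prop :=
  ∃ s m : ℕ, 2 * (s : ℤ) = N ∧ 2 * (m : ℤ) = M ∧ F = (2 * Polynomial.X) ^ s * (-1) ^ m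

lemma IsWt.mul {F G : Polynomial ℤ} {N M N' M' : ℤ} (h : IsWt F N M) (h' : IsWt G N' M') :
    IsWt (F * G) (N + N') (M + M') := by
  obtain ⟨s, m, h1, h2, rfl⟩ := h
  obtain ⟨s', m', h1', h2', rfl⟩ := h'
  exact ⟨s + s', m + m', by push_cast; linarith, by push_cast; linarith, by ring⟩

lemma IsWt.eq {F G : Polynomial ℤ} {N M N' M' : ℤ} (h : IsWt F N M) (h' : IsWt G N' M')
    (hN : N = N') (hM : M = M') : F = G := by
  obtain ⟨s, m, h1, h2, rfl⟩ := h
  obtain ⟨s', m', h1', h2', rfl⟩ := h'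
  have : s = s' := by omega
  have : m = m' := by omega
  subst_vars
  rfl

/-- The indicator function of one colour. -/
def minus {Q : Type} (κ : Q → Bool) (q : Q) : ℤ := if κ q then 0 else 1

lemma ev_theta (κ : Q → Bool) (hd : Inv κ d) (hc : Inv κ (T.cup c)) (hb : Inv κ (T.cup b)) :
    IsWt (ev κ (theta T c b d)) (thetaSum T c b d (fun _ => 1))
      (thetaSum T c b d (minus κ)) := by
  have h1 := splittings_length T c b d (fun _ => 1) (fun _ => rfl) (fun _ => rfl) (fun _ => rfl)
  have h2 := splittings_length T c b d (minus κ) (fun q => by simp only [minus]; rw [hd])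
    (fun q => by simp only [minus]; rw [hc]) (fun q => by simp only [minus]; rw [hb])
  have hb' : ∀ p, κ (T.emb (b p)) = κ (T.emb p) := ((T.cup_inv b).1 hb).1
  rw [← h1, ← h2, theta]
  generalize splittings T c b d b.leftEnds ∅ = l
  refine ⟨l.length, (l.filter (fun p => !κ (T.emb p))).length, by simp, ?_, ?_⟩
  · congr 1
    induction l with
    | nil => simp
    | cons p l ih =>
      rw [List.map_cons, List.sum_cons, ← ih, List.filter_cons]
      cases h : κ (T.emb p) <;> simp [minus, h]; ring
  · induction l with
    | nil => simp
    | cons p l ih =>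
      rw [List.map_cons, List.prod_cons, map_mul, ih, map_add, ev_X, ev_X, hb', List.filter_cons]
      cases h : κ (T.emb p) <;> simp <;> ring

lemma ev_theta_zero (κ : Q → Bool) (hd : Inv κ d) (hc : Inv κ (T.cup c))
    (hb : ¬ Inv κ (T.cup b)) : ev κ (theta T c b d) = 0 := by
  have hκ := compat_of_inv T c d hd hc
  have harc := ((T.cup_inv c).1 hc).2
  have hbad : ∃ p, κ (T.emb (b p)) ≠ κ (T.emb p) := by
    by_contra h
    push Not at h
    exact hb ((T.cup_inv b).2 ⟨h, harc⟩)
  have hbad' : ∃ p ∈ b.leftEnds, κ (T.emb (b p)) ≠ κ (T.emb p) := by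
    obtain ⟨p, hp⟩ := hbad
    rcases leftEnds_or b p with h | h
    · exact ⟨p, h, hp⟩
    · exact ⟨b p, h, by rw [b.invol]; exact hp.symm⟩
  obtain ⟨p, hp, hpκ⟩ := splittings_bad T b c d hκ b.leftEnds ∅
    (fun p h => absurd h (Set.notMem_empty p))
    (nodup_leftEnds b) (fun x hx => (mem_leftEnds b x).1 hx) (fun x _ => Set.notMem_empty x)
    (fun p _ h h' => by rcases leftEnds_or b p with h'' | h'' <;> contradiction) hbad'
  rw [theta, map_list_prod]
  apply List.prod_eq_zero
  rw [List.map_map, List.mem_map]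
  refine ⟨p, hp, ?_⟩
  simp only [Sum.elim_inl, Function.comp_apply] at hpκ ⊢
  rw [map_add, ev_X, ev_X]
  cases h : κ (T.emb p) <;> cases h' : κ (T.emb (b p)) <;> simp_all

/-- The contraction polynomial is homogeneous. -/
lemma theta_homogeneous : ∃ k : ℕ, (theta T c b d).IsHomogeneous k ∧
    2 * (k : ℤ) = thetaSum T c b d (fun _ => 1) := by
  have h1 := splittings_length T c b d (fun _ => 1) (fun _ => rfl) (fun _ => rfl) (fun _ => rfl)
  rw [← h1, theta]
  generalize splittings T c b d b.leftEnds ∅ = l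
  refine ⟨l.length, ?_, by simp⟩
  induction l with
  | nil => exact MvPolynomial.isHomogeneous_one _ _
  | cons p l ih =>
    rw [List.map_cons, List.prod_cons, List.length_cons, add_comm l.length]
    exact ((MvPolynomial.isHomogeneous_X _ _).add (MvPolynomial.isHomogeneous_X _ _)).mul ih

lemma card_leftEnds : 2 * b.leftEnds.length = Fintype.card P := by
  rw [Matching.leftEnds, Finset.length_sort, two_mul]
  have : (Finset.univ.filter (fun p => p < b p)).card =
      (Finset.univ.filter (fun p => ¬ p < b p)).card := by
    refine Finset.card_bij (fun p _ => b p) ?_ ?_ ?_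
    · intro p hp
      simp only [Finset.mem_filter, Finset.mem_univ, true_and, b.invol] at hp ⊢
      exact not_lt.2 hp.le
    · intro p _ q _ h
      rw [← b.invol p, h, b.invol]
    · intro p hp
      simp only [Finset.mem_filter, Finset.mem_univ, true_and] at hp
      refine ⟨b p, ?_, b.invol p⟩
      simp only [Finset.mem_filter, Finset.mem_univ, true_and, b.invol]
      exact lt_of_le_of_ne (not_lt.1 hp) (b.ne p)
  conv_lhs => rw [this]
  conv_lhs => lhs; rw [← this]
  rw [Finset.card_filter_add_card_filter_not, Finset.card_univ]

lemma arcSum_one : arcSum b (fun _ => 1) = (Fintype.card P / 2 : ℕ) := by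
  have := card_leftEnds b
  simp only [arcSum, List.map_const', List.sum_replicate, nsmul_eq_mul, mul_one]
  congr 1; omega

end Eval
end ArcAlgebra

namespace ArcAlgebra

section Contract

variable {P Q : Type} [LinearOrder P] [LinearOrder Q] [Fintype P] [Fintype Q]

/-- The map `ℱ(W(c)b) ⊗ ℱ(W(d)Tb) → ℱ(W(d)Tc)` induced by the cobordism which contracts `b` with
`W(b)`, computed on polynomials that represent the two arguments. Here `r₁`, `r₂`, `r₃` are the
relations "on the same circle" for the three closed 1-manifolds (or for their mirror images). -/
noncomputable def contract (T : CupTangle P Q) (c b : Matching P) (d : Matching Q)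
    {r₁ : Setoid P} {r₂ r₃ : Setoid Q} (x : TQFT r₁) (y : TQFT r₂) : TQFT r₃ :=
  TQFT.mk r₃ (MvPolynomial.rename T.emb (Quotient.out x) * Quotient.out y * theta T c b d)

lemma circles_comm {P : Type} [LinearOrder P] (b a : Matching P) : circles b a = circles a b :=
  le_antisymm
    (fun _ _ h => sameCircle_le (fun v => sameCircle_right _ _ v) (fun v => sameCircle_left _ _ v) h)
    (fun _ _ h => sameCircle_le (fun v => sameCircle_right _ _ v) (fun v => sameCircle_left _ _ v) h)

lemma theta_kill (T : CupTangle P Q) (c b : Matching P) (d : Matching Q)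
    (f : MvPolynomial Q ℤ) (hf : ∀ κ : Q → Bool, Inv κ d → Inv κ (T.cup c) → Inv κ (T.cup b) →
      ev κ f = 0) : TQFT.mk (circles d (T.cup c)) (f * theta T c b d) = 0 := by
  refine mk_eq_zero_of_ev _ _ (fun κ hκ => ?_)
  obtain ⟨hd, hc⟩ := inv_circles.1 hκ
  rw [map_mul]
  by_cases hb : Inv κ (T.cup b)
  · rw [hf κ hd hc hb, zero_mul]
  · rw [ev_theta_zero T c b d κ hd hc hb, mul_zero]

/-- The contraction map does not depend on the representing polynomials. -/
lemma contract_mk (T : CupTangle P Q) (c b : Matching P) (d : Matching Q)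
    {r₁ : Setoid P} {r₂ r₃ : Setoid Q} (h₁ : r₁ = circles c b) (h₂ : r₂ = circles d (T.cup b))
    (h₃ : r₃ = circles d (T.cup c)) (f : MvPolynomial P ℤ) (g : MvPolynomial Q ℤ) :
    (contract T c b d (TQFT.mk r₁ f) (TQFT.mk r₂ g) : TQFT r₃) =
      TQFT.mk r₃ (MvPolynomial.rename T.emb f * g * theta T c b d) := by
  subst h₁ h₂ h₃
  set r₃ := circles d (T.cup c) with hr₃
  obtain ⟨A, hA⟩ : ∃ A : Ideal (TQFT r₃),
      ∀ z, z ∈ A ↔ z * TQFT.mk r₃ (theta T c b d) = 0 :=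
    ⟨{ carrier := {z | z * TQFT.mk r₃ (theta T c b d) = 0}
       add_mem' := fun {x y} hx hy => by
        rw [Set.mem_ofPred_eq] at *
        rw [add_mul, hx, hy, add_zero]
       zero_mem' := zero_mul _
       smul_mem' := fun x y hy => by
        rw [Set.mem_ofPred_eq] at *
        rw [smul_eq_mul, mul_assoc, hy, mul_zero] }, fun _ => Iff.rfl⟩
  have h1 : relIdeal (circles c b) ≤ A.comap ((TQFT.mk r₃).comp
      (MvPolynomial.rename T.emb : MvPolynomial P ℤ →ₐ[ℤ] MvPolynomial Q ℤ).toRingHom) := by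
    refine Ideal.span_le.2 ?_
    rintro _ (⟨p, rfl⟩ | ⟨p, q, hpq, rfl⟩)
    · rw [SetLike.mem_coe, Ideal.mem_comap]
      simp only [AlgHom.toRingHom_eq_coe, RingHom.coe_comp, RingHom.coe_coe, Function.comp_apply,
        map_pow, MvPolynomial.rename_X]
      rw [← map_pow, TQFT.mk_X_sq]; exact A.zero_mem
    · rw [SetLike.mem_coe, Ideal.mem_comap]
      rw [hA]
      simp only [AlgHom.toRingHom_eq_coe, RingHom.coe_comp, RingHom.coe_coe, Function.comp_apply,
        map_sub, MvPolynomial.rename_X]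
      rw [← map_sub, ← map_mul]
      refine theta_kill T c b d _ (fun κ _ hc hb => ?_)
      have hc' : Inv (κ ∘ T.emb) c := ((T.cup_inv c).1 hc).1
      have hb' : Inv (κ ∘ T.emb) b := ((T.cup_inv b).1 hb).1
      have : κ (T.emb p) = κ (T.emb q) := inv_circles.2 ⟨hc', hb'⟩ p q hpq
      rw [map_sub, ev_X, ev_X, this, sub_self]
  have h2 : relIdeal (circles d (T.cup b)) ≤ A.comap (TQFT.mk r₃) := by
    refine Ideal.span_le.2 ?_
    rintro _ (⟨p, rfl⟩ | ⟨p, q, hpq, rfl⟩)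
    · rw [SetLike.mem_coe, Ideal.mem_comap]
      rw [TQFT.mk_X_sq]; exact A.zero_mem
    · rw [SetLike.mem_coe, Ideal.mem_comap]
      rw [hA, ← map_mul]
      refine theta_kill T c b d _ (fun κ hd _ hb => ?_)
      rw [map_sub, ev_X, ev_X, inv_circles.2 ⟨hd, hb⟩ p q hpq, sub_self]
  set f' := Quotient.out (TQFT.mk (circles c b) f) with hf'
  set g' := Quotient.out (TQFT.mk (circles d (T.cup b)) g) with hg'
  have hff : f' - f ∈ relIdeal (circles c b) := Ideal.Quotient.eq.1 (Quotient.out_eq _)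
  have hgg : g' - g ∈ relIdeal (circles d (T.cup b)) := Ideal.Quotient.eq.1 (Quotient.out_eq _)
  have e1 := (hA _).1 (h1 hff)
  have e2 := (hA _).1 (h2 hgg)
  simp only [AlgHom.toRingHom_eq_coe, RingHom.coe_comp, RingHom.coe_coe, Function.comp_apply,
    map_sub] at e1 e2
  change TQFT.mk r₃ (MvPolynomial.rename T.emb f' * g' * theta T c b d) = _
  simp only [map_mul]
  linear_combination (TQFT.mk r₃ g') * e1 + (TQFT.mk r₃ (MvPolynomial.rename T.emb f)) * e2

section
variable (T : CupTangle P Q) (c b : Matching P) (d : Matching Q)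
    {r₁ : Setoid P} {r₂ r₃ : Setoid Q} (h₁ : r₁ = circles c b) (h₂ : r₂ = circles d (T.cup b))
    (h₃ : r₃ = circles d (T.cup c))

/-- The contraction map as a biadditive map. -/
noncomputable def contractHom : TQFT r₁ →+ TQFT r₂ →+ TQFT r₃ :=
  AddMonoidHom.mk' (fun x => AddMonoidHom.mk' (fun y => contract T c b d x y) (fun y y' => by
      obtain ⟨f, rfl⟩ := x.mk_surj
      obtain ⟨g, rfl⟩ := y.mk_surj
      obtain ⟨g', rfl⟩ := y'.mk_surj
      rw [← map_add]
      simp only [contract_mk T c b d h₁ h₂ h₃]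
      rw [← map_add]
      congr 1; ring)) (fun x x' => by
    ext y
    obtain ⟨f, rfl⟩ := x.mk_surj
    obtain ⟨f', rfl⟩ := x'.mk_surj
    obtain ⟨g, rfl⟩ := y.mk_surj
    simp only [AddMonoidHom.mk'_apply, AddMonoidHom.add_apply]
    rw [← map_add]
    simp only [contract_mk T c b d h₁ h₂ h₃]
    rw [← map_add, map_add]
    congr 1; ring)

lemma contractHom_apply (x : TQFT r₁) (y : TQFT r₂) :
    contractHom T c b d h₁ h₂ h₃ x y = contract T c b d x y := rfl

/-- The contraction map has degree `m`, the number of contracted arcs. -/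
lemma contract_degree {x : TQFT r₁} {y : TQFT r₂} {i j : ℤ} (h₁ : r₁ = circles c b)
    (h₂ : r₂ = circles d (T.cup b)) (h₃ : r₃ = circles d (T.cup c))
    (hx : x ∈ TQFT.degree r₁ i) (hy : y ∈ TQFT.degree r₂ j) :
    (contract T c b d x y : TQFT r₃) ∈ TQFT.degree r₃ (i + j + (Fintype.card P / 2 : ℕ)) := by
  rw [← contractHom_apply T c b d h₁ h₂ h₃]
  have hxx : TQFT.degree r₁ i ≤ (TQFT.degree r₃ (i + j + (Fintype.card P / 2 : ℕ))).comap
      ((contractHom T c b d h₁ h₂ h₃).flip y) := by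
    refine (AddSubgroup.closure_le _).2 ?_
    rintro _ ⟨f, k, hf, hk, rfl⟩
    rw [SetLike.mem_coe, AddSubgroup.mem_comap, AddMonoidHom.flip_apply]
    have hyy : TQFT.degree r₂ j ≤ (TQFT.degree r₃ (i + j + (Fintype.card P / 2 : ℕ))).comap
        (contractHom T c b d h₁ h₂ h₃ (TQFT.mk r₁ f)) := by
      refine (AddSubgroup.closure_le _).2 ?_
      rintro _ ⟨g, l, hg, hl, rfl⟩
      rw [SetLike.mem_coe, AddSubgroup.mem_comap]
      rw [contractHom_apply, contract_mk T c b d h₁ h₂ h₃]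
      obtain ⟨t, ht, ht2⟩ := theta_homogeneous T c b d
      refine AddSubgroup.subset_closure ⟨_, k + l + t, ((hf.rename_isHomogeneous).mul hg).mul ht,
        ?_, rfl⟩
      unfold thetaSum at ht2
      have e : ((fun _ => 1 : Q → ℤ) ∘ T.emb) = fun _ => 1 := rfl
      rw [e, arcSum_one, circleSum_one, circleSum_one, circleSum_one] at ht2
      subst h₁ h₂ h₃
      push_cast at *
      linarith
    exact hyy hy
  exact hxx hx

end

lemma arcSum_eq_circleSum (b : Matching P) (g : P → ℤ) (hg : Inv g b) :
    circleSum (circles b b) g = arcSum b g := by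
  classical
  have hrel : ∀ p q, circles b b p q → q = p ∨ q = b p := by
    intro p q h
    let r : Setoid P :=
      { r := fun p q => q = p ∨ q = b p
        iseqv := by
          refine ⟨fun p => Or.inl rfl, ?_, ?_⟩
          · rintro x y (rfl | rfl)
            · exact Or.inl rfl
            · exact Or.inr (b.invol _).symm
          · rintro x y z (rfl | rfl) (rfl | rfl)
            · exact Or.inl rfl
            · exact Or.inr rfl
            · exact Or.inr rfl
            · exact Or.inl (b.invol _) }
    exact sameCircle_le (r := r) (fun v => Or.inr rfl) (fun v => Or.inr rfl) h
  let := Fintype.ofFinite (Quotient (circles b b))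
  unfold circleSum arcSum
  have hsum : (b.leftEnds.map g).sum = ∑ p ∈ Finset.univ.filter (fun p => p < b p), g p := by
    rw [Finset.sum_eq_multiset_sum, ← Finset.sort_eq (Finset.univ.filter (fun p => p < b p)) (· ≤ ·)]
    rfl
  rw [hsum]
  symm
  refine Finset.sum_bij (fun p _ => Quotient.mk (circles b b) p) (fun _ _ => Finset.mem_univ _)
    ?_ ?_ ?_
  · intro p hp q hq h
    simp only [Finset.mem_filter, Finset.mem_univ, true_and] at hp hq
    rcases hrel p q (Quotient.exact h) with h | h
    · exact h.symm
    · rw [h, b.invol] at hq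
      exact absurd (hp.trans hq) (lt_irrefl _)
  · rintro C -
    obtain ⟨p, rfl⟩ := Quotient.exists_rep C
    rcases lt_or_gt_of_ne (b.ne p) with h | h
    · exact ⟨b p, by simpa [b.invol] using h,
        Quotient.sound (Setoid.symm' _ (sameCircle_left _ _ p))⟩
    · exact ⟨p, by simpa using h, rfl⟩
  · intro p _
    have := Quotient.exact (Quotient.out_eq (Quotient.mk (circles b b) p))
    exact (inv_circles.2 ⟨hg, hg⟩ _ _ this).symm

/-- Contracting with the identity element. -/
lemma contract_one (T : CupTangle P Q) (c : Matching P) (d : Matching Q)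
    {r₁ : Setoid P} {r₂ : Setoid Q} (h₁ : r₁ = circles c c) (h₂ : r₂ = circles d (T.cup c))
    (y : TQFT r₂) : (contract T c c d (1 : TQFT r₁) y : TQFT r₂) = y := by
  obtain ⟨g, rfl⟩ := y.mk_surj
  rw [← map_one (TQFT.mk r₁), contract_mk T c c d h₁ h₂ h₂]
  apply mk_eq_of_ev
  subst h₂
  intro κ hκ
  obtain ⟨hd, hc⟩ := inv_circles.1 hκ
  have hw := ev_theta T c c d κ hd hc hc
  have hz : ∀ g : Q → ℤ, Inv g (T.cup c) → thetaSum T c c d g = 0 := by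
    intro g hg
    unfold thetaSum
    have hg' : Inv (g ∘ T.emb) c := ((T.cup_inv c).1 hg).1
    rw [arcSum_eq_circleSum c _ hg']
    ring
  have h0 : IsWt 1 0 0 := ⟨0, 0, by simp⟩
  have := hw.eq h0 (hz _ (fun _ => rfl)) (hz _ (fun q => by simp only [minus]; rw [hc]))
  rw [map_mul, this]
  simp

lemma contract_assoc (T : CupTangle P Q) (e c b : Matching P) (a : Matching Q)
    {r₁ r₂ r₄ : Setoid P} {r₃ r₅ r₆ : Setoid Q} (h₁ : r₁ = circles e c) (h₂ : r₂ = circles c b)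
    (h₃ : r₃ = circles a (T.cup b)) (h₄ : r₄ = circles e b) (h₅ : r₅ = circles a (T.cup c))
    (h₆ : r₆ = circles a (T.cup e)) (x : TQFT r₁) (y : TQFT r₂) (z : TQFT r₃) :
    (contract T e b a (contract (CupTangle.id P) e c b x y : TQFT r₄) z : TQFT r₆) =
      contract T e c a x (contract T c b a y z : TQFT r₅) := by
  obtain ⟨f, rfl⟩ := x.mk_surj
  obtain ⟨g, rfl⟩ := y.mk_surj
  obtain ⟨h, rfl⟩ := z.mk_surj
  rw [contract_mk (CupTangle.id P) e c b h₁ (by rw [h₂, CupTangle.id_cup, circles_comm])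
      (by rw [h₄, CupTangle.id_cup, circles_comm]), contract_mk T e b a h₄ h₃ h₆,
    contract_mk T c b a h₂ h₃ h₅, contract_mk T e c a h₁ h₅ h₆]
  subst h₆
  apply mk_eq_of_ev
  intro κ hκ
  obtain ⟨ha, he⟩ := inv_circles.1 hκ
  have hid : ∀ k : MvPolynomial P ℤ, MvPolynomial.rename (CupTangle.id P).emb k = k := by
    intro k
    have : ((CupTangle.id P).emb : P → P) = id := rfl
    rw [this, MvPolynomial.rename_id_apply]
  rw [hid]
  simp only [map_mul]
  have key : ev κ (MvPolynomial.rename T.emb (theta (CupTangle.id P) e c b)) *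
      ev κ (theta T e b a) = ev κ (theta T c b a) * ev κ (theta T e c a) := by
    rw [ev_rename]
    have he' : Inv (κ ∘ T.emb) e := ((T.cup_inv e).1 he).1
    have harc := ((T.cup_inv e).1 he).2
    by_cases hb : Inv κ (T.cup b)
    · have hb' : Inv (κ ∘ T.emb) b := ((T.cup_inv b).1 hb).1
      by_cases hc : Inv κ (T.cup c)
      · have hc' : Inv (κ ∘ T.emb) c := ((T.cup_inv c).1 hc).1
        have w1 := ev_theta (CupTangle.id P) e c b (κ ∘ T.emb) hb' (by simpa using he')
          (by simpa using hc')
        have w2 := ev_theta T e b a κ ha he hb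
        have w3 := ev_theta T c b a κ ha hc hb
        have w4 := ev_theta T e c a κ ha he hc
        have hs : ∀ g : Q → ℤ, thetaSum (CupTangle.id P) e c b (g ∘ T.emb) +
            thetaSum T e b a g = thetaSum T c b a g + thetaSum T e c a g := by
          intro g
          unfold thetaSum
          have : (g ∘ T.emb) ∘ (CupTangle.id P).emb = g ∘ T.emb := rfl
          rw [this]
          simp only [CupTangle.id_cup]
          rw [circles_comm b e, circles_comm b c]
          ring
        exact (w1.mul w2).eq (w3.mul w4) (hs fun _ => 1) (hs (minus κ))
      · rw [ev_theta_zero T e c a κ ha he hc, mul_zero]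
        have hc' : ¬ Inv (κ ∘ T.emb) c := fun h => hc ((T.cup_inv c).2 ⟨h, harc⟩)
        rw [ev_theta_zero (CupTangle.id P) e c b (κ ∘ T.emb) hb' (by simpa using he')
          (by simpa using hc'), zero_mul]
    · rw [ev_theta_zero T e b a κ ha he hb, mul_zero]
      by_cases hc : Inv κ (T.cup c)
      · rw [ev_theta_zero T c b a κ ha hc hb, zero_mul]
      · rw [ev_theta_zero T e c a κ ha he hc, mul_zero]
  linear_combination (ev κ (MvPolynomial.rename T.emb f) * ev κ (MvPolynomial.rename T.emb g) *
    ev κ h) * key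

lemma contract_id_comm (c b a : Matching P)
    {r₁ r₂ r₃ : Setoid P} (h₁ : r₁ = circles c b) (h₂ : r₂ = circles b a)
    (h₃ : r₃ = circles c a) (x : TQFT r₁) (y : TQFT r₂) :
    (contract (CupTangle.id P) c b a x y : TQFT r₃) = contract (CupTangle.id P) a b c y x := by
  obtain ⟨f, rfl⟩ := x.mk_surj
  obtain ⟨g, rfl⟩ := y.mk_surj
  rw [contract_mk _ c b a h₁ (by rw [h₂, CupTangle.id_cup, circles_comm])
      (by rw [h₃, CupTangle.id_cup, circles_comm]),
    contract_mk _ a b c (by rw [h₂, circles_comm]) (by rw [h₁, CupTangle.id_cup])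
      (by rw [h₃, CupTangle.id_cup])]
  apply mk_eq_of_ev
  subst h₃
  intro κ hκ
  obtain ⟨hc, ha⟩ := inv_circles.1 hκ
  have hid : ∀ k : MvPolynomial P ℤ, MvPolynomial.rename (CupTangle.id P).emb k = k := by
    intro k
    have : ((CupTangle.id P).emb : P → P) = id := rfl
    rw [this, MvPolynomial.rename_id_apply]
  rw [hid, hid]
  have key : ev κ (theta (CupTangle.id P) c b a) = ev κ (theta (CupTangle.id P) a b c) := by
    by_cases hb : Inv κ b
    · have w1 := ev_theta (CupTangle.id P) c b a κ ha (by simpa using hc) (by simpa using hb)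
      have w2 := ev_theta (CupTangle.id P) a b c κ hc (by simpa using ha) (by simpa using hb)
      have hs : ∀ g : P → ℤ, thetaSum (CupTangle.id P) c b a g =
          thetaSum (CupTangle.id P) a b c g := by
        intro g
        unfold thetaSum
        have : g ∘ (CupTangle.id P).emb = g := rfl
        rw [this]
        simp only [CupTangle.id_cup]
        rw [circles_comm a c]
        ring
      exact w1.eq w2 (hs _) (hs _)
    · rw [ev_theta_zero (CupTangle.id P) c b a κ ha (by simpa using hc) (by simpa using hb),
        ev_theta_zero (CupTangle.id P) a b c κ hc (by simpa using ha) (by simpa using hb)]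
  simp only [map_mul]
  rw [key]; ring

lemma contract_comm (T : CupTangle P Q) (c b : Matching P) (e a : Matching Q)
    {r₁ : Setoid P} {r₂ r₃ r₄ r₅ r₆ : Setoid Q} (h₁ : r₁ = circles c b) (h₂ : r₂ = circles e a)
    (h₃ : r₃ = circles a (T.cup b)) (h₄ : r₄ = circles e (T.cup b))
    (h₅ : r₅ = circles a (T.cup c)) (h₆ : r₆ = circles e (T.cup c))
    (x : TQFT r₁) (y : TQFT r₂) (z : TQFT r₃) :
    (contract T c b e x (contract (CupTangle.id Q) e a (T.cup b) y z : TQFT r₄) : TQFT r₆) =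
      contract (CupTangle.id Q) e a (T.cup c) y (contract T c b a x z : TQFT r₅) := by
  obtain ⟨f, rfl⟩ := x.mk_surj
  obtain ⟨g, rfl⟩ := y.mk_surj
  obtain ⟨h, rfl⟩ := z.mk_surj
  rw [contract_mk (CupTangle.id Q) e a _ h₂ (by rw [h₃, CupTangle.id_cup, circles_comm])
      (by rw [h₄, CupTangle.id_cup, circles_comm]), contract_mk T c b e h₁ h₄ h₆,
    contract_mk T c b a h₁ h₃ h₅, contract_mk (CupTangle.id Q) e a _ h₂
      (by rw [h₅, CupTangle.id_cup, circles_comm]) (by rw [h₆, CupTangle.id_cup, circles_comm])]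
  subst h₆
  apply mk_eq_of_ev
  intro κ hκ
  obtain ⟨he, hc⟩ := inv_circles.1 hκ
  have hid : ∀ k : MvPolynomial Q ℤ, MvPolynomial.rename (CupTangle.id Q).emb k = k := by
    intro k
    have : ((CupTangle.id Q).emb : Q → Q) = id := rfl
    rw [this, MvPolynomial.rename_id_apply]
  rw [hid]
  simp only [map_mul]
  have key : ev κ (theta (CupTangle.id Q) e a (T.cup b)) * ev κ (theta T c b e) =
      ev κ (theta T c b a) * ev κ (theta (CupTangle.id Q) e a (T.cup c)) := by
    by_cases hb : Inv κ (T.cup b)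
    · by_cases ha : Inv κ a
      · have w1 := ev_theta (CupTangle.id Q) e a (T.cup b) κ hb (by simpa using he)
          (by simpa using ha)
        have w2 := ev_theta T c b e κ he hc hb
        have w3 := ev_theta T c b a κ ha hc hb
        have w4 := ev_theta (CupTangle.id Q) e a (T.cup c) κ hc (by simpa using he)
          (by simpa using ha)
        have hs : ∀ g : Q → ℤ, thetaSum (CupTangle.id Q) e a (T.cup b) g + thetaSum T c b e g =
            thetaSum T c b a g + thetaSum (CupTangle.id Q) e a (T.cup c) g := by
          intro g
          unfold thetaSum
          have : g ∘ (CupTangle.id Q).emb = g := rfl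
          rw [this]
          simp only [CupTangle.id_cup]
          rw [circles_comm (T.cup b) e, circles_comm (T.cup b) a, circles_comm (T.cup c) e,
            circles_comm (T.cup c) a]
          ring
        exact (w1.mul w2).eq (w3.mul w4) (hs fun _ => 1) (hs (minus κ))
      · rw [ev_theta_zero (CupTangle.id Q) e a (T.cup b) κ hb (by simpa using he)
          (by simpa using ha), ev_theta_zero (CupTangle.id Q) e a (T.cup c) κ hc
          (by simpa using he) (by simpa using ha), zero_mul, mul_zero]
    · rw [ev_theta_zero T c b e κ he hc hb, mul_zero]
      by_cases ha : Inv κ a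
      · rw [ev_theta_zero T c b a κ ha hc hb, zero_mul]
      · rw [ev_theta_zero (CupTangle.id Q) e a (T.cup c) κ hc
          (by simpa using he) (by simpa using ha), mul_zero]
  linear_combination (ev κ (MvPolynomial.rename T.emb f) * ev κ g * ev κ h) * key

end Contract
end ArcAlgebra

namespace ArcAlgebra

/-! ### Gradings -/

section Grading

variable {M : Type} [AddCommGroup M]

lemma isInternal_of_coaction (D : ℤ → AddSubgroup M) (Δ : M →+ (ℤ →₀ M))
    (h1 : ∀ n x, x ∈ D n → Δ x = Finsupp.single n x) (h2 : ∀ x, x ∈ ⨆ n, D n) :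
    DirectSum.IsInternal D := by
  constructor
  · rw [injective_iff_map_eq_zero]
    intro f hf
    have key : ∀ f : DirectSum ℤ (fun i => D i), ∀ n,
        Δ (DirectSum.coeAddMonoidHom D f) n = (f n : M) := by
      intro f n
      induction f using DirectSum.induction_on with
      | zero => simp
      | of i x =>
        rw [DirectSum.coeAddMonoidHom_of, h1 i _ x.2]
        by_cases h : i = n
        · subst h; rw [Finsupp.single_eq_same, DirectSum.of_eq_same]
        · rw [Finsupp.single_eq_of_ne (Ne.symm h), DirectSum.of_eq_of_ne _ _ _ (Ne.symm h)]; rfl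
      | add x y hx hy => rw [map_add, map_add, Finsupp.add_apply, hx, hy]; rfl
    ext n
    rw [← key f n, hf]; simp
  · intro x
    have := h2 x
    induction this using AddSubgroup.iSup_induction' with
    | hp i x hx => exact ⟨DirectSum.of (fun i => D i) i ⟨x, hx⟩, by
        rw [DirectSum.coeAddMonoidHom_of]⟩
    | h1 => exact ⟨0, map_zero _⟩
    | hadd x y _ _ hx hy =>
      obtain ⟨a, rfl⟩ := hx
      obtain ⟨b, rfl⟩ := hy
      exact ⟨a + b, map_add _ _ _⟩

lemma exists_coaction {D : ℤ → AddSubgroup M} (h : DirectSum.IsInternal D) :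
    ∃ Δ : M →+ (ℤ →₀ M), ∀ n x, x ∈ D n → Δ x = Finsupp.single n x := by
  let e := AddEquiv.ofBijective (DirectSum.coeAddMonoidHom D) h
  let t : DirectSum ℤ (fun i => D i) →+ (ℤ →₀ M) :=
    DirectSum.toAddMonoid (fun n => (Finsupp.singleAddHom n).comp (D n).subtype)
  refine ⟨t.comp e.symm.toAddMonoidHom, fun n x hx => ?_⟩
  have : e.symm x = DirectSum.of (fun i => D i) n ⟨x, hx⟩ := by
    rw [AddEquiv.symm_apply_eq]
    exact (DirectSum.coeAddMonoidHom_of D n ⟨x, hx⟩).symm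
  change t (e.symm x) = _
  rw [this, DirectSum.toAddMonoid_of]
  rfl

lemma homogeneous_induction {D : ℤ → AddSubgroup M} (h : DirectSum.IsInternal D) {C : M → Prop}
    (h1 : ∀ n x, x ∈ D n → C x) (h0 : C 0) (hadd : ∀ x y, C x → C y → C (x + y)) (x : M) :
    C x := by
  obtain ⟨f, rfl⟩ := h.2 x
  induction f using DirectSum.induction_on with
  | zero => simpa using h0
  | of i x => rw [DirectSum.coeAddMonoidHom_of]; exact h1 i x x.2
  | add x y hx hy => rw [map_add]; exact hadd _ _ hx hy

lemma isInternal_shift {D : ℤ → AddSubgroup M} (h : DirectSum.IsInternal D) (k : ℤ) :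
    DirectSum.IsInternal (fun n => D (n - k)) := by
  obtain ⟨Δ, hΔ⟩ := exists_coaction h
  refine isInternal_of_coaction _
    ((Finsupp.mapDomain.addMonoidHom (fun n => n + k)).comp Δ) (fun n x hx => ?_) (fun x => ?_)
  · rw [AddMonoidHom.comp_apply, hΔ _ _ hx]
    change Finsupp.mapDomain _ _ = _
    rw [Finsupp.mapDomain_single, sub_add_cancel]
  · refine homogeneous_induction h (fun n x hx => ?_) (zero_mem _) (fun _ _ => add_mem) x
    refine AddSubgroup.mem_iSup_of_mem (n + k) ?_
    rwa [add_sub_cancel_right]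

lemma isInternal_pi {ι : Type} [Finite ι] {N : ι → Type} [∀ i, AddCommGroup (N i)]
    {D : ∀ i, ℤ → AddSubgroup (N i)} (h : ∀ i, DirectSum.IsInternal (D i)) :
    DirectSum.IsInternal (fun n => AddSubgroup.pi Set.univ (fun i => D i n)) := by
  classical
  cases nonempty_fintype ι
  choose Δ hΔ using fun i => exists_coaction (h i)
  let Δ' : (∀ i, N i) →+ (ℤ →₀ ∀ i, N i) := ∑ i, (Finsupp.mapRange.addMonoidHom
    (AddMonoidHom.single N i)).comp ((Δ i).comp (Pi.evalAddMonoidHom N i))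
  refine isInternal_of_coaction _ Δ' (fun n x hx => ?_) (fun x => ?_)
  · have hx' : ∀ i, x i ∈ D i n := fun i => (AddSubgroup.mem_pi _).1 hx i trivial
    have : ∀ i, (Finsupp.mapRange.addMonoidHom (AddMonoidHom.single N i)) (Δ i (x i)) =
        Finsupp.single n (Pi.single i (x i)) := by
      intro i
      rw [hΔ i n _ (hx' i)]
      simp
    simp only [Δ', AddMonoidHom.finsetSum_apply, AddMonoidHom.comp_apply,
      Pi.evalAddMonoidHom_apply, this]
    rw [← Finsupp.single_finsetSum, Finset.univ_sum_single]
  · rw [← Finset.univ_sum_single x]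
    refine sum_mem (fun i _ => ?_)
    refine homogeneous_induction (h i)
      (C := fun y => Pi.single i y ∈ ⨆ n, AddSubgroup.pi Set.univ (fun i => D i n)) (fun n y hy => ?_) ?_ ?_
      (x i)
    · refine AddSubgroup.mem_iSup_of_mem n ((AddSubgroup.mem_pi _).2 fun j _ => ?_)
      by_cases hj : j = i
      · subst hj; simpa using hy
      · rw [Pi.single_eq_of_ne hj]; exact zero_mem _
    · rw [Pi.single_zero]; exact zero_mem _
    · intro y z hy hz
      rw [Pi.single_add]; exact add_mem hy hz

end Grading

section TQFTGrading

variable {P : Type}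

lemma TQFT.isInternal (r : Setoid P) : DirectSum.IsInternal (TQFT.degree r) := by
  let ψ₀ : MvPolynomial P ℤ →+* Polynomial (TQFT r) :=
    MvPolynomial.eval₂Hom (Int.castRingHom _)
      (fun p => Polynomial.monomial 1 (TQFT.mk r (MvPolynomial.X p)))
  have hker : ∀ f ∈ relIdeal r, ψ₀ f = 0 := by
    intro f hf
    have : relIdeal r ≤ RingHom.ker ψ₀ := by
      refine Ideal.span_le.2 ?_
      rintro _ (⟨p, rfl⟩ | ⟨p, q, hpq, rfl⟩)
      · rw [SetLike.mem_coe, RingHom.mem_ker, map_pow]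
        simp only [ψ₀, MvPolynomial.eval₂Hom_X', sq, Polynomial.monomial_mul_monomial]
        rw [← sq, ← map_pow, TQFT.mk_X_sq, Polynomial.monomial_zero_right]
      · rw [SetLike.mem_coe, RingHom.mem_ker, map_sub]
        simp only [ψ₀, MvPolynomial.eval₂Hom_X']
        rw [TQFT.mk_X hpq, sub_self]
    exact RingHom.mem_ker.1 (this hf)
  let ψ : TQFT r →+* Polynomial (TQFT r) := Ideal.Quotient.lift (relIdeal r) ψ₀ hker
  have hmon : ∀ (s : P →₀ ℕ) (a : ℤ), ψ₀ (MvPolynomial.monomial s a) =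
      Polynomial.monomial s.degree (TQFT.mk r (MvPolynomial.monomial s a)) := by
    intro s a
    induction s using Finsupp.induction generalizing a with
    | zero =>
      simp only [ψ₀, MvPolynomial.eval₂Hom_monomial, Finsupp.prod_zero_index, mul_one, map_zero]
      rw [← MvPolynomial.C_apply, Polynomial.monomial_zero_left]
      simp
    | single_add p k s hp hk ih =>
      have h1 : (MvPolynomial.monomial (Finsupp.single p k + s) a : MvPolynomial P ℤ) =
          MvPolynomial.X p ^ k * MvPolynomial.monomial s a := by
        rw [MvPolynomial.X_pow_eq_monomial, MvPolynomial.monomial_mul, one_mul]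
      have h2 : ψ₀ (MvPolynomial.X p ^ k) =
          Polynomial.monomial k (TQFT.mk r (MvPolynomial.X p ^ k)) := by
        rw [map_pow]
        simp only [ψ₀, MvPolynomial.eval₂Hom_X', Polynomial.monomial_pow, one_mul, map_pow]
      rw [h1, map_mul, h2, ih, Polynomial.monomial_mul_monomial, ← map_mul]
      congr 1
      simp [map_add]
  have hhom : ∀ (f : MvPolynomial P ℤ) (k : ℕ), f.IsHomogeneous k →
      ψ (TQFT.mk r f) = Polynomial.monomial k (TQFT.mk r f) := by
    intro f k hf
    change ψ₀ f = _
    conv_lhs => rw [f.as_sum]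
    conv_rhs => rw [f.as_sum]
    rw [map_sum, map_sum, map_sum]
    refine Finset.sum_congr rfl (fun s hs => ?_)
    rw [hmon]
    congr 2
    have := hf (MvPolynomial.mem_support_iff.1 hs)
    rw [← this, Finsupp.degree_eq_weight_one]
    rfl
  let c : ℤ := numCircles r
  let τ : Polynomial (TQFT r) →+ (ℤ →₀ TQFT r) :=
    AddMonoidHom.mk' (fun p => p.sum (fun k a => Finsupp.single (2 * (k : ℤ) - c) a))
      (fun p q => Polynomial.sum_add_index _ _ _ (fun _ => Finsupp.single_zero _)
        (fun _ _ _ => Finsupp.single_add _ _ _))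
  have hτ : ∀ k a, τ (Polynomial.monomial k a) = Finsupp.single (2 * (k : ℤ) - c) a := fun k a =>
    Polynomial.sum_monomial_index _ _ (Finsupp.single_zero _)
  refine isInternal_of_coaction _ (τ.comp ψ.toAddMonoidHom) (fun n x hx => ?_) (fun x => ?_)
  · induction hx using AddSubgroup.closure_induction with
    | mem x hx =>
      obtain ⟨f, k, hf, hk, rfl⟩ := hx
      change τ (ψ _) = _
      rw [hhom f k hf, hτ, ← hk]
    | zero => simp
    | add x y _ _ hx hy => rw [map_add, hx, hy, Finsupp.single_add]
    | neg x _ hx => rw [map_neg, hx, Finsupp.single_neg]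
  · obtain ⟨f, rfl⟩ := x.mk_surj
    rw [← MvPolynomial.sum_homogeneousComponent f, map_sum]
    exact sum_mem (fun k _ => AddSubgroup.mem_iSup_of_mem (2 * (k : ℤ) - c)
      (AddSubgroup.subset_closure
        ⟨_, k, MvPolynomial.homogeneousComponent_isHomogeneous k f, rfl, rfl⟩))

lemma TQFT.finite [Finite P] (r : Setoid P) : Module.Finite ℤ (TQFT r) := by
  have : Algebra.IsIntegral ℤ (TQFT r) := by
    refine ⟨fun x => ?_⟩
    obtain ⟨f, rfl⟩ := x.mk_surj
    induction f using MvPolynomial.induction_on with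
    | C a =>
      have : TQFT.mk r (MvPolynomial.C a) = algebraMap ℤ (TQFT r) a := by simp
      rw [this]; exact isIntegral_algebraMap
    | add f g hf hg => rw [map_add]; exact hf.add hg
    | mul_X f p hf =>
      rw [map_mul]
      refine hf.mul (IsIntegral.of_pow (n := 2) two_pos ?_)
      rw [← map_pow, TQFT.mk_X_sq]
      exact isIntegral_zero
  have : Algebra.FiniteType ℤ (TQFT r) :=
    Algebra.FiniteType.of_surjective (Ideal.Quotient.mkₐ ℤ (relIdeal r))
      (Ideal.Quotient.mkₐ_surjective _ _)
  exact Algebra.IsIntegral.finite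

lemma TQFT.mem_degree (r : Setoid P) {f : MvPolynomial P ℤ} {k : ℕ} (hf : f.IsHomogeneous k)
    {n : ℤ} (h : 2 * (k : ℤ) - numCircles r = n) : TQFT.mk r f ∈ TQFT.degree r n :=
  AddSubgroup.subset_closure ⟨f, k, hf, h, rfl⟩

end TQFTGrading
end ArcAlgebra

namespace ArcAlgebra

/-! ### The rings `H^m` -/

section Ring

variable (P : Type) [LinearOrder P]

/-- The arc ring of a finite set of points on a line: the direct sum of the groups
`ℱ(W(b)a)` over crossingless matchings `b`, `a`. For `2 m` points this is the ring `H^m`. -/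
def ArcRing : Type := ∀ b a : Matching P, TQFT (circles b a)

noncomputable instance : AddCommGroup (ArcRing P) :=
  inferInstanceAs (AddCommGroup (∀ b a : Matching P, TQFT (circles b a)))

variable {P}

lemma ArcRing.add_apply (x y : ArcRing P) (b a : Matching P) : (x + y) b a = x b a + y b a := rfl

lemma ArcRing.zero_apply (b a : Matching P) : (0 : ArcRing P) b a = 0 := rfl

section Act

variable {P Q : Type} [LinearOrder P] [LinearOrder Q] [Fintype P] [Fintype Q]
  (T : CupTangle P Q) (d : Matching Q) {r : Matching P → Setoid Q}

/-- The action of the arc ring on the sum of the groups `ℱ(W(d)Tb)` over all `b`. -/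
noncomputable def act (x : ArcRing P) (z : ∀ b, TQFT (r b)) : ∀ b, TQFT (r b) :=
  fun c => ∑ b, contract T c b d (x c b) (z b)

/-- The action of the arc ring from the other side. -/
noncomputable def actOp (x : ArcRing P) (z : ∀ b, TQFT (r b)) : ∀ b, TQFT (r b) :=
  fun c => ∑ b, contract T c b d (x b c) (z b)

variable (hr : ∀ b, r b = circles d (T.cup b))

lemma contract_add_left (hr : ∀ b, r b = circles d (T.cup b)) {c b : Matching P} {r₁ : Setoid P}
    (h₁ : r₁ = circles c b) (x y : TQFT r₁) (z : TQFT (r b)) :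
    (contract T c b d (x + y) z : TQFT (r c)) = contract T c b d x z + contract T c b d y z := by
  rw [← contractHom_apply T c b d h₁ (hr b) (hr c), map_add]; rfl

lemma contract_add_right (hr : ∀ b, r b = circles d (T.cup b)) {c b : Matching P} {r₁ : Setoid P}
    (h₁ : r₁ = circles c b) (x : TQFT r₁) (z w : TQFT (r b)) :
    (contract T c b d x (z + w) : TQFT (r c)) = contract T c b d x z + contract T c b d x w := by
  rw [← contractHom_apply T c b d h₁ (hr b) (hr c), map_add]; rfl

lemma contract_zero_left (hr : ∀ b, r b = circles d (T.cup b)) {c b : Matching P}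
    {r₁ : Setoid P} (h₁ : r₁ = circles c b) (z : TQFT (r b)) :
    (contract T c b d (0 : TQFT r₁) z : TQFT (r c)) = 0 := by
  rw [← contractHom_apply T c b d h₁ (hr b) (hr c), map_zero]; rfl

lemma contract_zero_right (hr : ∀ b, r b = circles d (T.cup b)) {c b : Matching P}
    {r₁ : Setoid P} (h₁ : r₁ = circles c b) (x : TQFT r₁) :
    (contract T c b d x (0 : TQFT (r b)) : TQFT (r c)) = 0 := by
  rw [← contractHom_apply T c b d h₁ (hr b) (hr c), map_zero]

lemma contract_sum_left (hr : ∀ b, r b = circles d (T.cup b)) {c b : Matching P}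
    {r₁ : Setoid P} (h₁ : r₁ = circles c b) {ι : Type} (s : Finset ι) (x : ι → TQFT r₁)
    (z : TQFT (r b)) : (contract T c b d (∑ i ∈ s, x i) z : TQFT (r c)) =
      ∑ i ∈ s, contract T c b d (x i) z := by
  rw [← contractHom_apply T c b d h₁ (hr b) (hr c), map_sum, AddMonoidHom.finsetSum_apply]; rfl

lemma contract_sum_right (hr : ∀ b, r b = circles d (T.cup b)) {c b : Matching P}
    {r₁ : Setoid P} (h₁ : r₁ = circles c b) {ι : Type} (s : Finset ι) (x : TQFT r₁)
    (z : ι → TQFT (r b)) : (contract T c b d x (∑ i ∈ s, z i) : TQFT (r c)) =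
      ∑ i ∈ s, contract T c b d x (z i) := by
  rw [← contractHom_apply T c b d h₁ (hr b) (hr c), map_sum]; rfl

noncomputable instance : Mul (ArcRing P) :=
  ⟨fun x y c a => ∑ b, contract (CupTangle.id P) c b a (x c b) (y b a)⟩

noncomputable instance : One (ArcRing P) := ⟨fun b a => if b = a then 1 else 0⟩

lemma ArcRing.mul_apply (x y : ArcRing P) (c a : Matching P) :
    (x * y) c a = ∑ b, contract (CupTangle.id P) c b a (x c b) (y b a) := rfl

lemma ArcRing.one_apply (b a : Matching P) : (1 : ArcRing P) b a = if b = a then 1 else 0 := rfl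

lemma circles_id (a b : Matching P) : circles b a = circles a ((CupTangle.id P).cup b) := by
  rw [CupTangle.id_cup, circles_comm]

lemma act_add (hr : ∀ b, r b = circles d (T.cup b)) (x : ArcRing P) (z w : ∀ b, TQFT (r b)) :
    act T d x (z + w) = act T d x z + act T d x w := by
  funext c
  simp only [act, Pi.add_apply]
  rw [← Finset.sum_add_distrib]
  exact Finset.sum_congr rfl fun b _ => contract_add_right T d hr rfl _ _ _

lemma add_act (hr : ∀ b, r b = circles d (T.cup b)) (x y : ArcRing P) (z : ∀ b, TQFT (r b)) :
    act T d (x + y) z = act T d x z + act T d y z := by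
  funext c
  simp only [act, Pi.add_apply]
  rw [← Finset.sum_add_distrib]
  exact Finset.sum_congr rfl fun b _ => contract_add_left T d hr rfl _ _ _

lemma act_zero (hr : ∀ b, r b = circles d (T.cup b)) (x : ArcRing P) :
    act T d x (0 : ∀ b, TQFT (r b)) = 0 := by
  funext c
  exact Finset.sum_eq_zero fun b _ => contract_zero_right T d hr rfl _

lemma zero_act (hr : ∀ b, r b = circles d (T.cup b)) (z : ∀ b, TQFT (r b)) :
    act T d 0 z = 0 := by
  funext c
  exact Finset.sum_eq_zero fun b _ => contract_zero_left T d hr rfl _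

lemma one_act (hr : ∀ b, r b = circles d (T.cup b)) (z : ∀ b, TQFT (r b)) :
    act T d 1 z = z := by
  funext c
  unfold act
  rw [Finset.sum_eq_single c]
  · rw [ArcRing.one_apply, if_pos rfl]; exact contract_one T c d rfl (hr c) _
  · intro b _ hb
    rw [ArcRing.one_apply, if_neg (Ne.symm hb)]; exact contract_zero_left T d hr rfl _
  · intro h; exact absurd (Finset.mem_univ _) h

lemma mul_act (hr : ∀ b, r b = circles d (T.cup b)) (x y : ArcRing P) (z : ∀ b, TQFT (r b)) :
    act T d (x * y) z = act T d x (act T d y z) := by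
  funext e
  unfold act
  have h1 : ∀ b, (contract T e b d ((x * y) e b) (z b) : TQFT (r e)) =
      ∑ c, contract T e b d (contract (CupTangle.id P) e c b (x e c) (y c b) :
        TQFT (circles e b)) (z b) := fun b => by
    rw [ArcRing.mul_apply]; exact contract_sum_left T d hr rfl _ _ _
  have h2 : ∀ c, (contract T e c d (x e c) (∑ b, contract T c b d (y c b) (z b) : TQFT (r c)) :
      TQFT (r e)) = ∑ b, contract T e c d (x e c) (contract T c b d (y c b) (z b) : TQFT (r c)) :=
    fun c => contract_sum_right T d hr rfl _ _ _
  rw [Finset.sum_congr rfl fun b _ => h1 b, Finset.sum_congr rfl fun c _ => h2 c,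
    Finset.sum_comm]
  exact Finset.sum_congr rfl fun c _ => Finset.sum_congr rfl fun b _ =>
    contract_assoc T e c b d rfl rfl (hr b) rfl (hr c) (hr e) _ _ _

lemma actOp_add (hr : ∀ b, r b = circles d (T.cup b)) (x : ArcRing P) (z w : ∀ b, TQFT (r b)) :
    actOp T d x (z + w) = actOp T d x z + actOp T d x w := by
  funext c
  simp only [actOp, Pi.add_apply]
  rw [← Finset.sum_add_distrib]
  exact Finset.sum_congr rfl fun b _ => contract_add_right T d hr (circles_comm _ _) _ _ _

lemma add_actOp (hr : ∀ b, r b = circles d (T.cup b)) (x y : ArcRing P) (z : ∀ b, TQFT (r b)) :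
    actOp T d (x + y) z = actOp T d x z + actOp T d y z := by
  funext c
  simp only [actOp, Pi.add_apply]
  rw [← Finset.sum_add_distrib]
  exact Finset.sum_congr rfl fun b _ => contract_add_left T d hr (circles_comm _ _) _ _ _

lemma actOp_zero (hr : ∀ b, r b = circles d (T.cup b)) (x : ArcRing P) :
    actOp T d x (0 : ∀ b, TQFT (r b)) = 0 := by
  funext c
  exact Finset.sum_eq_zero fun b _ => contract_zero_right T d hr (circles_comm _ _) _

lemma zero_actOp (hr : ∀ b, r b = circles d (T.cup b)) (z : ∀ b, TQFT (r b)) :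
    actOp T d 0 z = 0 := by
  funext c
  exact Finset.sum_eq_zero fun b _ => contract_zero_left T d hr (circles_comm _ _) _

lemma one_actOp (hr : ∀ b, r b = circles d (T.cup b)) (z : ∀ b, TQFT (r b)) :
    actOp T d 1 z = z := by
  funext c
  unfold actOp
  rw [Finset.sum_eq_single c]
  · rw [ArcRing.one_apply, if_pos rfl]; exact contract_one T c d rfl (hr c) _
  · intro b _ hb
    rw [ArcRing.one_apply, if_neg hb]; exact contract_zero_left T d hr (circles_comm _ _) _
  · intro h; exact absurd (Finset.mem_univ _) h

lemma mul_actOp (hr : ∀ b, r b = circles d (T.cup b)) (x y : ArcRing P) (z : ∀ b, TQFT (r b)) :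
    actOp T d (y * x) z = actOp T d x (actOp T d y z) := by
  funext e
  unfold actOp
  have h1 : ∀ b, (contract T e b d ((y * x) b e) (z b) : TQFT (r e)) =
      ∑ c, contract T e b d (contract (CupTangle.id P) e c b (x c e) (y b c) :
        TQFT (circles b e)) (z b) := fun b => by
    have h0 : ∀ c, (contract (CupTangle.id P) b c e (y b c) (x c e) : TQFT (circles b e)) =
        contract (CupTangle.id P) e c b (x c e) (y b c) := fun c =>
      contract_id_comm b c e rfl rfl rfl _ _
    rw [ArcRing.mul_apply, Finset.sum_congr rfl fun c _ => h0 c]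
    exact contract_sum_left T d hr (circles_comm _ _) _ _ _
  have h2 : ∀ c, (contract T e c d (x c e) (∑ b, contract T c b d (y b c) (z b) : TQFT (r c)) :
      TQFT (r e)) = ∑ b, contract T e c d (x c e) (contract T c b d (y b c) (z b) : TQFT (r c)) :=
    fun c => contract_sum_right T d hr (circles_comm _ _) _ _ _
  rw [Finset.sum_congr rfl fun b _ => h1 b, Finset.sum_congr rfl fun c _ => h2 c,
    Finset.sum_comm]
  exact Finset.sum_congr rfl fun c _ => Finset.sum_congr rfl fun b _ =>
    contract_assoc T e c b d (circles_comm _ _) (circles_comm _ _) (hr b) (circles_comm _ _) (hr c) (hr e) _ _ _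

end Act

variable [Fintype P]

noncomputable instance : Ring (ArcRing P) :=
  { (inferInstance : AddCommGroup (ArcRing P)) with
    mul := (· * ·)
    one := 1
    left_distrib := fun x y z => funext fun c => funext fun a => congrFun
      (act_add (CupTangle.id P) a (circles_id a) x (fun b => y b a) (fun b => z b a)) c
    right_distrib := fun x y z => funext fun c => funext fun a => congrFun
      (add_act (CupTangle.id P) a (circles_id a) x y (fun b => z b a)) c
    zero_mul := fun x => funext fun c => funext fun a => congrFun
      (zero_act (CupTangle.id P) a (circles_id a) (fun b => x b a)) c
    mul_zero := fun x => funext fun c => funext fun a => congrFun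
      (act_zero (CupTangle.id P) a (circles_id a) x) c
    mul_assoc := fun x y z => funext fun c => funext fun a => congrFun
      (mul_act (CupTangle.id P) a (circles_id a) x y (fun b => z b a)) c
    one_mul := fun x => funext fun c => funext fun a => congrFun
      (one_act (CupTangle.id P) a (circles_id a) (fun b => x b a)) c
    mul_one := fun x => funext fun c => funext fun a => by
      have h := congrFun (one_actOp (CupTangle.id P) c (r := fun b => circles c b)
        (fun b => by rw [CupTangle.id_cup]) (x c)) a
      refine Eq.trans ?_ h
      exact Finset.sum_congr rfl fun b _ => contract_id_comm c b a rfl rfl rfl _ _ }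

/-- The number `m` of arcs in a crossingless matching. -/
def half (P : Type) [Fintype P] : ℕ := Fintype.card P / 2

variable (P) in
/-- The grading of the arc ring: `_b(H^m)_a = ℱ(W(b)a){m}`. -/
noncomputable def ArcRing.degree (n : ℤ) : AddSubgroup (ArcRing P) where
  carrier := {x | ∀ b a, x b a ∈ TQFT.degree (circles b a) (n - half P)}
  add_mem' hx hy b a := add_mem (hx b a) (hy b a)
  zero_mem' _ _ := zero_mem _
  neg_mem' hx b a := neg_mem (hx b a)

lemma contract_mem {P Q : Type} [LinearOrder P] [LinearOrder Q] [Fintype P] [Fintype Q]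
    (T : CupTangle P Q) (c b : Matching P) (d : Matching Q)
    {r₁ : Setoid P} {r₂ r₃ : Setoid Q} {x : TQFT r₁} {y : TQFT r₂} {i j k : ℤ}
    (h₁ : r₁ = circles c b) (h₂ : r₂ = circles d (T.cup b)) (h₃ : r₃ = circles d (T.cup c))
    (hx : x ∈ TQFT.degree r₁ i) (hy : y ∈ TQFT.degree r₂ j) (hk : i + j + half P = k) :
    (contract T c b d x y : TQFT r₃) ∈ TQFT.degree r₃ k :=
  hk ▸ contract_degree T c b d h₁ h₂ h₃ hx hy

lemma numCircles_self (b : Matching P) : numCircles (circles b b) = half P := by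
  have h := arcSum_eq_circleSum b (fun _ => 1) (fun _ => rfl)
  rw [circleSum_one, arcSum_one] at h
  exact_mod_cast h

lemma isInternal_pi₂ {α β : Type} [Finite α] [Finite β] (r : α → β → Setoid P) (k : ℤ)
    (D : ℤ → AddSubgroup (∀ a b, TQFT (r a b)))
    (hD : ∀ (n : ℤ) (x : ∀ a b, TQFT (r a b)), x ∈ D n ↔ ∀ a b, x a b ∈ TQFT.degree (r a b) (n - k)) :
    DirectSum.IsInternal D := by
  have h0 := fun a => isInternal_pi fun b => isInternal_shift (TQFT.isInternal (r a b)) k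
  have h := isInternal_pi h0
  have e : D = fun n => AddSubgroup.pi Set.univ fun a => AddSubgroup.pi Set.univ fun b =>
      TQFT.degree (r a b) (n - k) := by
    funext n
    refine AddSubgroup.ext fun x => ?_
    rw [hD, AddSubgroup.mem_pi]
    simp only [Set.mem_univ, forall_const, AddSubgroup.mem_pi]
  rw [e]; exact h

lemma ArcRing.isInternal : DirectSum.IsInternal (ArcRing.degree P) :=
  isInternal_pi₂ (fun b a => circles b a) (half P) (ArcRing.degree P) (fun _ _ => Iff.rfl)

noncomputable instance : GradedRing (ArcRing.degree P) where
  one_mem b a := by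
    rw [ArcRing.one_apply]
    split_ifs with h
    · subst h
      rw [← map_one (TQFT.mk _)]
      refine TQFT.mem_degree _ (MvPolynomial.isHomogeneous_one _ _) ?_
      rw [numCircles_self]; simp
    · exact zero_mem _
  mul_mem i j x y hx hy c a := by
    rw [ArcRing.mul_apply]
    refine sum_mem fun b _ => ?_
    exact contract_mem _ c b a rfl (circles_id a b) (circles_id a c) (hx c b) (hy b a) (by ring)
  toDecomposition := ArcRing.isInternal.chooseDecomposition

end Ring

/-! ### Bimodules of flat tangles -/

section Bimodules

variable {P Q : Type} [LinearOrder P] [LinearOrder Q] [Fintype P] [Fintype Q]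

/-- The bimodule `ℱ(T)`, the direct sum of the groups `ℱ(W(b)Ta)`, of a tangle made of cups and
through-strands. -/
def CupBimod (T : CupTangle P Q) : Type :=
  ∀ (b : Matching Q) (a : Matching P), TQFT (circles b (T.cup a))

/-- The bimodule `ℱ(W(T))`, the direct sum of the groups `ℱ(W(b)W(T)a) = ℱ(W(Tb)a)`, of the mirror
image `W(T)`, a tangle made of caps and through-strands. -/
def CapBimod (T : CupTangle P Q) : Type :=
  ∀ (b : Matching P) (a : Matching Q), TQFT (circles (T.cup b) a)

variable (T : CupTangle P Q)

noncomputable instance : AddCommGroup (CupBimod T) :=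
  inferInstanceAs (AddCommGroup (∀ (b : Matching Q) (a : Matching P), TQFT (circles b (T.cup a))))

noncomputable instance : AddCommGroup (CapBimod T) :=
  inferInstanceAs (AddCommGroup (∀ (b : Matching P) (a : Matching Q), TQFT (circles (T.cup b) a)))

/-- The left action on `ℱ(T)`: contract `b` with `W(b)` in `W(c)b ⊔ W(b)Ta`. -/
noncomputable instance : Module (ArcRing Q) (CupBimod T) where
  smul x z c a := ∑ b, contract (CupTangle.id Q) c b (T.cup a) (x c b) (z b a)
  one_smul z := funext fun c => funext fun a => congrFun
    (one_act (CupTangle.id Q) (T.cup a) (circles_id _) (fun b => z b a)) c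
  mul_smul x y z := funext fun c => funext fun a => congrFun
    (mul_act (CupTangle.id Q) (T.cup a) (circles_id _) x y (fun b => z b a)) c
  smul_zero x := funext fun c => funext fun a => congrFun
    (act_zero (CupTangle.id Q) (T.cup a) (circles_id _) x) c
  smul_add x z w := funext fun c => funext fun a => congrFun
    (act_add (CupTangle.id Q) (T.cup a) (circles_id _) x (fun b => z b a) (fun b => w b a)) c
  add_smul x y z := funext fun c => funext fun a => congrFun
    (add_act (CupTangle.id Q) (T.cup a) (circles_id _) x y (fun b => z b a)) c
  zero_smul z := funext fun c => funext fun a => congrFun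
    (zero_act (CupTangle.id Q) (T.cup a) (circles_id _) (fun b => z b a)) c

/-- The right action on `ℱ(T)`: contract `a` with `W(a)` in `W(d)Ta ⊔ W(a)c`. -/
noncomputable instance : Module (ArcRing P)ᵐᵒᵖ (CupBimod T) where
  smul x z d c := ∑ a, contract T c a d (x.unop a c) (z d a)
  one_smul z := funext fun d => one_actOp T d (fun _ => rfl) (z d)
  mul_smul x y z := funext fun d => mul_actOp T d (fun _ => rfl) x.unop y.unop (z d)
  smul_zero x := funext fun d => actOp_zero T d (fun _ => rfl) x.unop
  smul_add x z w := funext fun d => actOp_add T d (fun _ => rfl) x.unop (z d) (w d)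
  add_smul x y z := funext fun d => add_actOp T d (fun _ => rfl) x.unop y.unop (z d)
  zero_smul z := funext fun d => zero_actOp T d (fun _ => rfl) (z d)

/-- The left action on `ℱ(W(T))`: contract `b` with `W(b)` in `W(c)b ⊔ W(b)W(T)a`. -/
noncomputable instance : Module (ArcRing P) (CapBimod T) where
  smul x z c a := ∑ b, contract T c b a (x c b) (z b a)
  one_smul z := funext fun c => funext fun a => congrFun
    (one_act T a (fun _ => circles_comm _ _) (fun b => z b a)) c
  mul_smul x y z := funext fun c => funext fun a => congrFun
    (mul_act T a (fun _ => circles_comm _ _) x y (fun b => z b a)) c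
  smul_zero x := funext fun c => funext fun a => congrFun
    (act_zero T a (fun _ => circles_comm _ _) x) c
  smul_add x z w := funext fun c => funext fun a => congrFun
    (act_add T a (fun _ => circles_comm _ _) x (fun b => z b a) (fun b => w b a)) c
  add_smul x y z := funext fun c => funext fun a => congrFun
    (add_act T a (fun _ => circles_comm _ _) x y (fun b => z b a)) c
  zero_smul z := funext fun c => funext fun a => congrFun
    (zero_act T a (fun _ => circles_comm _ _) (fun b => z b a)) c

/-- The right action on `ℱ(W(T))`: contract `a` with `W(a)` in `W(d)W(T)a ⊔ W(a)c`. -/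
noncomputable instance : Module (ArcRing Q)ᵐᵒᵖ (CapBimod T) where
  smul x z d c := ∑ a, contract (CupTangle.id Q) c a (T.cup d) (x.unop a c) (z d a)
  one_smul z := funext fun d => one_actOp (CupTangle.id Q) (T.cup d)
    (fun _ => by rw [CupTangle.id_cup]) (z d)
  mul_smul x y z := funext fun d => mul_actOp (CupTangle.id Q) (T.cup d)
    (fun _ => by rw [CupTangle.id_cup]) x.unop y.unop (z d)
  smul_zero x := funext fun d => actOp_zero (CupTangle.id Q) (T.cup d)
    (fun _ => by rw [CupTangle.id_cup]) x.unop
  smul_add x z w := funext fun d => actOp_add (CupTangle.id Q) (T.cup d)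
    (fun _ => by rw [CupTangle.id_cup]) x.unop (z d) (w d)
  add_smul x y z := funext fun d => add_actOp (CupTangle.id Q) (T.cup d)
    (fun _ => by rw [CupTangle.id_cup]) x.unop y.unop (z d)
  zero_smul z := funext fun d => zero_actOp (CupTangle.id Q) (T.cup d)
    (fun _ => by rw [CupTangle.id_cup]) (z d)

lemma CupBimod.smul_apply (x : ArcRing Q) (z : CupBimod T) (c : Matching Q) (a : Matching P) :
    (x • z) c a = ∑ b, contract (CupTangle.id Q) c b (T.cup a) (x c b) (z b a) := rfl

lemma CupBimod.op_smul_apply (x : (ArcRing P)ᵐᵒᵖ) (z : CupBimod T) (d : Matching Q)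
    (c : Matching P) : (x • z) d c = ∑ a, contract T c a d (x.unop a c) (z d a) := rfl

lemma CapBimod.smul_apply (x : ArcRing P) (z : CapBimod T) (c : Matching P) (a : Matching Q) :
    (x • z) c a = ∑ b, contract T c b a (x c b) (z b a) := rfl

lemma CapBimod.op_smul_apply (x : (ArcRing Q)ᵐᵒᵖ) (z : CapBimod T) (d : Matching P)
    (c : Matching Q) :
    (x • z) d c = ∑ a, contract (CupTangle.id Q) c a (T.cup d) (x.unop a c) (z d a) := rfl

instance : SMulCommClass (ArcRing Q) (ArcRing P)ᵐᵒᵖ (CupBimod T) where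
  smul_comm x y z := by
    funext e c
    have h1 : ∀ a, (contract (CupTangle.id Q) e a (T.cup c) (x e a)
        (∑ b, contract T c b a (y.unop b c) (z a b) : TQFT (circles a (T.cup c))) :
          TQFT (circles e (T.cup c))) =
        ∑ b, contract (CupTangle.id Q) e a (T.cup c) (x e a)
          (contract T c b a (y.unop b c) (z a b) : TQFT (circles a (T.cup c))) := fun a =>
      contract_sum_right (CupTangle.id Q) (T.cup c) (r := fun a => circles a (T.cup c))
        (circles_id _) rfl _ _ _
    have h2 : ∀ b, (contract T c b e (y.unop b c) (∑ a, contract (CupTangle.id Q) e a (T.cup b)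
        (x e a) (z a b) : TQFT (circles e (T.cup b))) : TQFT (circles e (T.cup c))) =
        ∑ a, contract T c b e (y.unop b c) (contract (CupTangle.id Q) e a (T.cup b)
        (x e a) (z a b) : TQFT (circles e (T.cup b))) := fun b =>
      contract_sum_right T e (r := fun b => circles e (T.cup b)) (fun _ => rfl)
        (circles_comm _ _) _ _ _
    simp only [CupBimod.smul_apply, CupBimod.op_smul_apply]
    rw [Finset.sum_congr rfl fun a _ => h1 a, Finset.sum_congr rfl fun b _ => h2 b,
      Finset.sum_comm]
    exact Finset.sum_congr rfl fun b _ => Finset.sum_congr rfl fun a _ =>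
      (contract_comm T c b e a (circles_comm _ _) rfl rfl rfl rfl rfl _ _ _).symm

instance : SMulCommClass (ArcRing P) (ArcRing Q)ᵐᵒᵖ (CapBimod T) where
  smul_comm x y z := by
    funext c e
    have h2 : ∀ a, (contract (CupTangle.id Q) e a (T.cup c) (y.unop a e)
        (∑ b, contract T c b a (x c b) (z b a) : TQFT (circles (T.cup c) a)) :
          TQFT (circles (T.cup c) e)) =
        ∑ b, contract (CupTangle.id Q) e a (T.cup c) (y.unop a e)
          (contract T c b a (x c b) (z b a) : TQFT (circles (T.cup c) a)) := fun a =>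
      contract_sum_right (CupTangle.id Q) (T.cup c) (r := fun a => circles (T.cup c) a)
        (fun _ => by rw [CupTangle.id_cup]) (circles_comm _ _) _ _ _
    have h1 : ∀ b, (contract T c b e (x c b) (∑ a, contract (CupTangle.id Q) e a (T.cup b)
        (y.unop a e) (z b a) : TQFT (circles (T.cup b) e)) : TQFT (circles (T.cup c) e)) =
        ∑ a, contract T c b e (x c b) (contract (CupTangle.id Q) e a (T.cup b)
        (y.unop a e) (z b a) : TQFT (circles (T.cup b) e)) := fun b =>
      contract_sum_right T e (r := fun b => circles (T.cup b) e) (fun _ => circles_comm _ _)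
        rfl _ _ _
    simp only [CapBimod.smul_apply, CapBimod.op_smul_apply]
    rw [Finset.sum_congr rfl fun a _ => h1 a, Finset.sum_congr rfl fun b _ => h2 b,
      Finset.sum_comm]
    exact Finset.sum_congr rfl fun a _ => Finset.sum_congr rfl fun b _ =>
      contract_comm T c b e a rfl (circles_comm _ _) (circles_comm _ _) (circles_comm _ _)
        (circles_comm _ _) (circles_comm _ _) _ _ _

/-- The grading of `ℱ(T)`, the sum of the groups `ℱ(W(b)Ta){m}`, where `2 m` is the number of
bottom endpoints. -/
noncomputable def CupBimod.degree (n : ℤ) : AddSubgroup (CupBimod T) where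
  carrier := {x | ∀ b a, x b a ∈ TQFT.degree (circles b (T.cup a)) (n - half P)}
  add_mem' hx hy b a := add_mem (hx b a) (hy b a)
  zero_mem' _ _ := zero_mem _
  neg_mem' hx b a := neg_mem (hx b a)

/-- The grading of `ℱ(W(T))`, the sum of the groups `ℱ(W(b)W(T)a){m}`, where `2 m` is the number
of bottom endpoints of `W(T)`. -/
noncomputable def CapBimod.degree (n : ℤ) : AddSubgroup (CapBimod T) where
  carrier := {x | ∀ b a, x b a ∈ TQFT.degree (circles (T.cup b) a) (n - half Q)}
  add_mem' hx hy b a := add_mem (hx b a) (hy b a)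
  zero_mem' _ _ := zero_mem _
  neg_mem' hx b a := neg_mem (hx b a)

lemma finite_pi₂ {P α β : Type} [Finite P] [Finite α] [Finite β] (r : α → β → Setoid P) :
    Module.Finite ℤ (∀ a b, TQFT (r a b)) := by
  have := fun a b => TQFT.finite (r a b)
  infer_instance

end Bimodules
end ArcAlgebra

namespace ArcAlgebra

open CategoryTheory CategoryTheory.Limits MulOpposite
open scoped TensorProduct

/-! ### Graded modules and bimodules -/

section GradedModules

/-- Finitely generated graded left modules over a graded ring. -/
structure GrMod {A : Type} [Ring A] (𝒜 : ℤ → AddSubgroup A) where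
  carrier : Type
  [addCommGroup : AddCommGroup carrier]
  [module : Module A carrier]
  deg : ℤ → AddSubgroup carrier
  internal : DirectSum.IsInternal deg
  smul_mem : ∀ {i j : ℤ} {a : A} {x : carrier}, a ∈ 𝒜 i → x ∈ deg j → a • x ∈ deg (i + j)
  finite : Module.Finite A carrier

attribute [instance] GrMod.addCommGroup GrMod.module

/-- Graded bimodules that are finitely generated as left modules. -/
structure GrBimod {A R : Type} [Ring A] [Ring R] (𝒜 : ℤ → AddSubgroup A)
    (ℛ : ℤ → AddSubgroup R) where
  carrier : Type
  [addCommGroup : AddCommGroup carrier]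
  [module : Module A carrier]
  [moduleOp : Module Rᵐᵒᵖ carrier]
  [smulCommClass : SMulCommClass A Rᵐᵒᵖ carrier]
  deg : ℤ → AddSubgroup carrier
  internal : DirectSum.IsInternal deg
  smul_mem : ∀ {i j : ℤ} {a : A} {x : carrier}, a ∈ 𝒜 i → x ∈ deg j → a • x ∈ deg (i + j)
  op_smul_mem : ∀ {i j : ℤ} {r : R} {x : carrier}, x ∈ deg i → r ∈ ℛ j →
    op r • x ∈ deg (i + j)
  finite : Module.Finite A carrier

attribute [instance] GrBimod.addCommGroup GrBimod.module GrBimod.moduleOp GrBimod.smulCommClass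

variable {A R : Type} [Ring A] [Ring R] {𝒜 : ℤ → AddSubgroup A} {ℛ : ℤ → AddSubgroup R}

namespace GrMod

/-- Module homomorphisms that preserve the degree. -/
def homs (M N : GrMod 𝒜) : AddSubgroup (M.carrier →ₗ[A] N.carrier) where
  carrier := {f | ∀ n, ∀ x ∈ M.deg n, f x ∈ N.deg n}
  add_mem' hf hg n x hx := add_mem (hf n x hx) (hg n x hx)
  zero_mem' _ _ _ := zero_mem _
  neg_mem' hf n x hx := neg_mem (hf n x hx)

instance : Category (GrMod 𝒜) where
  Hom M N := homs M N
  id M := ⟨LinearMap.id, fun _ _ hx => hx⟩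
  comp f g := ⟨g.1.comp f.1, fun n x hx => g.2 n _ (f.2 n x hx)⟩

lemma hom_ext {M N : GrMod 𝒜} {f g : M ⟶ N} (h : ∀ x, f.1 x = g.1 x) : f = g :=
  Subtype.ext (LinearMap.ext h)

@[simp] lemma id_apply (M : GrMod 𝒜) (x : M.carrier) : Subtype.val (𝟙 M) x = x := rfl

@[simp] lemma comp_apply {M N L : GrMod 𝒜} (f : M ⟶ N) (g : N ⟶ L) (x : M.carrier) :
    (f ≫ g).1 x = g.1 (f.1 x) := rfl

instance : Preadditive (GrMod 𝒜) where
  homGroup M N := inferInstanceAs (AddCommGroup (homs M N))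
  add_comp _ _ _ f g h := hom_ext fun x => map_add h.1 (f.1 x) (g.1 x)
  comp_add _ _ _ _ _ _ := rfl

@[simp] lemma add_apply {M N : GrMod 𝒜} (f g : M ⟶ N) (x : M.carrier) :
    (f + g).1 x = f.1 x + g.1 x := rfl

/-- The zero module. -/
def zero (𝒜 : ℤ → AddSubgroup A) : GrMod 𝒜 where
  carrier := PUnit
  deg _ := ⊤
  internal := isInternal_of_coaction _ 0 (fun _ _ _ => Finsupp.ext fun _ => Subsingleton.elim _ _)
    (fun _ => AddSubgroup.mem_iSup_of_mem 0 trivial)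
  smul_mem _ _ := trivial
  finite := inferInstance

/-- The shift `M{k}`, which moves every degree up by `k`. -/
def shiftObj (k : ℤ) (M : GrMod 𝒜) : GrMod 𝒜 where
  carrier := M.carrier
  deg n := M.deg (n - k)
  internal := isInternal_shift M.internal k
  smul_mem {i j a x} ha hx := by
    have := M.smul_mem ha hx
    rwa [← add_sub_assoc] at this
  finite := M.finite

/-- The shift functor `{k}`. -/
def shift (𝒜 : ℤ → AddSubgroup A) (k : ℤ) : GrMod 𝒜 ⥤ GrMod 𝒜 where
  obj := shiftObj k
  map f := ⟨f.1, fun n x hx => f.2 (n - k) x hx⟩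
  map_id _ := rfl
  map_comp _ _ := rfl

/-- The direct sum of two graded modules. -/
def prod (M N : GrMod 𝒜) : GrMod 𝒜 where
  carrier := M.carrier × N.carrier
  deg n := (M.deg n).prod (N.deg n)
  internal := by
    obtain ⟨Δ, hΔ⟩ := exists_coaction M.internal
    obtain ⟨Δ', hΔ'⟩ := exists_coaction N.internal
    refine isInternal_of_coaction _
      ((Finsupp.mapRange.addMonoidHom (AddMonoidHom.inl M.carrier N.carrier)).comp
        (Δ.comp (AddMonoidHom.fst _ _)) +
      (Finsupp.mapRange.addMonoidHom (AddMonoidHom.inr M.carrier N.carrier)).comp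
        (Δ'.comp (AddMonoidHom.snd _ _))) ?_ ?_
    · rintro n ⟨x, y⟩ ⟨hx, hy⟩
      simp only [AddMonoidHom.add_apply, AddMonoidHom.comp_apply, AddMonoidHom.coe_fst,
        AddMonoidHom.coe_snd]
      rw [hΔ n x hx, hΔ' n y hy]
      simp [← Finsupp.single_add]
    · rintro ⟨x, y⟩
      have h1 : ∀ x : M.carrier, ((x, 0) : M.carrier × N.carrier) ∈
          ⨆ n, (M.deg n).prod (N.deg n) := fun x =>
        homogeneous_induction M.internal
          (C := fun x => ((x, 0) : M.carrier × N.carrier) ∈ ⨆ n, (M.deg n).prod (N.deg n))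
          (fun n x hx => AddSubgroup.mem_iSup_of_mem n ⟨hx, zero_mem _⟩) (zero_mem _)
          (fun x y hx hy => by simpa using add_mem hx hy) x
      have h2 : ∀ y : N.carrier, ((0, y) : M.carrier × N.carrier) ∈
          ⨆ n, (M.deg n).prod (N.deg n) := fun y =>
        homogeneous_induction N.internal
          (C := fun y => ((0, y) : M.carrier × N.carrier) ∈ ⨆ n, (M.deg n).prod (N.deg n))
          (fun n x hx => AddSubgroup.mem_iSup_of_mem n ⟨zero_mem _, hx⟩) (zero_mem _)
          (fun x y hx hy => by simpa using add_mem hx hy) y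
      simpa using add_mem (h1 x) (h2 y)
  smul_mem ha hx := ⟨M.smul_mem ha hx.1, N.smul_mem ha hx.2⟩
  finite := by
    have := M.finite
    have := N.finite
    infer_instance

/-- The direct sum as a biproduct. -/
def bicone (M N : GrMod 𝒜) : BinaryBicone M N where
  pt := prod M N
  fst := ⟨LinearMap.fst A _ _, fun _ _ hx => hx.1⟩
  snd := ⟨LinearMap.snd A _ _, fun _ _ hx => hx.2⟩
  inl := ⟨LinearMap.inl A _ _, fun _ _ hx => ⟨hx, zero_mem _⟩⟩
  inr := ⟨LinearMap.inr A _ _, fun _ _ hx => ⟨zero_mem _, hx⟩⟩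
  inl_fst := rfl
  inl_snd := rfl
  inr_fst := rfl
  inr_snd := rfl

instance : HasBinaryBiproducts (GrMod 𝒜) where
  has_binary_biproduct M N := HasBinaryBiproduct.mk ⟨bicone M N,
    isBinaryBilimitOfTotal _ (hom_ext fun _ => Prod.ext (add_zero _) (zero_add _))⟩

end GrMod

namespace GrBimod

variable (B : GrBimod 𝒜 ℛ) (M : GrMod ℛ)

/-- The relations `b r ⊗ m = b ⊗ r m`. -/
def rels : Submodule A (B.carrier ⊗[ℤ] M.carrier) :=
  Submodule.span A {x | ∃ (b : B.carrier) (r : R) (m : M.carrier), x = (op r • b) ⊗ₜ[ℤ] m - b ⊗ₜ[ℤ] (r • m)}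

/-- The tensor product `B ⊗_R M` over the not necessarily commutative ring `R`. -/
abbrev Tensor : Type := (B.carrier ⊗[ℤ] M.carrier) ⧸ B.rels M

/-- The class of `b ⊗ m`. -/
def tmul (b : B.carrier) (m : M.carrier) : B.Tensor M := (B.rels M).mkQ (b ⊗ₜ[ℤ] m)

lemma tmul_add (b : B.carrier) (m m' : M.carrier) :
    B.tmul M b (m + m') = B.tmul M b m + B.tmul M b m' := by
  simp only [tmul, TensorProduct.tmul_add, map_add]

lemma add_tmul (b b' : B.carrier) (m : M.carrier) :
    B.tmul M (b + b') m = B.tmul M b m + B.tmul M b' m := by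
  simp only [tmul, TensorProduct.add_tmul, map_add]

lemma tmul_zero (b : B.carrier) : B.tmul M b 0 = 0 := by
  simp only [tmul, TensorProduct.tmul_zero, map_zero]

lemma zero_tmul (m : M.carrier) : B.tmul M 0 m = 0 := by
  simp only [tmul, TensorProduct.zero_tmul, map_zero]

lemma smul_tmul (a : A) (b : B.carrier) (m : M.carrier) :
    a • B.tmul M b m = B.tmul M (a • b) m := by
  simp only [tmul, ← map_smul, TensorProduct.smul_tmul']

lemma op_smul_tmul (r : R) (b : B.carrier) (m : M.carrier) :
    B.tmul M (op r • b) m = B.tmul M b (r • m) := by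
  rw [← sub_eq_zero, tmul, tmul, ← map_sub, Submodule.mkQ_apply, Submodule.Quotient.mk_eq_zero]
  exact Submodule.subset_span ⟨b, r, m, rfl⟩

variable {M} in
lemma tensor_induction {C : B.Tensor M → Prop} (h : ∀ b m, C (B.tmul M b m)) (h0 : C 0)
    (hadd : ∀ x y, C x → C y → C (x + y)) (x : B.Tensor M) : C x := by
  obtain ⟨x, rfl⟩ := (B.rels M).mkQ_surjective x
  induction x with
  | zero => rw [map_zero]; exact h0
  | tmul b m => exact h b m
  | add x y hx hy => rw [map_add]; exact hadd _ _ hx hy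

/-- The grading of the tensor product. -/
def tensorDeg (n : ℤ) : AddSubgroup (B.Tensor M) :=
  AddSubgroup.closure {x | ∃ i j b m, b ∈ B.deg i ∧ m ∈ M.deg j ∧ i + j = n ∧ x = B.tmul M b m}

lemma tmul_mem {i j n : ℤ} {b : B.carrier} {m : M.carrier} (hb : b ∈ B.deg i) (hm : m ∈ M.deg j)
    (h : i + j = n) : B.tmul M b m ∈ B.tensorDeg M n :=
  AddSubgroup.subset_closure ⟨i, j, b, m, hb, hm, h, rfl⟩

lemma tensor_smul_mem {i j : ℤ} {a : A} {x : B.Tensor M} (ha : a ∈ 𝒜 i)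
    (hx : x ∈ B.tensorDeg M j) : a • x ∈ B.tensorDeg M (i + j) := by
  induction hx using AddSubgroup.closure_induction with
  | mem x hx =>
    obtain ⟨k, l, b, m, hb, hm, rfl, rfl⟩ := hx
    rw [smul_tmul]
    exact B.tmul_mem M (B.smul_mem ha hb) hm (by ring)
  | zero => rw [smul_zero]; exact zero_mem _
  | add x y _ _ hx hy => rw [smul_add]; exact add_mem hx hy
  | neg x _ hx => rw [smul_neg]; exact neg_mem hx

lemma tensor_finite : Module.Finite A (B.Tensor M) := by
  classical
  have := B.finite
  obtain ⟨s, hs⟩ := M.finite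
  let f : (s → B.carrier) →ₗ[A] B.Tensor M :=
    { toFun := fun b => ∑ m, B.tmul M (b m) m
      map_add' := fun b b' => by simp only [Pi.add_apply, add_tmul, Finset.sum_add_distrib]
      map_smul' := fun a b => by
        simp only [Pi.smul_apply, ← smul_tmul, Finset.smul_sum, RingHom.id_apply] }
  refine Module.Finite.of_surjective f fun x => LinearMap.mem_range.1 ?_
  refine B.tensor_induction (C := fun x => x ∈ LinearMap.range f) (fun b m => ?_) (zero_mem _)
    (fun _ _ => add_mem) x
  have hm : m ∈ Submodule.span R (s : Set M.carrier) := hs ▸ Submodule.mem_top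
  induction hm using Submodule.span_induction generalizing b with
  | mem m hm =>
    refine ⟨Pi.single ⟨m, hm⟩ b, ?_⟩
    change ∑ m', B.tmul M ((Pi.single ⟨m, hm⟩ b : s → B.carrier) m') m' = _
    rw [Finset.sum_eq_single ⟨m, hm⟩, Pi.single_eq_same]
    · intro m' _ h
      rw [Pi.single_eq_of_ne h, zero_tmul]
    · intro h; exact absurd (Finset.mem_univ _) h
  | zero => rw [tmul_zero]; exact zero_mem _
  | add x y _ _ hx hy => rw [tmul_add]; exact add_mem (hx b) (hy b)
  | smul r x _ hx => rw [← op_smul_tmul]; exact hx _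

lemma tensor_isInternal [GradedRing ℛ] : DirectSum.IsInternal (B.tensorDeg M) := by
  obtain ⟨Δ, hΔ⟩ := exists_coaction B.internal
  obtain ⟨Δ', hΔ'⟩ := exists_coaction M.internal
  have hR : DirectSum.IsInternal ℛ := DirectSum.Decomposition.isInternal ℛ
  -- the coaction on the tensor product over the integers
  let g : B.carrier → M.carrier → (ℤ →₀ B.Tensor M) := fun b m =>
    (Δ b).sum fun i b' => (Δ' m).sum fun j m' => Finsupp.single (i + j) (B.tmul M b' m')
  have g1 : ∀ b m m', g b (m + m') = g b m + g b m' := by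
    intro b m m'
    simp only [g]
    rw [map_add, ← Finsupp.sum_add]
    refine Finsupp.sum_congr fun i _ => ?_
    exact Finsupp.sum_add_index' (fun j => by rw [tmul_zero, Finsupp.single_zero])
      (fun j x y => by rw [tmul_add, Finsupp.single_add])
  have g2 : ∀ b b' m, g (b + b') m = g b m + g b' m := by
    intro b b' m
    simp only [g]
    rw [map_add]
    refine Finsupp.sum_add_index' (fun i => ?_) (fun i x y => ?_)
    · exact Finset.sum_eq_zero fun j _ => by simp only [zero_tmul, Finsupp.single_zero]
    · rw [← Finsupp.sum_add]
      exact Finsupp.sum_congr fun j _ => by rw [add_tmul, Finsupp.single_add]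
  let μ : B.carrier →+ M.carrier →+ (ℤ →₀ B.Tensor M) :=
    AddMonoidHom.mk' (fun b => AddMonoidHom.mk' (g b) (g1 b))
      (fun b b' => AddMonoidHom.ext fun m => g2 b b' m)
  have hμ : ∀ i j b m, b ∈ B.deg i → m ∈ M.deg j →
      μ b m = Finsupp.single (i + j) (B.tmul M b m) := by
    intro i j b m hb hm
    change (Δ b).sum (fun i b' => (Δ' m).sum fun j m' => Finsupp.single (i + j) (B.tmul M b' m')) = _
    rw [hΔ i b hb, hΔ' j m hm]
    rw [Finsupp.sum_single_index, Finsupp.sum_single_index]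
    · rw [tmul_zero, Finsupp.single_zero]
    · exact Finset.sum_eq_zero fun j _ => by simp only [zero_tmul, Finsupp.single_zero]
  have hrel : ∀ (r : R) (b : B.carrier) (m : M.carrier), μ (op r • b) m = μ b (r • m) := by
    intro r b m
    refine homogeneous_induction hR (C := fun r => μ (op r • b) m = μ b (r • m))
      (fun k r hr => ?_) (by simp)
      (fun x y hx hy => by simp only [MulOpposite.op_add, add_smul, map_add, AddMonoidHom.add_apply, hx, hy]) r
    refine homogeneous_induction B.internal (C := fun b => μ (op r • b) m = μ b (r • m))
      (fun i b hb => ?_) (by simp)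
      (fun x y hx hy => by simp only [smul_add, map_add, AddMonoidHom.add_apply, hx, hy]) b
    refine homogeneous_induction M.internal (C := fun m => μ (op r • b) m = μ b (r • m))
      (fun j m hm => ?_) (by simp)
      (fun x y hx hy => by simp only [smul_add, map_add, hx, hy]) m
    rw [hμ _ _ _ _ (B.op_smul_mem hb hr) hm, hμ _ _ _ _ hb (M.smul_mem hr hm), op_smul_tmul,
      add_assoc]
  let Φ : B.carrier ⊗[ℤ] M.carrier →+ (ℤ →₀ B.Tensor M) :=
    TensorProduct.liftAddHom μ (fun n b m => by simp)
  have hΦ : ∀ b m, Φ (b ⊗ₜ m) = μ b m := fun b m => rfl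
  have hker : ∀ x ∈ B.rels M, Φ x = 0 := by
    intro x hx
    induction hx using Submodule.closure_induction with
    | zero => exact map_zero _
    | add x y _ _ hx hy => rw [map_add, hx, hy, add_zero]
    | smul_mem a x hx =>
      obtain ⟨b, r, m, rfl⟩ := hx
      rw [smul_sub, TensorProduct.smul_tmul', TensorProduct.smul_tmul', smul_comm a (op r) b,
        map_sub, hΦ, hΦ, hrel, sub_self]
  let Ψ : B.Tensor M →+ (ℤ →₀ B.Tensor M) :=
    QuotientAddGroup.lift (B.rels M).toAddSubgroup Φ hker
  have hΨ : ∀ b m, Ψ (B.tmul M b m) = μ b m := fun b m => rfl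
  refine isInternal_of_coaction _ Ψ (fun n x hx => ?_) (fun x => ?_)
  · induction hx using AddSubgroup.closure_induction with
    | mem x hx =>
      obtain ⟨i, j, b, m, hb, hm, rfl, rfl⟩ := hx
      rw [hΨ, hμ _ _ _ _ hb hm]
    | zero => rw [map_zero, Finsupp.single_zero]
    | add x y _ _ hx hy => rw [map_add, hx, hy, Finsupp.single_add]
    | neg x _ hx => rw [map_neg, hx, Finsupp.single_neg]
  · refine B.tensor_induction (C := fun x => x ∈ ⨆ n, B.tensorDeg M n) (fun b m => ?_)
      (zero_mem _) (fun _ _ => add_mem) x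
    refine homogeneous_induction B.internal (C := fun b => B.tmul M b m ∈ ⨆ n, B.tensorDeg M n)
      (fun i b hb => ?_) (by rw [zero_tmul]; exact zero_mem _)
      (fun x y hx hy => by rw [add_tmul]; exact add_mem hx hy) b
    refine homogeneous_induction M.internal (C := fun m => B.tmul M b m ∈ ⨆ n, B.tensorDeg M n)
      (fun j m hm => ?_) (by rw [tmul_zero]; exact zero_mem _)
      (fun x y hx hy => by rw [tmul_add]; exact add_mem hx hy) m
    exact AddSubgroup.mem_iSup_of_mem (i + j) (B.tmul_mem M hb hm rfl)

/-- The graded module `B ⊗_R M`. -/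
def tensorObj [GradedRing ℛ] : GrMod 𝒜 where
  carrier := B.Tensor M
  deg := B.tensorDeg M
  internal := B.tensor_isInternal M
  smul_mem := B.tensor_smul_mem M
  finite := B.tensor_finite M

variable {M} in
/-- The homomorphism `id ⊗ f`. -/
noncomputable def tensorHom {N : GrMod ℛ} (f : M ⟶ N) : B.Tensor M →ₗ[A] B.Tensor N :=
  (B.rels M).mapQ (B.rels N)
    (TensorProduct.AlgebraTensorModule.lTensor A B.carrier (f.1.toAddMonoidHom.toIntLinearMap))
    (Submodule.span_le.2 (by
      rintro _ ⟨b, r, m, rfl⟩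
      refine Submodule.subset_span ⟨b, r, f.1 m, ?_⟩
      rw [map_sub]
      change (op r • b) ⊗ₜ[ℤ] (f.1 m) - b ⊗ₜ[ℤ] f.1 (r • m) = _
      rw [map_smul]))

variable {M} in
@[simp] lemma tensorHom_tmul {N : GrMod ℛ} (f : M ⟶ N) (b : B.carrier) (m : M.carrier) :
    B.tensorHom f (B.tmul M b m) = B.tmul N b (f.1 m) := rfl

lemma tensorHom_mem {N : GrMod ℛ} (f : M ⟶ N) {n : ℤ} {x : B.Tensor M}
    (hx : x ∈ B.tensorDeg M n) : B.tensorHom f x ∈ B.tensorDeg N n := by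
  induction hx using AddSubgroup.closure_induction with
  | mem x hx =>
    obtain ⟨i, j, b, m, hb, hm, h, rfl⟩ := hx
    rw [tensorHom_tmul]
    exact B.tmul_mem N hb (f.2 j m hm) h
  | zero => rw [map_zero]; exact zero_mem _
  | add x y _ _ hx hy => rw [map_add]; exact add_mem hx hy
  | neg x _ hx => rw [map_neg]; exact neg_mem hx

/-- The functor `B ⊗_R -`. -/
noncomputable def tensor [GradedRing ℛ] : GrMod ℛ ⥤ GrMod 𝒜 where
  obj M := B.tensorObj M
  map {M N} f := ⟨B.tensorHom f, fun _ _ hx => B.tensorHom_mem M f hx⟩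
  map_id M := GrMod.hom_ext fun x => by
    refine B.tensor_induction (C := fun x => B.tensorHom (𝟙 M) x = x) (fun b m => rfl)
      (map_zero _) (fun x y hx hy => by rw [map_add, hx, hy]) x
  map_comp {L M N} f g := GrMod.hom_ext fun x => by
    refine B.tensor_induction
      (C := fun x => B.tensorHom (f ≫ g) x = B.tensorHom g (B.tensorHom f x)) (fun b m => rfl)
      (by simp only [map_zero]) (fun x y hx hy => by simp only [map_add, hx, hy]) x

end GrBimod

end GradedModules

section TangleBimod

variable {P Q : Type} [LinearOrder P] [LinearOrder Q] [Fintype P] [Fintype Q]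

/-- `ℱ(T)` as a graded bimodule. -/
noncomputable def CupTangle.bimod (T : CupTangle P Q) :
    GrBimod (ArcRing.degree Q) (ArcRing.degree P) where
  carrier := CupBimod T
  deg := CupBimod.degree T
  internal := isInternal_pi₂ (fun b a => circles b (T.cup a)) (half P) (CupBimod.degree T)
    (fun _ _ => Iff.rfl)
  smul_mem {i j x z} hx hz c a := by
    rw [CupBimod.smul_apply]
    exact sum_mem fun b _ => contract_mem _ c b (T.cup a) rfl (circles_id _ b) (circles_id _ c)
      (hx c b) (hz b a) (by ring)
  op_smul_mem {i j x z} hz hx d c := by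
    rw [CupBimod.op_smul_apply]
    exact sum_mem fun a _ => contract_mem _ c a d (circles_comm _ _) rfl rfl
      (hx a c) (hz d a) (by ring)
  finite := by
    have : Module.Finite ℤ (CupBimod T) :=
      finite_pi₂ (fun (b : Matching Q) (a : Matching P) => circles b (T.cup a))
    exact Module.Finite.of_restrictScalars_finite ℤ _ _

/-- `ℱ(W(T))` as a graded bimodule. -/
noncomputable def CupTangle.mirrorBimod (T : CupTangle P Q) :
    GrBimod (ArcRing.degree P) (ArcRing.degree Q) where
  carrier := CapBimod T
  deg := CapBimod.degree T
  internal := isInternal_pi₂ (fun b a => circles (T.cup b) a) (half Q) (CapBimod.degree T)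
    (fun _ _ => Iff.rfl)
  smul_mem {i j x z} hx hz c a := by
    rw [CapBimod.smul_apply]
    exact sum_mem fun b _ => contract_mem _ c b a rfl (circles_comm _ _) (circles_comm _ _)
      (hx c b) (hz b a) (by ring)
  op_smul_mem {i j x z} hz hx d c := by
    rw [CapBimod.op_smul_apply]
    exact sum_mem fun a _ => contract_mem _ c a (T.cup d) (circles_comm _ _)
      (by rw [CupTangle.id_cup]) (by rw [CupTangle.id_cup]) (hx a c) (hz d a) (by ring)
  finite := by
    have : Module.Finite ℤ (CapBimod T) :=
      finite_pi₂ (fun (b : Matching P) (a : Matching Q) => circles (T.cup b) a)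
    exact Module.Finite.of_restrictScalars_finite ℤ _ _

end TangleBimod
end ArcAlgebra

namespace ArcAlgebra

open CategoryTheory CategoryTheory.Limits

section PiCategory

universe u v w

variable {I : Type w} {D : I → Type u} [∀ i, Category.{v} (D i)] [∀ i, Preadditive (D i)]

instance : Preadditive (∀ i, D i) where
  homGroup X Y := inferInstanceAs (AddCommGroup (∀ i, X i ⟶ Y i))
  add_comp _ _ _ _ _ _ := funext fun _ => Preadditive.add_comp _ _ _ _ _ _
  comp_add _ _ _ _ _ _ := funext fun _ => Preadditive.comp_add _ _ _ _ _ _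

instance [∀ i, HasBinaryBiproducts (D i)] : HasBinaryBiproducts (∀ i, D i) where
  has_binary_biproduct X Y := by
    let b : BinaryBicone X Y :=
      { pt := fun i => X i ⊞ Y i
        fst := fun _ => biprod.fst
        snd := fun _ => biprod.snd
        inl := fun _ => biprod.inl
        inr := fun _ => biprod.inr
        inl_fst := funext fun _ => biprod.inl_fst
        inl_snd := funext fun _ => biprod.inl_snd
        inr_fst := funext fun _ => biprod.inr_fst
        inr_snd := funext fun _ => biprod.inr_snd }
    exact HasBinaryBiproduct.mk ⟨b, isBinaryBilimitOfTotal b (funext fun _ => biprod.total)⟩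

end PiCategory

/-! ### Weights -/

/-- A sequence is admissible if its terms are `0`, `1`, `2` and add up to `2 k`. -/
def Admissible {n : ℕ} (k : ℕ) (l : Fin n → ℤ) : Prop :=
  (∀ x, 0 ≤ l x ∧ l x ≤ 2) ∧ ∑ x, l x = 2 * k

/-- Admissible weights. -/
abbrev Weight (n k : ℕ) : Type := {l : Fin n → ℤ // Admissible k l}

/-- The positions `s(l)` of the terms that are equal to `1`. -/
abbrev Ones {n : ℕ} (l : Fin n → ℤ) : Type := {x : Fin n // l x = 1}

/-- The root `(0, …, 0, 1, -1, 0, …, 0)` with `1` at position `i` and `-1` at position `j`, where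
`j` will be the position after `i`. -/
def eps {n : ℕ} (i j : Fin n) : Fin n → ℤ := Pi.single i 1 - Pi.single j 1

/-- The category `𝒞(l)`. -/
abbrev WeightCat {n : ℕ} (l : Fin n → ℤ) : Type 1 := GrMod (ArcRing.degree (Ones l))

/-- The category `𝒞`, the direct sum of the categories `𝒞(l)` over the finite set of all
admissible weights. -/
abbrev TotalCat (n k : ℕ) : Type 1 := ∀ l : Weight n k, WeightCat l.1

section Tangles

variable {n : ℕ} {i j : Fin n} {l m : Fin n → ℤ}

lemma swap_lt (hij : (i : ℕ) + 1 = j) {x y : Fin n} (hxy : x < y) (h : ¬ (x = i ∧ y = j)) :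
    Equiv.swap i j x < Equiv.swap i j y := by
  simp only [Equiv.swap_apply_def, Fin.ext_iff, Fin.lt_def] at *
  split_ifs <;> omega

/-- The tangle `Id_i^{i+1}` or `Id_{i+1}^i`, which has through-strands only: one of them runs from
`i` to `j = i + 1` or the other way round, and the others are vertical. -/
def slide (hij : (i : ℕ) + 1 = j) (hl : ¬ (l i = 1 ∧ l j = 1))
    (hm : ∀ x, m x = l (Equiv.swap i j x)) : CupTangle (Ones l) (Ones m) where
  emb := OrderEmbedding.ofStrictMono
    (fun x => ⟨Equiv.swap i j x.1, by rw [hm, Equiv.swap_apply_self]; exact x.2⟩)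
    (fun x y hxy => swap_lt hij hxy (fun h => hl ⟨h.1 ▸ x.2, h.2 ▸ y.2⟩))
  arc q := q
  arc_notMem _ h := h
  arc_ne q h := absurd ⟨⟨Equiv.swap i j q.1, by rw [← hm]; exact q.2⟩,
    Subtype.ext (Equiv.swap_apply_self i j q.1)⟩ h
  arc_arc _ _ := rfl
  arc_adj _ _ _ h h' := lt_asymm h h'

/-- The tangle `∪^{i,i+1}`: a cup joins the top endpoints `i` and `j = i + 1`, and all other strands
are vertical.  Its mirror image is `∩_{i,i+1}`. -/
def cupAt (hij : (i : ℕ) + 1 = j) (hi : l i ≠ 1) (hj : l j ≠ 1) (hi' : m i = 1) (hj' : m j = 1)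
    (hm : ∀ x, x ≠ i → x ≠ j → m x = l x) : CupTangle (Ones l) (Ones m) :=
  have hne : ∀ x : Ones l, x.1 ≠ i ∧ x.1 ≠ j := fun x =>
    ⟨fun h => hi (h ▸ x.2), fun h => hj (h ▸ x.2)⟩
  let f : Ones l → Ones m := fun x => ⟨x.1, by rw [hm _ (hne x).1 (hne x).2]; exact x.2⟩
  have hf : StrictMono f := fun _ _ h => h
  have hr : ∀ q : Ones m, q ∉ Set.range f ↔ q.1 = i ∨ q.1 = j := fun q => by
    constructor
    · intro h
      by_contra! h'
      exact h ⟨⟨q.1, by rw [← hm _ h'.1 h'.2]; exact q.2⟩, rfl⟩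
    · rintro h ⟨x, rfl⟩
      exact h.elim (hne x).1 (hne x).2
  { emb := OrderEmbedding.ofStrictMono f hf
    arc := fun q => ⟨Equiv.swap i j q.1, by
      rw [Equiv.swap_apply_def]
      split_ifs
      exacts [hj', hi', q.2]⟩
    arc_notMem := fun q h => by
      change q ∉ Set.range f at h
      change _ ∉ Set.range f
      rw [hr] at h ⊢
      rcases h with h | h
      · exact Or.inr (by simp [h])
      · exact Or.inl (by simp [h])
    arc_ne := fun q h h' => by
      change q ∉ Set.range f at h
      rw [hr] at h
      have := congrArg Subtype.val h'
      rcases h with h | h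
      · simp only [h, Equiv.swap_apply_left, Fin.ext_iff] at this; omega
      · simp only [h, Equiv.swap_apply_right, Fin.ext_iff] at this; omega
    arc_arc := fun q _ => Subtype.ext (Equiv.swap_apply_self i j q.1)
    arc_adj := fun q h x h1 h2 => by
      change q ∉ Set.range f at h
      rw [hr] at h
      replace h1 : q.1 < x.1 := h1
      replace h2 : x.1 < Equiv.swap i j q.1 := h2
      rcases h with h | h
      · rw [h] at h1 h2
        rw [Equiv.swap_apply_left] at h2
        simp only [Fin.lt_def] at h1 h2; omega
      · rw [h] at h1 h2
        rw [Equiv.swap_apply_right] at h2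
        simp only [Fin.lt_def] at h1 h2; omega }

end Tangles

section Functors

variable {n : ℕ} {i j : Fin n} {l m : Fin n → ℤ}

/-- The zero functor. -/
noncomputable def zeroFunctor (C : Type 1) [Category.{0} C] (m : Fin n → ℤ) : C ⥤ WeightCat m :=
  (Functor.const C).obj (GrMod.zero _)

lemma eps_left (hij : (i : ℕ) + 1 = j) : eps i j i = 1 := by
  have : i ≠ j := fun h => by rw [h] at hij; omega
  simp [eps, this]

lemma eps_right (hij : (i : ℕ) + 1 = j) : eps i j j = -1 := by
  have : j ≠ i := fun h => by rw [h] at hij; omega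
  simp [eps, this]

lemma eps_other {x : Fin n} (hi : x ≠ i) (hj : x ≠ j) : eps i j x = 0 := by
  simp [eps, hi, hj]

lemma apply_swap (h1 : m i = l j) (h2 : m j = l i) (h3 : ∀ x, x ≠ i → x ≠ j → m x = l x)
    (x : Fin n) : m x = l (Equiv.swap i j x) := by
  rw [Equiv.swap_apply_def]
  split_ifs with h h'
  · rw [h, h1]
  · rw [h', h2]
  · exact h3 x h h'

/-- The component `𝒞(l) ⥤ 𝒞(m)` of the functor `ℰ_i`, where `m = l + ε_i`. -/
noncomputable def stepE (hij : (i : ℕ) + 1 = j) (hm : m = l + eps i j) : WeightCat l ⥤ WeightCat m :=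
  have mi : m i = l i + 1 := by rw [hm, Pi.add_apply, eps_left hij]
  have mj : m j = l j - 1 := by rw [hm, Pi.add_apply, eps_right hij]; ring
  have mx : ∀ x, x ≠ i → x ≠ j → m x = l x := fun x h h' => by
    rw [hm, Pi.add_apply, eps_other h h', add_zero]
  if h : (l i = 1 ∧ l j = 2) ∨ (l i = 0 ∧ l j = 1) then
    (slide (l := l) (m := m) hij (by omega)
      (apply_swap (by omega) (by omega) mx)).bimod.tensor
  else if h : l i = 0 ∧ l j = 2 then
    (cupAt (l := l) (m := m) hij (by omega) (by omega) (by omega) (by omega) mx).bimod.tensor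
  else if h : l i = 1 ∧ l j = 1 then
    (cupAt (l := m) (m := l) hij (by omega) (by omega) (by omega) (by omega)
      (fun x h h' => (mx x h h').symm)).mirrorBimod.tensor
  else zeroFunctor _ m

/-- The component `𝒞(l) ⥤ 𝒞(m)` of the functor `ℱ_i`, where `m = l - ε_i`. -/
noncomputable def stepF (hij : (i : ℕ) + 1 = j) (hm : m = l - eps i j) : WeightCat l ⥤ WeightCat m :=
  have mi : m i = l i - 1 := by rw [hm, Pi.sub_apply, eps_left hij]
  have mj : m j = l j + 1 := by rw [hm, Pi.sub_apply, eps_right hij]; ring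
  have mx : ∀ x, x ≠ i → x ≠ j → m x = l x := fun x h h' => by
    rw [hm, Pi.sub_apply, eps_other h h', sub_zero]
  if h : (l i = 1 ∧ l j = 0) ∨ (l i = 2 ∧ l j = 1) then
    (slide (l := l) (m := m) hij (by omega)
      (apply_swap (by omega) (by omega) mx)).bimod.tensor
  else if h : l i = 2 ∧ l j = 0 then
    (cupAt (l := l) (m := m) hij (by omega) (by omega) (by omega) (by omega) mx).bimod.tensor
  else if h : l i = 1 ∧ l j = 1 then
    (cupAt (l := m) (m := l) hij (by omega) (by omega) (by omega) (by omega)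
      (fun x h h' => (mx x h h').symm)).mirrorBimod.tensor
  else zeroFunctor _ m

variable (k : ℕ)

open Classical in
/-- The functor `ℰ_i : 𝒞 ⥤ 𝒞`, where `j = i + 1`: its component in `𝒞(m)` comes from the summand
`𝒞(m - ε_i)` if `m - ε_i` is admissible, and is zero otherwise. -/
noncomputable def functorE (hij : (i : ℕ) + 1 = j) : TotalCat n k ⥤ TotalCat n k :=
  Functor.pi' fun m =>
    if h : Admissible k (m.1 - eps i j) then
      Pi.eval (fun l : Weight n k => WeightCat l.1) ⟨m.1 - eps i j, h⟩ ⋙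
        stepE hij (sub_add_cancel m.1 (eps i j)).symm
    else zeroFunctor _ m.1

open Classical in
/-- The functor `ℱ_i : 𝒞 ⥤ 𝒞`, where `j = i + 1`: its component in `𝒞(m)` comes from the summand
`𝒞(m + ε_i)` if `m + ε_i` is admissible, and is zero otherwise. -/
noncomputable def functorF (hij : (i : ℕ) + 1 = j) : TotalCat n k ⥤ TotalCat n k :=
  Functor.pi' fun m =>
    if h : Admissible k (m.1 + eps i j) then
      Pi.eval (fun l : Weight n k => WeightCat l.1) ⟨m.1 + eps i j, h⟩ ⋙
        stepF hij (add_sub_cancel_right m.1 (eps i j)).symm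
    else zeroFunctor _ m.1

/-- The identification of `𝒞(l)` with `𝒞(m)` for `l = m`. -/
noncomputable def castFunctor : ∀ {l m : Fin n → ℤ}, l = m → (WeightCat l ⥤ WeightCat m)
  | _, _, rfl => 𝟭 _

variable {k}

open Classical in
/-- The inclusion of the summand `𝒞(l)` in `𝒞`. -/
noncomputable def incl (l : Weight n k) : WeightCat l.1 ⥤ TotalCat n k :=
  Functor.pi' fun m =>
    if h : l.1 = m.1 then castFunctor h else zeroFunctor _ m.1

/-- The functor `{d}` on `𝒞(l)`. -/
noncomputable abbrev gradeShift (l : Fin n → ℤ) (d : ℤ) : WeightCat l ⥤ WeightCat l := GrMod.shift _ d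

end Functors
end ArcAlgebra

/-! On objects concentrated in weight `l`, each of the two composites of `functorE` and `functorF`
passes through a single intermediate weight. It is therefore tensoring with two tangle bimodules in
succession, or zero if that weight is not admissible. If the entries of `l` at `i` and `j` differ,
exactly one composite survives. If both are `0` or both are `2`, neither does. Three geometric facts
remain. Two opposite slides of a strand compose to the identity. A cup followed by its mirror image
creates a circle, whose value `𝒜 = ℤX ⊕ ℤ1` accounts for the shifts by `1` and `-1`. A cap followed
by a cup is the same tangle whether the intermediate weight has entries `(0,2)` or `(2,0)`, because
only the set of positions with entry `1` enters.

A general gluing theorem for tangle bimodules is not needed. If `T` consists of cups and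
through-strands, then `ℱ(W(b)Ta)` is literally the entry `(b, Ta)` of the arc ring of the top
points. Thus `ℱ(T)` is, up to a shift, a left ideal `Re` of that arc ring `R`, where `e` is the
idempotent of the matchings of the form `Ta`. Consequently `B ⊗_R ℱ(T) = Be`, which keeps only the
columns `Ta` of `B`. It suffices that `Be` is free over the arc ring `A` of the bottom points, on
homogeneous elements for which left and right multiplication by `A` agree. `GrBimod.Splitting`
records this situation, and `Splitting.bijective` concludes that `B ⊗_R ℱ(T) ⊗_A M` is a sum of
shifted copies of `M`, naturally in `M`.

The two instances are `slideSplitting`, with one basis element, and `circleSplitting`, with basis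
`X`, `1` of the additional circle. In both, the actions must be computed on matchings of the form
`Ta`. The circles of `W(Tb)Ta` are those of `W(b)a` together with one circle for each cup
(`circleSum_cup`). Testing the contraction polynomial on colourings of circles by `± t` then shows
that it does not see the cups (`mk_theta_cup`) and that it is `1` when an arc diagram is contracted
against its own closure (`mk_theta_self`).

The rest is bookkeeping on the total category: `incl_comp_iso` reduces the composites to single
components, and `prodFunctor_incl` carries the direct sum of shifts through the inclusion. -/

namespace ArcAlgebra

/-! ### Circles of closures of `Tb` and `Ta`, and the contraction polynomial on them. -/

section CupCircles

variable {P Q : Type} [LinearOrder P] [LinearOrder Q] [Fintype P] [Fintype Q]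
  (T : CupTangle P Q)

lemma sameCircle_map {V W : Type} {α β : V → V} {α' β' : W → W} (f : V → W)
    (hα : ∀ v, f (α v) = α' (f v)) (hβ : ∀ v, f (β v) = β' (f v)) {v w : V}
    (h : sameCircle α β v w) : sameCircle α' β' (f v) (f w) :=
  sameCircle_le (r := (sameCircle α' β').comap f)
    (fun v => by
      change sameCircle α' β' (f v) (f (α v))
      rw [hα]; exact sameCircle_left _ _ _)
    (fun v => by
      change sameCircle α' β' (f v) (f (β v))
      rw [hβ]; exact sameCircle_right _ _ _) h

lemma circleSum_bijective {V W : Type} [Finite V] [Finite W] {α β : V → V} {α' β' : W → W}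
    (f : V ≃ W) (hα : ∀ v, f (α v) = α' (f v)) (hβ : ∀ v, f (β v) = β' (f v)) (g : W → ℤ)
    (hg1 : ∀ w, g (α' w) = g w) (hg2 : ∀ w, g (β' w) = g w) :
    circleSum (sameCircle α β) (g ∘ f) = circleSum (sameCircle α' β') g := by
  refine circleSum_equiv _ _ _ _ f (fun v w => ⟨sameCircle_map f hα hβ, fun h => ?_⟩)
    (fun w => ⟨f.symm w, by rw [f.apply_symm_apply]⟩) (fun _ => rfl)
    (fun v w => sameCircle_inv hg1 hg2)
  have := sameCircle_map (α' := α) (β' := β) f.symm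
    (fun w => by rw [Equiv.symm_apply_eq, hα, f.apply_symm_apply])
    (fun w => by rw [Equiv.symm_apply_eq, hβ, f.apply_symm_apply]) h
  simpa using this

namespace CupTangle

/-- The top endpoints of the cups. -/
abbrev CupPoints : Type := {q : Q // q ∉ Set.range T.emb}

/-- The partner function of the cups. -/
def cupArc (q : T.CupPoints) : T.CupPoints := ⟨T.arc q.1, T.arc_notMem _ q.2⟩

open Classical in
/-- The top endpoints are those of the through-strands and those of the cups. -/
noncomputable def pointsEquiv : P ⊕ T.CupPoints ≃ Q :=
  ((Equiv.ofInjective T.emb T.emb.injective).sumCongr (Equiv.refl _)).trans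
    (Equiv.sumCompl (· ∈ Set.range T.emb))

lemma pointsEquiv_inl (p : P) : T.pointsEquiv (Sum.inl p) = T.emb p := rfl

lemma pointsEquiv_inr (q : T.CupPoints) : T.pointsEquiv (Sum.inr q) = q.1 := rfl

/-- The sum over the circles that consist of a cup and its mirror image. -/
noncomputable def cupSum (g : Q → ℤ) : ℤ :=
  circleSum (sameCircle T.cupArc T.cupArc) (fun q => g q.1)

lemma pointsEquiv_map (a : Matching P) (v : P ⊕ T.CupPoints) :
    T.pointsEquiv (Sum.map a T.cupArc v) = T.cup a (T.pointsEquiv v) := by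
  rcases v with p | q
  · simp [pointsEquiv_inl]
  · simp only [Sum.map_inr, pointsEquiv_inr]
    rw [T.cup_off a q.1 q.2]; rfl

end CupTangle

/-- Both matchings preserve the decomposition of the top points into strand ends and cup ends. On
the strand ends they are `b` and `a`. On the cup ends they coincide, so every cup closes up with its
mirror image. The second summand depends on neither `a` nor `b`, and hence cancels in differences of
circle counts. -/
lemma circleSum_cup (b a : Matching P) (g : Q → ℤ) (hb : Inv g (T.cup b)) (ha : Inv g (T.cup a)) :
    circleSum (circles (T.cup b) (T.cup a)) g =
      circleSum (circles b a) (g ∘ T.emb) + T.cupSum g := by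
  rw [circles, ← circleSum_bijective T.pointsEquiv (T.pointsEquiv_map b) (T.pointsEquiv_map a) g
    hb ha]
  have hb' := (T.cup_inv b).1 hb
  refine circleSum_sum b a T.cupArc T.cupArc _ (fun v w => ?_) (fun v w => ?_)
  · exact sameCircle_inv (g := fun p => g (T.emb p)) hb'.1 ((T.cup_inv a).1 ha).1
  · exact sameCircle_inv (g := fun q : T.CupPoints => g q.1) (fun q => hb'.2 q.1 q.2)
      (fun q => hb'.2 q.1 q.2)

/-- Contracting arcs away from the cups of `T` is not affected by these cups. -/
lemma mk_theta_cup (c b a : Matching P) :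
    TQFT.mk (circles (T.cup a) (T.cup c)) (theta T c b (T.cup a)) =
      TQFT.mk (circles (T.cup a) (T.cup c))
        (MvPolynomial.rename T.emb (theta (CupTangle.id P) c b a)) := by
  apply mk_eq_of_ev
  intro κ hκ
  obtain ⟨ha, hc⟩ := inv_circles.1 hκ
  have hc' : Inv (κ ∘ T.emb) c := ((T.cup_inv c).1 hc).1
  have ha' : Inv (κ ∘ T.emb) a := ((T.cup_inv a).1 ha).1
  rw [ev_rename]
  -- If the colouring is compatible with `Tb`, both sides are monomials in `2 t` and `-1` whose
  -- doubled exponents are weighted circle counts, so only the counts need comparing. Otherwise both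
  -- sides vanish.
  by_cases hb : Inv κ (T.cup b)
  · have hb' : Inv (κ ∘ T.emb) b := ((T.cup_inv b).1 hb).1
    have w1 := ev_theta T c b (T.cup a) κ ha hc hb
    have w2 := ev_theta (CupTangle.id P) c b a (κ ∘ T.emb) ha' (by simpa using hc')
      (by simpa using hb')
    have hs : ∀ g : Q → ℤ, Inv g (T.cup a) → Inv g (T.cup c) → Inv g (T.cup b) →
        thetaSum T c b (T.cup a) g = thetaSum (CupTangle.id P) c b a (g ∘ T.emb) := by
      intro g h1 h2 h3
      unfold thetaSum
      have : (g ∘ T.emb) ∘ (CupTangle.id P).emb = g ∘ T.emb := rfl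
      rw [this, circleSum_cup T a c g h1 h2, circleSum_cup T a b g h1 h3]
      simp only [CupTangle.id_cup]
      ring
    refine w1.eq w2 (hs _ (fun _ => rfl) (fun _ => rfl) (fun _ => rfl)) (hs _ ?_ ?_ ?_) <;>
      intro q <;> simp only [minus]
    exacts [by rw [ha], by rw [hc], by rw [hb]]
  -- The colouring already respects the cups, since it respects `Tc`. Its failure on `Tb` must
  -- therefore come from an arc of `b`.
  · have hb' : ¬ Inv (κ ∘ T.emb) b := fun h =>
      hb ((T.cup_inv b).2 ⟨h, ((T.cup_inv c).1 hc).2⟩)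
    rw [ev_theta_zero T c b _ κ ha hc hb, ev_theta_zero (CupTangle.id P) c b a (κ ∘ T.emb) ha'
      (by simpa using hc') (by simpa using hb')]

/-- In `W(Tb)Tb` each arc of `b` lies on a small circle of its own, so every saddle merges and none
splits. Numerically, the circles of `W(b)b` are counted by the arcs of `b`, and the doubled number
of splittings comes out as zero for every weight. -/
lemma mk_theta_self (c b : Matching P) {r : Setoid Q} (hr : r = circles (T.cup b) (T.cup c)) :
    TQFT.mk r (theta T c b (T.cup b)) = 1 := by
  subst hr
  rw [← map_one (TQFT.mk _)]
  apply mk_eq_of_ev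
  intro κ hκ
  obtain ⟨hb, hc⟩ := inv_circles.1 hκ
  have w1 := ev_theta T c b (T.cup b) κ hb hc hb
  have hs : ∀ g : Q → ℤ, Inv g (T.cup c) → Inv g (T.cup b) →
      thetaSum T c b (T.cup b) g = 0 := by
    intro g h2 h3
    unfold thetaSum
    rw [circleSum_cup T b c g h3 h2, circleSum_cup T b b g h3 h3,
      arcSum_eq_circleSum b (g ∘ T.emb) ((T.cup_inv b).1 h3).1, circles_comm c b]
    ring
  rw [map_one]
  refine w1.eq ⟨0, 0, by simp⟩ (hs _ (fun _ => rfl) (fun _ => rfl)) (hs _ ?_ ?_) <;>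
    intro q <;> simp only [minus]
  exacts [by rw [hc], by rw [hb]]

/-- Contractions which only merge a circle with the closure of an arc diagram. -/
lemma contract_self (c b : Matching P) {d : Matching Q} (hd : d = T.cup b) {r₁ : Setoid P}
    {r₂ r₃ : Setoid Q} (h₁ : r₁ = circles c b) (h₂ : r₂ = circles d (T.cup b))
    (h₃ : r₃ = circles d (T.cup c)) (f : MvPolynomial P ℤ) (g : MvPolynomial Q ℤ) :
    (contract T c b d (TQFT.mk r₁ f) (TQFT.mk r₂ g) : TQFT r₃) =
      TQFT.mk r₃ (MvPolynomial.rename T.emb f * g) := by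
  subst hd
  rw [contract_mk T c b _ h₁ h₂ h₃, map_mul, mk_theta_self T c b h₃, mul_one]

/-- The local right unit law: the element `1` of `ℱ(W(b)b)` is the idempotent of `b` in the arc
ring. It makes the generators below act as they should. -/
lemma contract_id_self (c b : Matching P) {r₁ r₂ : Setoid P} (h₁ : r₁ = circles c b)
    (h₂ : r₂ = circles b b) (x : TQFT r₁) :
    (contract (CupTangle.id P) c b b x (1 : TQFT r₂) : TQFT r₁) = x := by
  obtain ⟨f, rfl⟩ := x.mk_surj
  rw [← map_one (TQFT.mk r₂), contract_self (CupTangle.id P) c b (by simp) h₁ (by simp [h₂])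
    (by rw [CupTangle.id_cup, circles_comm, h₁]), mul_one]
  have : ((CupTangle.id P).emb : P → P) = id := rfl
  rw [this, MvPolynomial.rename_id_apply]

end CupCircles
end ArcAlgebra

namespace ArcAlgebra

open CategoryTheory CategoryTheory.Limits MulOpposite
open scoped TensorProduct

/-! ### Tensor products with a cyclic projective bimodule as sums of shifts. -/

section Splittings

variable {A R : Type} [Ring A] [Ring R] {𝒜 : ℤ → AddSubgroup A} {ℛ : ℤ → AddSubgroup R}

namespace GrMod

/-- The inverse of a bijective homomorphism preserves the degree. -/
lemma mem_deg_of_bijective {M N : GrMod 𝒜} (f : M ⟶ N) (hf : Function.Injective f.1) {n : ℤ}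
    {y : M.carrier} (hy : f.1 y ∈ N.deg n) : y ∈ M.deg n := by
  obtain ⟨Δ, hΔ⟩ := exists_coaction M.internal
  obtain ⟨Δ', hΔ'⟩ := exists_coaction N.internal
  -- A degree-preserving map commutes with taking homogeneous components. By injectivity, the
  -- components of `y` outside degree `n` vanish with those of its image.
  have h1 : ∀ z k, Δ' (f.1 z) k = f.1 (Δ z k) := fun z k => by
    refine homogeneous_induction M.internal (C := fun z => Δ' (f.1 z) k = f.1 (Δ z k))
      (fun i z hz => ?_) (by simp) (fun x y hx hy => by simp [hx, hy]) z
    rw [hΔ i z hz, hΔ' i _ (f.2 i z hz)]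
    by_cases h : i = k
    · subst h; simp
    · simp [Finsupp.single_eq_of_ne (Ne.symm h)]
  have h2 : ∀ z k, Δ z k ∈ M.deg k := fun z k => by
    refine homogeneous_induction M.internal (C := fun z => Δ z k ∈ M.deg k)
      (fun i z hz => ?_) (by simp) (fun x y hx hy => by
        rw [map_add]; exact add_mem hx hy) z
    rw [hΔ i z hz]
    by_cases h : i = k
    · subst h; simpa using hz
    · simp [Finsupp.single_eq_of_ne (Ne.symm h)]
  have h3 : ∀ z, (Δ z).sum (fun _ w => w) = z := fun z => by
    refine homogeneous_induction M.internal (C := fun z => (Δ z).sum (fun _ w => w) = z)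
      (fun i z hz => ?_) (by simp) (fun x y hx hy => by
        rw [map_add, Finsupp.sum_add_index' (fun _ => rfl) (fun _ _ _ => rfl), hx, hy]) z
    rw [hΔ i z hz, Finsupp.sum_single_index rfl]
  have h4 : Δ y = Finsupp.single n (Δ y n) := by
    ext k
    by_cases h : n = k
    · subst h; simp
    · rw [Finsupp.single_eq_of_ne (Ne.symm h)]
      apply hf
      rw [← h1, hΔ' n _ hy, Finsupp.single_eq_of_ne (Ne.symm h), map_zero]
  have h5 := h3 y
  rw [h4, Finsupp.sum_single_index rfl] at h5
  rw [← h5]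
  exact h2 y n

lemma isIso_of_bijective {M N : GrMod 𝒜} (f : M ⟶ N) (hf : Function.Bijective f.1) : IsIso f := by
  let e := LinearEquiv.ofBijective f.1 hf
  have he : ∀ x, f.1 (e.symm x) = x := fun x => e.apply_symm_apply x
  exact ⟨⟨⟨e.symm.toLinearMap, fun n x hx => mem_deg_of_bijective f hf.1 (by
      change f.1 (e.symm x) ∈ _
      rwa [he])⟩,
    hom_ext fun x => e.symm_apply_apply x, hom_ext fun x => he x⟩⟩

/-- The zeroth shift. -/
def shiftZero (𝒜 : ℤ → AddSubgroup A) : shift 𝒜 0 ≅ 𝟭 (GrMod 𝒜) :=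
  NatIso.ofComponents fun M =>
    { hom := ⟨LinearMap.id, fun n x (hx : x ∈ M.deg (n - 0)) => by rwa [sub_zero] at hx⟩
      inv := ⟨LinearMap.id, fun n x hx => by
        change x ∈ M.deg (n - 0)
        rwa [sub_zero]⟩ }

/-- The direct sum of two functors. -/
def prodFunctor {C : Type*} [Category* C] (F G : C ⥤ GrMod 𝒜) : C ⥤ GrMod 𝒜 where
  obj X := prod (F.obj X) (G.obj X)
  map f := ⟨(F.map f).1.prodMap (G.map f).1, fun n x hx =>
    ⟨(F.map f).2 n _ hx.1, (G.map f).2 n _ hx.2⟩⟩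
  map_id X := hom_ext fun x => by rw [F.map_id, G.map_id]; rfl
  map_comp f g := hom_ext fun x => by rw [F.map_comp, G.map_comp]; rfl

end GrMod

namespace GrBimod

/-- The universal property of the tensor product. -/
lemma exists_lift (B : GrBimod 𝒜 ℛ) (M : GrMod ℛ) {G : Type} [AddCommGroup G]
    (μ : B.carrier →+ M.carrier →+ G) (h : ∀ (b : B.carrier) (r : R) (m : M.carrier), μ (op r • b) m = μ b (r • m)) :
    ∃ φ : B.Tensor M →+ G, ∀ b m, φ (B.tmul M b m) = μ b m := by
  let Φ : B.carrier ⊗[ℤ] M.carrier →+ G := TensorProduct.liftAddHom μ (fun n b m => by simp)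
  have hΦ : ∀ b m, Φ (b ⊗ₜ m) = μ b m := fun b m => rfl
  have hker : ∀ x ∈ B.rels M, Φ x = 0 := by
    intro x hx
    induction hx using Submodule.closure_induction with
    | zero => exact map_zero _
    | add x y _ _ hx hy => rw [map_add, hx, hy, add_zero]
    -- The relations form an `A`-submodule while the biadditive map is not assumed `A`-linear.
    -- Multiples of a relation are nevertheless relations, because the left action commutes with the
    -- right one.
    | smul_mem a x hx =>
      obtain ⟨b, r, m, rfl⟩ := hx
      rw [smul_sub, TensorProduct.smul_tmul', TensorProduct.smul_tmul', smul_comm a (op r) b,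
        map_sub, hΦ, hΦ, h, sub_self]
  exact ⟨QuotientAddGroup.lift (B.rels M).toAddSubgroup Φ hker, fun _ _ => rfl⟩

lemma tensor_add_hom_ext (B : GrBimod 𝒜 ℛ) {M : GrMod ℛ} {G : Type} [AddCommGroup G]
    {φ ψ : B.Tensor M →+ G} (h : ∀ b m, φ (B.tmul M b m) = ψ (B.tmul M b m)) : φ = ψ :=
  AddMonoidHom.ext fun x => B.tensor_induction (C := fun x => φ x = ψ x) h (by simp)
    (fun x y hx hy => by rw [map_add, map_add, hx, hy]) x

variable [GradedRing 𝒜] [GradedRing ℛ]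

section

variable (B : GrBimod 𝒜 ℛ) (C : GrBimod ℛ 𝒜) (M : GrMod 𝒜)

/-- The class of `b ⊗ c ⊗ m`. -/
def tmul₂ (b : B.carrier) (c : C.carrier) (m : M.carrier) : B.Tensor (C.tensorObj M) :=
  B.tmul (C.tensorObj M) b (C.tmul M c m)

lemma tmul₂_add (b : B.carrier) (c : C.carrier) (m m' : M.carrier) :
    tmul₂ B C M b c (m + m') = tmul₂ B C M b c m + tmul₂ B C M b c m' := by
  rw [tmul₂, C.tmul_add]
  exact B.tmul_add (C.tensorObj M) _ _ _

lemma sum_tmul₂ {ι : Type} (s : Finset ι) (b : ι → B.carrier) (c : C.carrier) (m : M.carrier) :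
    tmul₂ B C M (∑ i ∈ s, b i) c m = ∑ i ∈ s, tmul₂ B C M (b i) c m :=
  map_sum (AddMonoidHom.mk' (fun b => tmul₂ B C M b c m)
    (fun b b' => B.add_tmul (C.tensorObj M) b b' _)) b s

lemma smul_tmul₂ (a : A) (b : B.carrier) (c : C.carrier) (m : M.carrier) :
    a • tmul₂ B C M b c m = tmul₂ B C M (a • b) c m := B.smul_tmul (C.tensorObj M) _ _ _

lemma op_smul_tmul₂ (r : R) (b : B.carrier) (c : C.carrier) (m : M.carrier) :
    tmul₂ B C M (op r • b) c m = tmul₂ B C M b (r • c) m := by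
  have := C.smul_tmul M r c m
  rw [tmul₂, tmul₂, ← this]
  exact B.op_smul_tmul (C.tensorObj M) _ _ _

lemma tmul₂_op_smul (a : A) (b : B.carrier) (c : C.carrier) (m : M.carrier) :
    tmul₂ B C M b (op a • c) m = tmul₂ B C M b c (a • m) := by
  rw [tmul₂, C.op_smul_tmul]; rfl

variable {B C M} in
lemma tensor₂_induction {D : B.Tensor (C.tensorObj M) → Prop}
    (h : ∀ b c m, D (tmul₂ B C M b c m)) (h0 : D 0)
    (hadd : ∀ x y, D x → D y → D (x + y)) (x : B.Tensor (C.tensorObj M)) : D x := by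
  refine B.tensor_induction (fun b y => ?_) h0 hadd x
  refine C.tensor_induction (M := M) (C := fun y => D (B.tmul (C.tensorObj M) b y)) (h b) ?_
    (fun x y hx hy => ?_) y
  · have := B.tmul_zero (C.tensorObj M) b
    exact this ▸ h0
  · have := B.tmul_add (C.tensorObj M) b x y
    exact this ▸ hadd _ _ hx hy

end

/-- Data that identify `B ⊗_R C` with a direct sum of shifts of the bimodule `A`, when `C` is
generated by one element over `R` and projective. -/
structure Splitting (B : GrBimod 𝒜 ℛ) (C : GrBimod ℛ 𝒜) {ι : Type} [Fintype ι] [DecidableEq ι]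
    (d : ι → ℤ) where
  coord : C.carrier →ₗ[R] R
  gen : C.carrier
  -- This makes `coord` injective and `coord gen` an idempotent `e` of `R`, so that `C` becomes the
  -- left ideal `Re` and `B ⊗_R C` becomes `Be` through `b ⊗ c ↦ b (coord c)`.
  coord_smul : ∀ c, coord c • gen = c
  proj : ι → B.carrier →ₗ[A] A
  elt : ι → B.carrier
  -- Spanning is required only on the part `Be` of `B`. Elsewhere `B` can be arbitrary.
  expand : ∀ b c, op (coord c) • b = ∑ i, proj i (op (coord c) • b) • elt i
  -- For `a = 1` this is duality of the two families. For general `a` it also says that acting by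
  -- `a` on the right of a basis element, through `C`, is the same as multiplying by `a` on the
  -- left.
  dual : ∀ i j a, proj i (op (coord (op a • gen)) • elt j) = if i = j then a else 0
  shift : ℤ
  coord_mem : ∀ {n c}, c ∈ C.deg n → coord c ∈ ℛ (n + shift)
  proj_mem : ∀ {i n b}, b ∈ B.deg n → proj i b ∈ 𝒜 (n - shift - d i)

namespace Splitting

variable {B : GrBimod 𝒜 ℛ} {C : GrBimod ℛ 𝒜} {ι : Type} [Fintype ι] [DecidableEq ι] {d : ι → ℤ}
  (S : Splitting B C d)

/-- The projections of `B ⊗_R C` to `A`. -/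
def pair (i : ι) (b : B.carrier) (c : C.carrier) : A := S.proj i (op (S.coord c) • b)

lemma pair_add_left (i : ι) (b b' : B.carrier) (c : C.carrier) :
    S.pair i (b + b') c = S.pair i b c + S.pair i b' c := by
  simp only [pair, smul_add, map_add]

lemma pair_add_right (i : ι) (b : B.carrier) (c c' : C.carrier) :
    S.pair i b (c + c') = S.pair i b c + S.pair i b c' := by
  simp only [pair, map_add, MulOpposite.op_add, add_smul]

lemma pair_smul (i : ι) (a : A) (b : B.carrier) (c : C.carrier) :
    S.pair i (a • b) c = a * S.pair i b c := by
  rw [pair, ← smul_comm, map_smul, smul_eq_mul, pair]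

lemma pair_op_smul_left (i : ι) (r : R) (b : B.carrier) (c : C.carrier) :
    S.pair i (op r • b) c = S.pair i b (r • c) := by
  rw [pair, pair, (S.coord).map_smul, smul_eq_mul, MulOpposite.op_mul, mul_smul]

lemma expand' (b : B.carrier) (c : C.carrier) :
    op (S.coord c) • b = ∑ i, S.pair i b c • S.elt i := S.expand b c

/-- Right `A`-linearity is not part of the data; it follows from them. Since `c = coord c • gen`,
the coordinate of `c a` is the product of those of `c` and `gen a`. Expanding `b (coord c)` in the
basis leaves the terms `elt j · coord (gen a)`, which `dual` evaluates. This linearity is what lets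
the pairing descend to `C ⊗_A M`. -/
lemma pair_op_smul_right (i : ι) (a : A) (b : B.carrier) (c : C.carrier) :
    S.pair i b (op a • c) = S.pair i b c * a := by
  have h : S.coord (op a • c) = S.coord c * S.coord (op a • S.gen) := by
    rw [← smul_eq_mul, ← map_smul, smul_comm, S.coord_smul]
  rw [pair, h, MulOpposite.op_mul, mul_smul, S.expand' b c, Finset.smul_sum, map_sum,
    Finset.sum_eq_single i]
  · rw [← smul_comm, map_smul, S.dual, if_pos rfl, smul_eq_mul]
  · intro j _ hj
    rw [← smul_comm, map_smul, S.dual, if_neg (Ne.symm hj), smul_zero]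
  · intro h; exact absurd (Finset.mem_univ _) h

lemma pair_elt (i j : ι) (a : A) :
    S.pair i (S.elt j) (op a • S.gen) = if i = j then a else 0 := S.dual i j a

/-- The degree gained in `coord` is lost again in `proj`, so only the shift `d i` of the summand
survives. -/
lemma pair_mem {i : ι} {m n : ℤ} {b : B.carrier} {c : C.carrier} (hb : b ∈ B.deg m)
    (hc : c ∈ C.deg n) : S.pair i b c ∈ 𝒜 (m + n - d i) := by
  have := S.proj_mem (i := i) (B.op_smul_mem hb (S.coord_mem hc))
  rwa [show m + (n + S.shift) - S.shift - d i = m + n - d i by ring] at this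

lemma exists_inner (M : GrMod 𝒜) (i : ι) (b : B.carrier) :
    ∃ φ : C.Tensor M →+ M.carrier, ∀ c m, φ (C.tmul M c m) = S.pair i b c • m :=
  C.exists_lift M
    (AddMonoidHom.mk' (fun c => AddMonoidHom.mk' (fun m => S.pair i b c • m)
      (fun m m' => smul_add _ m m'))
      (fun c c' => AddMonoidHom.ext fun m => by
        change S.pair i b (c + c') • m = S.pair i b c • m + S.pair i b c' • m
        rw [pair_add_right, add_smul]))
    (fun c a m => by
      change S.pair i b (op a • c) • m = S.pair i b c • a • m
      rw [pair_op_smul_right, mul_smul])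

/-- The universal property is applied twice: the inner maps are additive in `b` because they are
determined on pure tensors, and balanced over `R` by `pair_op_smul_left`. -/
lemma exists_outer (M : GrMod 𝒜) (i : ι) :
    ∃ ψ : B.Tensor (C.tensorObj M) →+ M.carrier,
      ∀ b c m, ψ (tmul₂ B C M b c m) = S.pair i b c • m := by
  choose φ hφ using S.exists_inner M i
  have hadd : ∀ b b', φ (b + b') = φ b + φ b' := fun b b' =>
    C.tensor_add_hom_ext fun c m => by
      rw [AddMonoidHom.add_apply, hφ, hφ, hφ, pair_add_left, add_smul]
  obtain ⟨ψ, hψ⟩ := B.exists_lift (C.tensorObj M) (AddMonoidHom.mk' φ hadd) (fun b r y => by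
    change φ (op r • b) y = φ b (r • y)
    refine C.tensor_induction (M := M) (C := fun y => φ (op r • b) y = φ b (r • y))
      (fun c m => ?_) ?_ (fun x y hx hy => ?_) y
    · rw [C.smul_tmul, hφ, hφ, pair_op_smul_left]
    · rw [smul_zero, map_zero, map_zero]
    · rw [smul_add, map_add, map_add, hx, hy])
  exact ⟨ψ, fun b c m => (hψ _ _).trans (hφ _ _ _)⟩

/-- The action map `B ⊗_R C ⊗_A M → M`. -/
noncomputable def actMap (M : GrMod 𝒜) (i : ι) : B.Tensor (C.tensorObj M) →ₗ[A] M.carrier :=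
  { (S.exists_outer M i).choose with
    map_smul' := fun a x => by
      change (S.exists_outer M i).choose (a • x) = a • (S.exists_outer M i).choose x
      refine tensor₂_induction (D := fun x => (S.exists_outer M i).choose (a • x) =
        a • (S.exists_outer M i).choose x) (fun b c m => ?_) (by simp) (fun x y hx hy => ?_) x
      · rw [smul_tmul₂, (S.exists_outer M i).choose_spec, (S.exists_outer M i).choose_spec,
          pair_smul, mul_smul]
      · rw [smul_add, map_add, map_add, hx, hy, smul_add] }

lemma actMap_tmul (M : GrMod 𝒜) (i : ι) (b : B.carrier) (c : C.carrier) (m : M.carrier) :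
    S.actMap M i (tmul₂ B C M b c m) = S.pair i b c • m :=
  (S.exists_outer M i).choose_spec b c m

lemma actMap_mem (M : GrMod 𝒜) (i : ι) {n : ℤ} {x : B.Tensor (C.tensorObj M)}
    (hx : x ∈ B.tensorDeg (C.tensorObj M) n) : S.actMap M i x ∈ M.deg (n - d i) := by
  induction hx using AddSubgroup.closure_induction with
  | mem x hx =>
    obtain ⟨k, l, b, y, hb, hy, rfl, rfl⟩ := hx
    -- The homogeneous elements of the inner tensor product are themselves only sums of homogeneous
    -- pure tensors, hence a second induction.
    replace hy : y ∈ C.tensorDeg M l := hy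
    induction hy using AddSubgroup.closure_induction with
    | mem y hy =>
      obtain ⟨p, q, c, m, hc, hm, rfl, rfl⟩ := hy
      change S.actMap M i (tmul₂ B C M b c m) ∈ _
      rw [actMap_tmul]
      have := M.smul_mem (S.pair_mem (i := i) hb hc) hm
      rwa [show k + p - d i + q = k + (p + q) - d i by ring] at this
    | zero =>
      have := B.tmul_zero (C.tensorObj M) b
      exact this ▸ (map_zero (S.actMap M i)).symm ▸ zero_mem _
    | add x y _ _ hx hy =>
      have := B.tmul_add (C.tensorObj M) b x y
      have h := add_mem hx hy
      rw [← map_add] at h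
      exact this ▸ h
    | neg x _ hx =>
      have h := neg_mem hx
      rw [← map_neg] at h
      have : B.tmul (C.tensorObj M) b (-x) = -B.tmul (C.tensorObj M) b x := by
        simp only [tmul]
        rw [← map_neg, ← TensorProduct.tmul_neg]
      exact this ▸ h
  | zero => rw [map_zero]; exact zero_mem _
  | add x y _ _ hx hy => rw [map_add]; exact add_mem hx hy
  | neg x _ hx => rw [map_neg]; exact neg_mem hx

/-- The action maps are natural. -/
noncomputable def trans (i : ι) : C.tensor ⋙ B.tensor ⟶ GrMod.shift 𝒜 (d i) where
  app M := ⟨S.actMap M i, fun _ _ hx => S.actMap_mem M i hx⟩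
  naturality M N f := GrMod.hom_ext fun x => by
    change S.actMap N i (B.tensorHom (C.tensor.map f) x) = f.1 (S.actMap M i x)
    refine tensor₂_induction (D := fun x => S.actMap N i (B.tensorHom (C.tensor.map f) x) =
      f.1 (S.actMap M i x)) (fun b c m => ?_) ?_ (fun x y hx hy => ?_) x
    · rw [actMap_tmul, map_smul, ← actMap_tmul S N]
      rfl
    · rw [map_zero, map_zero]
      exact (congrArg _ (map_zero _)).trans (map_zero _)
    · rw [map_add, map_add, ← hx, ← hy]
      exact (congrArg _ (map_add _ _ _)).trans (map_add _ _ _)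

/-- A scalar travels from `M` to the front: through `gen` as a right multiplication, then, after
writing `gen a` as `coord (gen a) • gen`, across the tensor sign into `B`, where `expand` and `dual`
turn it into a left multiplication of `elt i`. -/
lemma elt_tmul (M : GrMod 𝒜) (i : ι) (a : A) (m : M.carrier) :
    tmul₂ B C M (S.elt i) S.gen (a • m) = tmul₂ B C M (a • S.elt i) S.gen m := by
  rw [← tmul₂_op_smul, ← S.coord_smul (op a • S.gen), ← op_smul_tmul₂, S.expand',
    Finset.sum_eq_single i, S.pair_elt, if_pos rfl]
  · intro j _ hj
    rw [S.pair_elt, if_neg hj, zero_smul]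
  · intro h; exact absurd (Finset.mem_univ _) h

/-- The normal form of a pure tensor. Read from right to left: bring the pairings to the front, sum
them to `b (coord c)`, move `coord c` back across the tensor sign and recover `c` from `gen`. -/
lemma tmul_eq (M : GrMod 𝒜) (b : B.carrier) (c : C.carrier) (m : M.carrier) :
    tmul₂ B C M b c m = ∑ i, tmul₂ B C M (S.elt i) S.gen (S.pair i b c • m) := by
  rw [Finset.sum_congr rfl fun i _ => S.elt_tmul M i _ m, ← sum_tmul₂, ← S.expand',
    op_smul_tmul₂, S.coord_smul]

/-- The action maps identify `B ⊗_R C ⊗_A M` with a direct sum of copies of `M`. -/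
lemma bijective (M : GrMod 𝒜) : Function.Bijective
    (fun (x : B.Tensor (C.tensorObj M)) (i : ι) => S.actMap M i x) := by
  -- The inverse inserts `elt i ⊗ gen` in front of each coordinate. Only its additivity is needed,
  -- to check the composite with the action maps on pure tensors.
  let Θ : (ι → M.carrier) → B.Tensor (C.tensorObj M) := fun m =>
    ∑ i, tmul₂ B C M (S.elt i) S.gen (m i)
  have hΘ : ∀ m m', Θ (m + m') = Θ m + Θ m' := fun m m' => by
    simp only [Θ]
    rw [← Finset.sum_add_distrib]
    refine Finset.sum_congr rfl fun i _ => ?_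
    rw [Pi.add_apply, tmul₂_add]
  refine Function.bijective_iff_has_inverse.2 ⟨Θ, fun x => ?_, fun m => funext fun i => ?_⟩
  · refine tensor₂_induction (D := fun x => Θ (fun i => S.actMap M i x) = x)
      (fun b c m => ?_) ?_ (fun x y hx hy => ?_) x
    · simp only [actMap_tmul]
      exact (S.tmul_eq M b c m).symm
    · simp only [map_zero]
      have := hΘ 0 0
      rw [add_zero] at this
      exact left_eq_add.1 this
    · conv_rhs => rw [← hx, ← hy, ← hΘ]
      simp only [map_add]
      rfl
  · change S.actMap M i (∑ j, _) = m i
    rw [map_sum, Finset.sum_eq_single i]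
    · rw [actMap_tmul]
      -- At `a = 1` the general duality relation gives the pairing of `elt` with `gen` itself.
      have := S.pair_elt i i 1
      rw [op_one, one_smul, if_pos rfl] at this
      rw [this, one_smul]
    · intro j _ hj
      rw [actMap_tmul]
      have := S.pair_elt i j 1
      rw [op_one, one_smul, if_neg (Ne.symm hj)] at this
      rw [this, zero_smul]
    · intro h; exact absurd (Finset.mem_univ _) h

/-- If there is one summand, without a shift, the tensor product is the identity functor. -/
lemma nonempty_iso_id (S : Splitting B C (fun _ : Unit => 0)) :
    Nonempty (C.tensor ⋙ B.tensor ≅ 𝟭 (GrMod 𝒜)) := by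
  have : ∀ M, IsIso ((S.trans ()).app M) := fun M => by
    refine GrMod.isIso_of_bijective _ ?_
    have := (Equiv.funUnique Unit M.carrier).bijective.comp (S.bijective M)
    exact this
  have : IsIso (S.trans ()) := NatIso.isIso_of_isIso_app _
  exact ⟨asIso (S.trans ()) ≪≫ GrMod.shiftZero 𝒜⟩

/-- If there are two summands, the tensor product is a sum of two shifts. -/
lemma nonempty_iso_prod {d : Fin 2 → ℤ} (S : Splitting B C d) :
    Nonempty (C.tensor ⋙ B.tensor ≅
      GrMod.prodFunctor (GrMod.shift 𝒜 (d 0)) (GrMod.shift 𝒜 (d 1))) := by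
  let α : C.tensor ⋙ B.tensor ⟶
      GrMod.prodFunctor (GrMod.shift 𝒜 (d 0)) (GrMod.shift 𝒜 (d 1)) :=
    { app := fun M => ⟨LinearMap.prod (((S.trans 0).app M).1) (((S.trans 1).app M).1),
        fun n x hx => ⟨((S.trans 0).app M).2 n x hx, ((S.trans 1).app M).2 n x hx⟩⟩
      naturality := fun M N f => GrMod.hom_ext fun x => Prod.ext
        (congrArg (fun φ => φ.1 x) ((S.trans 0).naturality f))
        (congrArg (fun φ => φ.1 x) ((S.trans 1).naturality f)) }
  have : ∀ M, IsIso (α.app M) := fun M => by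
    refine GrMod.isIso_of_bijective _ ?_
    have := (finTwoArrowEquiv M.carrier).bijective.comp (S.bijective M)
    exact this
  have : IsIso α := NatIso.isIso_of_isIso_app _
  exact ⟨asIso α⟩

end Splitting
end GrBimod
end Splittings
end ArcAlgebra

namespace ArcAlgebra

open CategoryTheory CategoryTheory.Limits MulOpposite

/-! ### Transport along equalities of circle relations. -/

namespace TQFT

variable {P : Type}

/-- Groups assigned to equal 1-manifolds. -/
noncomputable def cast {r s : Setoid P} (h : r = s) : TQFT r →+ TQFT s := h ▸ AddMonoidHom.id _

lemma cast_mk {r s : Setoid P} (h : r = s) (f : MvPolynomial P ℤ) :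
    cast h (mk r f) = mk s f := by
  subst h; rfl

lemma cast_mem {r s : Setoid P} (h : r = s) {n : ℤ} {x : TQFT r} (hx : x ∈ degree r n) :
    cast h x ∈ degree s n := by
  subst h; exact hx

lemma cast_cast {r s t : Setoid P} (h : r = s) (h' : s = t) (x : TQFT r) :
    cast h' (cast h x) = cast (h.trans h') x := by
  subst h h'; rfl

end TQFT

/-! ### The bimodule of a cup tangle as a left ideal of the arc ring. -/

section Column

variable {P Q : Type} [LinearOrder P] [LinearOrder Q] [Fintype P] [Fintype Q]
  (T : CupTangle P Q)

/-- Needed because `S(Ta)` and `a` are equal matchings without being definitionally equal, so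
entries of the bimodules have to be transported before they are compared. -/
lemma cast_contract (c b : Matching P) {d d' : Matching Q} (hd : d = d') {r₁ : Setoid P}
    {r₂ r₂' r₃ r₃' : Setoid Q} (h₂ : r₂ = r₂') (h₃ : r₃ = r₃') (x : TQFT r₁) (y : TQFT r₂) :
    TQFT.cast h₃ (contract T c b d x y) = contract T c b d' x (TQFT.cast h₂ y) := by
  subst hd h₂ h₃; rfl

lemma contract_id_one (c b : Matching P) {d : Matching P} (hd : d = b) {r₁ r₂ r₃ : Setoid P}
    (h₁ : r₁ = circles c b) (h₂ : r₂ = circles b b) (h₃ : r₁ = r₃) (x : TQFT r₁) :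
    (contract (CupTangle.id P) c b d x (1 : TQFT r₂) : TQFT r₃) = TQFT.cast h₃ x := by
  subst hd h₃
  exact contract_id_self c d h₁ h₂ x

lemma CupTangle.cup_injective : Function.Injective T.cup := fun a a' h => by
  ext p
  apply T.emb.injective
  rw [← T.cup_emb, h, T.cup_emb]

lemma CupBimod.add_apply (z w : CupBimod T) (b : Matching Q) (a : Matching P) :
    (z + w) b a = z b a + w b a := rfl

lemma CapBimod.add_apply (z w : CapBimod T) (b : Matching P) (a : Matching Q) :
    (z + w) b a = z b a + w b a := rfl

/-- An element of `ℱ(T)` as an element of the arc ring: the column of `a` becomes the column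
of `Ta`. -/
noncomputable def CupBimod.toArcRing (y : CupBimod T) : ArcRing Q := fun d e =>
  ∑ a, if h : T.cup a = e then TQFT.cast (by rw [h]) (y d a) else 0

/-- Placing `T` on top of a matching loses no information about the matching, so exactly one summand
contributes to the column of `Ta`. -/
lemma CupBimod.toArcRing_cup (y : CupBimod T) (d : Matching Q) (a : Matching P) :
    toArcRing T y d (T.cup a) = y d a := by
  unfold toArcRing
  rw [Finset.sum_eq_single a]
  · rw [dif_pos rfl]; rfl
  · intro b _ hb
    exact dif_neg fun h => hb (T.cup_injective h)
  · intro h; exact absurd (Finset.mem_univ _) h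

lemma CupBimod.toArcRing_off (y : CupBimod T) (d e : Matching Q) (he : e ∉ Set.range T.cup) :
    toArcRing T y d e = 0 :=
  Finset.sum_eq_zero fun a _ => dif_neg fun h => he ⟨a, h⟩

lemma ArcRing.ext_cup {x y : ArcRing Q} (h1 : ∀ d a, x d (T.cup a) = y d (T.cup a))
    (h2 : ∀ d e, e ∉ Set.range T.cup → x d e = y d e) : x = y := by
  funext d e
  by_cases he : e ∈ Set.range T.cup
  · obtain ⟨a, rfl⟩ := he; exact h1 d a
  · exact h2 d e he

/-- The embedding of `ℱ(T)` in the arc ring. -/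
noncomputable def CupBimod.coord : CupBimod T →ₗ[ArcRing Q] ArcRing Q where
  toFun := toArcRing T
  map_add' y z := ArcRing.ext_cup T
    (fun d a => by
      rw [ArcRing.add_apply, toArcRing_cup, toArcRing_cup, toArcRing_cup, CupBimod.add_apply])
    (fun d e he => by
      rw [ArcRing.add_apply, toArcRing_off T _ _ _ he, toArcRing_off T _ _ _ he,
        toArcRing_off T _ _ _ he, add_zero])
  map_smul' x y := ArcRing.ext_cup T
    (fun d a => by
      rw [toArcRing_cup, CupBimod.smul_apply, RingHom.id_apply, smul_eq_mul, ArcRing.mul_apply]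
      exact Finset.sum_congr rfl fun b _ => by rw [toArcRing_cup])
    -- In a column that is not of the form `Ta`, every entry of the image is zero, and left
    -- multiplication acts on each column separately.
    (fun d e he => by
      rw [toArcRing_off T _ _ _ he, RingHom.id_apply, smul_eq_mul, ArcRing.mul_apply]
      refine (Finset.sum_eq_zero fun b _ => ?_).symm
      rw [toArcRing_off T _ _ _ he]
      exact contract_zero_right (CupTangle.id Q) e (r := fun b => circles b e)
        (circles_id e) rfl _)

lemma CupBimod.coord_cup (y : CupBimod T) (d : Matching Q) (a : Matching P) :
    coord T y d (T.cup a) = y d a := toArcRing_cup T y d a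

lemma CupBimod.coord_off (y : CupBimod T) (d e : Matching Q) (he : e ∉ Set.range T.cup) :
    coord T y d e = 0 := toArcRing_off T y d e he

/-- The generator of the left module `ℱ(T)`. -/
noncomputable def CupBimod.gen : CupBimod T := fun c a => if c = T.cup a then 1 else 0

lemma CupBimod.gen_cup (a : Matching P) : gen T (T.cup a) a = 1 := if_pos rfl

lemma CupBimod.gen_ne {c : Matching Q} {a : Matching P} (h : c ≠ T.cup a) : gen T c a = 0 :=
  if_neg h

/-- The generator has a unit in each position `(Ta, a)` and zeros elsewhere, so it returns column
`Ta` of the arc ring to column `a` of the bimodule. -/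
lemma CupBimod.coord_smul (y : CupBimod T) : coord T y • gen T = y := by
  funext d a
  rw [CupBimod.smul_apply, Finset.sum_eq_single (T.cup a), gen_cup, coord_cup]
  · exact contract_id_self d (T.cup a) rfl rfl _
  · intro b _ hb
    rw [gen_ne T hb]
    exact contract_zero_right (CupTangle.id Q) (T.cup a) (r := fun b => circles b (T.cup a))
      (circles_id _) rfl _
  · intro h; exact absurd (Finset.mem_univ _) h

/-- This carries the entry `(b, a)` of the small arc ring to the entry `(Tb, Ta)` of the large one.
The contraction is against a closure `W(Tb)Tb`, so by `contract_self` it only renames variables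
along the strands. Both verifications of `dual` rest on it. -/
lemma CupBimod.coord_op_smul_gen (x : ArcRing P) (b a : Matching P) :
    coord T (op x • gen T) (T.cup b) (T.cup a) =
      contract T a b (T.cup b) (x b a) (1 : TQFT (circles (T.cup b) (T.cup b))) := by
  rw [coord_cup, CupBimod.op_smul_apply, Finset.sum_eq_single b, gen_cup,
    unop_op]
  · intro c _ hc
    rw [gen_ne T (fun h => hc (T.cup_injective h).symm)]
    exact contract_zero_right T (T.cup b) (r := fun a => circles (T.cup b) (T.cup a))
      (fun _ => rfl) (circles_comm _ _) _
  · intro h; exact absurd (Finset.mem_univ _) h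

/-- The entries are the same groups. The bimodule is normalised by the bottom points of `T`, the arc
ring by the top points, whence the difference of the halves. -/
lemma CupBimod.coord_mem {n : ℤ} {y : CupBimod T} (hy : y ∈ CupBimod.degree T n) :
    coord T y ∈ ArcRing.degree Q (n + (half Q - half P)) := by
  intro d e
  by_cases he : e ∈ Set.range T.cup
  · obtain ⟨a, rfl⟩ := he
    rw [coord_cup, show n + ((half Q : ℤ) - half P) - half Q = n - half P by ring]
    exact hy d a
  · rw [coord_off T _ _ _ he]; exact zero_mem _

end Column

/-! ### Through-strands -/

section Slide

variable {P Q : Type} [LinearOrder P] [LinearOrder Q] [Fintype P] [Fintype Q]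
  (T : CupTangle P Q) (S : CupTangle Q P)

lemma CupTangle.cup_cup {T : CupTangle P Q} {S : CupTangle Q P}
    (h : ∀ p, S.emb (T.emb p) = p) (a : Matching P) : S.cup (T.cup a) = a := by
  ext p
  obtain ⟨q, rfl⟩ : ∃ q, q = S.emb (T.emb p) := ⟨_, rfl⟩
  conv_lhs => rw [← h p]
  rw [S.cup_emb, T.cup_emb, h]

variable (h1 : ∀ p, S.emb (T.emb p) = p)

/-- The identification of `ℱ(S)` with the arc ring for an invertible tangle `S`. -/
noncomputable def CupBimod.slideProj : CupBimod S →ₗ[ArcRing P] ArcRing P where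
  toFun z b a := TQFT.cast (by rw [CupTangle.cup_cup h1]) (z b (T.cup a))
  map_add' y z := funext fun b => funext fun a => map_add (TQFT.cast _) _ _
  map_smul' x z := by
    -- Left multiplication does not mix columns, so relabelling the column `Ta` as `a` commutes with
    -- it up to transport.
    funext b a
    change TQFT.cast _ ((x • z) b (T.cup a)) =
      ∑ c, contract (CupTangle.id P) b c a (x b c) (TQFT.cast _ (z c (T.cup a)))
    rw [CupBimod.smul_apply, map_sum]
    exact Finset.sum_congr rfl fun c _ => cast_contract _ _ _ (CupTangle.cup_cup h1 a) _ _ _ _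

lemma CupBimod.slideProj_apply (z : CupBimod S) (b a : Matching P) :
    slideProj T S h1 z b a = TQFT.cast (by rw [CupTangle.cup_cup h1]) (z b (T.cup a)) := rfl

/-- The generator of `ℱ(S)` for an invertible tangle `S`. -/
noncomputable def CupBimod.slideElt : CupBimod S := fun b c => if c = T.cup b then 1 else 0

lemma CupBimod.slideElt_cup (b : Matching P) : slideElt T S b (T.cup b) = 1 := if_pos rfl

lemma CupBimod.slideElt_ne {b : Matching P} {c : Matching Q} (h : c ≠ T.cup b) :
    slideElt T S b c = 0 := if_neg h

/-- As the tangles are mutually inverse, every column has the form `Ta`. No column is lost, and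
relabelling columns is undone by the element with units in the positions `(b, Tb)`. -/
lemma CupBimod.slide_expand (h2 : ∀ q, T.emb (S.emb q) = q) (z : CupBimod S) : slideProj T S h1 z • slideElt T S = z := by
  funext b c
  obtain ⟨a, rfl⟩ : ∃ a, c = T.cup a := ⟨S.cup c, (CupTangle.cup_cup h2 c).symm⟩
  rw [CupBimod.smul_apply, Finset.sum_eq_single a, slideElt_cup, slideProj_apply]
  · rw [contract_id_one b a (CupTangle.cup_cup h1 a) rfl (by rw [CupTangle.cup_cup h1])
      (by rw [CupTangle.cup_cup h1]), TQFT.cast_cast]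
    rfl
  · intro b' _ hb
    rw [slideElt_ne T S (fun h => hb (T.cup_injective h).symm)]
    exact contract_zero_right (CupTangle.id P) (S.cup (T.cup a))
      (r := fun b => circles b (S.cup (T.cup a))) (circles_id _) rfl _
  · intro h; exact absurd (Finset.mem_univ _) h

/-- Both contractions involved are against a unit in the closure of a matching, so they act by
renaming points, along `T` and then along `S`. The two renamings compose to the identity. -/
lemma CupBimod.slide_dual (x : ArcRing P) :
    slideProj T S h1 (op (coord T (op x • gen T)) • slideElt T S) = x := by
  funext b a
  rw [slideProj_apply, CupBimod.op_smul_apply, Finset.sum_eq_single (T.cup b), slideElt_cup,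
    unop_op, coord_op_smul_gen]
  · obtain ⟨f, hf⟩ := (x b a).mk_surj
    rw [← hf, ← map_one (TQFT.mk _), contract_self T a b rfl (circles_comm _ _) rfl rfl,
      ← map_one (TQFT.mk _),
      contract_self S (T.cup a) (T.cup b) (CupTangle.cup_cup h1 b).symm (circles_comm _ _) rfl rfl,
      TQFT.cast_mk, mul_one, mul_one, MvPolynomial.rename_rename]
    have : (S.emb ∘ T.emb : P → P) = id := funext h1
    rw [this, MvPolynomial.rename_id_apply]
  · intro c _ hc
    rw [slideElt_ne T S hc]
    exact contract_zero_right S b (r := fun c => circles b (S.cup c)) (fun _ => rfl)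
      (circles_comm _ _) _
  · intro h; exact absurd (Finset.mem_univ _) h

/-- Inverse tangles have inverse bimodules. -/
noncomputable def slideSplitting (h2 : ∀ q, T.emb (S.emb q) = q) :
    GrBimod.Splitting S.bimod T.bimod (fun _ : Unit => 0) where
  coord := CupBimod.coord T
  gen := CupBimod.gen T
  coord_smul := CupBimod.coord_smul T
  proj _ := CupBimod.slideProj T S h1
  elt _ := CupBimod.slideElt T S
  expand b c := by
    rw [Fintype.sum_unique]
    exact (CupBimod.slide_expand T S h1 h2 _).symm
  dual _ _ a := by
    rw [if_pos rfl]
    exact CupBimod.slide_dual T S h1 a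
  shift := half Q - half P
  coord_mem := CupBimod.coord_mem T
  proj_mem {_ n z} hz b a := by
    rw [show n - ((half Q : ℤ) - half P) - 0 - half P = n - half Q by ring]
    exact TQFT.cast_mem _ (hz b (T.cup a))

end Slide
end ArcAlgebra

namespace ArcAlgebra

open CategoryTheory CategoryTheory.Limits MulOpposite

/-! ### Removing a circle -/

section Circle

variable {P Q : Type} [LinearOrder P] [LinearOrder Q] [Fintype P] [Fintype Q]
  (T : CupTangle P Q)

namespace CupTangle

open Classical in
/-- Set the variables of the cups to zero. -/
noncomputable def collapse : MvPolynomial Q ℤ →ₐ[ℤ] MvPolynomial P ℤ :=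
  MvPolynomial.aeval fun q => if h : ∃ p, T.emb p = q then MvPolynomial.X h.choose else 0

lemma collapse_emb (p : P) : T.collapse (MvPolynomial.X (T.emb p)) = MvPolynomial.X p := by
  have h : ∃ p', T.emb p' = T.emb p := ⟨p, rfl⟩
  have h2 : h.choose = p := T.emb.injective h.choose_spec
  rw [collapse, MvPolynomial.aeval_X, dif_pos h, h2]

lemma collapse_off {q : Q} (hq : q ∉ Set.range T.emb) : T.collapse (MvPolynomial.X q) = 0 := by
  rw [collapse, MvPolynomial.aeval_X]; exact dif_neg hq

lemma collapse_rename (f : MvPolynomial P ℤ) :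
    T.collapse (MvPolynomial.rename T.emb f) = f := by
  have : T.collapse.comp (MvPolynomial.rename T.emb) = AlgHom.id ℤ _ :=
    MvPolynomial.algHom_ext fun p => by
      rw [AlgHom.comp_apply, MvPolynomial.rename_X, collapse_emb, AlgHom.id_apply]
  exact congrArg (fun φ => φ f) this

/-- Each variable goes to a variable or to zero, and zero is homogeneous of every degree. -/
lemma collapse_homogeneous {f : MvPolynomial Q ℤ} {k : ℕ} (hf : f.IsHomogeneous k) :
    (T.collapse f).IsHomogeneous k := by
  have h : ∀ q, (T.collapse (MvPolynomial.X q)).IsHomogeneous 1 := fun q => by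
    by_cases hq : q ∈ Set.range T.emb
    · obtain ⟨p, rfl⟩ := hq
      rw [collapse_emb]
      exact MvPolynomial.isHomogeneous_X _ _
    · rw [collapse_off T hq]
      exact MvPolynomial.isHomogeneous_zero _ _ _
  have e : T.collapse = MvPolynomial.aeval fun q => T.collapse (MvPolynomial.X q) :=
    MvPolynomial.aeval_unique _
  have := hf.aeval _ h
  rwa [one_mul, ← e] at this

open Classical in
/-- The derivative in the direction of the variables of the cups. -/
noncomputable def deriv : Derivation ℤ (MvPolynomial Q ℤ) (MvPolynomial Q ℤ) :=
  ∑ q ∈ Finset.univ.filter (fun q => q ∉ Set.range T.emb), MvPolynomial.pderiv q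

open Classical in
lemma deriv_apply (f : MvPolynomial Q ℤ) :
    T.deriv f = ∑ q ∈ Finset.univ.filter (fun q => q ∉ Set.range T.emb), MvPolynomial.pderiv q f := by
  rw [deriv]
  exact (congrFun (map_sum (Derivation.coeFnAddMonoidHom :
    Derivation ℤ (MvPolynomial Q ℤ) (MvPolynomial Q ℤ) →+ _) _ _) f).trans
      (Finset.sum_apply _ _ _)

lemma deriv_emb (p : P) : T.deriv (MvPolynomial.X (T.emb p)) = 0 := by
  classical
  rw [deriv_apply]
  refine Finset.sum_eq_zero fun q hq => ?_
  rw [MvPolynomial.pderiv_X_of_ne]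
  rintro rfl
  exact (Finset.mem_filter.1 hq).2 ⟨p, rfl⟩

lemma deriv_off {q : Q} (hq : q ∉ Set.range T.emb) : T.deriv (MvPolynomial.X q) = 1 := by
  classical
  rw [deriv_apply, Finset.sum_eq_single q]
  · rw [MvPolynomial.pderiv_X_self]
  · intro q' _ hq'
    exact MvPolynomial.pderiv_X_of_ne (Ne.symm hq')
  · intro h
    exact (h (by simpa using hq)).elim

/-- Polynomials in the strand variables are constants for this derivation, so extracting
coefficients is linear over them. -/
lemma deriv_rename (f : MvPolynomial P ℤ) : T.deriv (MvPolynomial.rename T.emb f) = 0 := by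
  induction f using MvPolynomial.induction_on with
  | C a => rw [MvPolynomial.rename_C, MvPolynomial.derivation_C]
  | add f g hf hg => rw [map_add, map_add, hf, hg, add_zero]
  | mul_X f p hf =>
    rw [map_mul, MvPolynomial.rename_X, Derivation.leibniz, hf, deriv_emb, smul_zero, smul_zero,
      add_zero]

/-- The two coefficients with respect to the variable of the cup. -/
noncomputable def coeff : Fin 2 → MvPolynomial Q ℤ →+ MvPolynomial P ℤ :=
  -- Index `0` is the coefficient of `X` and index `1` that of `1`, matching the order of the shifts
  -- `1` and `-1`. Differentiating along all cup variables at once is what makes the result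
  -- insensitive to which end of the cup carries the variable.
  ![(T.collapse : MvPolynomial Q ℤ →+ MvPolynomial P ℤ).comp (T.deriv : _ →+ _),
    (T.collapse : MvPolynomial Q ℤ →+ MvPolynomial P ℤ)]

lemma coeff_zero (f : MvPolynomial Q ℤ) : T.coeff 0 f = T.collapse (T.deriv f) := rfl

lemma coeff_one (f : MvPolynomial Q ℤ) : T.coeff 1 f = T.collapse f := rfl

lemma coeff_rename_mul (k : Fin 2) (f : MvPolynomial P ℤ) (g : MvPolynomial Q ℤ) :
    T.coeff k (MvPolynomial.rename T.emb f * g) = f * T.coeff k g := by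
  fin_cases k
  · change T.coeff 0 _ = f * T.coeff 0 g
    rw [coeff_zero, coeff_zero, Derivation.leibniz, deriv_rename, smul_zero, add_zero,
      smul_eq_mul, map_mul, collapse_rename]
  · change T.coeff 1 _ = f * T.coeff 1 g
    rw [coeff_one, coeff_one, map_mul, collapse_rename]

open Classical in
-- No circle contains both a strand end and a cup end. The proof colours a strand end by its circle
-- in `W(b)a` and every cup end by `none`; the colouring is constant along both matchings, hence
-- along circles.
lemma circles_cup {b a : Matching P} {q q' : Q} (h : circles (T.cup b) (T.cup a) q q') :
    (∃ p p', q = T.emb p ∧ q' = T.emb p' ∧ circles b a p p') ∨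
      (q ∉ Set.range T.emb ∧ q' ∉ Set.range T.emb) := by
  let κ : Q → Option (Quotient (circles b a)) := fun q =>
    if h : ∃ p, T.emb p = q then some (Quotient.mk _ h.choose) else none
  have h1 : ∀ p, κ (T.emb p) = some (Quotient.mk _ p) := fun p => by
    have h : ∃ p', T.emb p' = T.emb p := ⟨p, rfl⟩
    have h2 : h.choose = p := T.emb.injective h.choose_spec
    simp only [κ]
    rw [dif_pos h, h2]
  have h2 : ∀ q, q ∉ Set.range T.emb → κ q = none := fun q hq => dif_neg hq
  have key : κ q = κ q' := by
    refine sameCircle_inv (g := κ) ((T.cup_inv b).2 ⟨fun p => ?_, fun q hq => ?_⟩)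
      ((T.cup_inv a).2 ⟨fun p => ?_, fun q hq => ?_⟩) h
    · rw [h1, h1]
      exact congrArg some (Quotient.sound (Setoid.symm' _ (sameCircle_left _ _ _)))
    · rw [h2 _ hq, h2 _ (T.arc_notMem _ hq)]
    · rw [h1, h1]
      exact congrArg some (Quotient.sound (Setoid.symm' _ (sameCircle_right _ _ _)))
    · rw [h2 _ hq, h2 _ (T.arc_notMem _ hq)]
  by_cases hq : q ∈ Set.range T.emb <;> by_cases hq' : q' ∈ Set.range T.emb
  · obtain ⟨p, rfl⟩ := hq
    obtain ⟨p', rfl⟩ := hq'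
    rw [h1, h1] at key
    exact Or.inl ⟨p, p', rfl, rfl, Quotient.exact (Option.some_injective _ key)⟩
  · obtain ⟨p, rfl⟩ := hq
    rw [h1, h2 _ hq'] at key
    exact absurd key (by simp)
  · obtain ⟨p, rfl⟩ := hq'
    rw [h1, h2 _ hq] at key
    exact absurd key (by simp)
  · exact Or.inr ⟨hq, hq'⟩

/-- The two coefficients must be treated together: by the Leibniz rule, the `X`-coefficient of a
multiple `h f` involves the constant coefficient of `f`. On generators, a difference of two cup
variables has derivative zero, and the square of a cup variable has derivative twice that variable,
which is then set to zero. -/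
lemma coeff_relIdeal (b a : Matching P) {f : MvPolynomial Q ℤ}
    (hf : f ∈ relIdeal (circles (T.cup b) (T.cup a))) :
    T.collapse f ∈ relIdeal (circles b a) ∧ T.collapse (T.deriv f) ∈ relIdeal (circles b a) := by
  induction hf using Submodule.span_induction with
  | mem f hf =>
    rcases hf with ⟨q, rfl⟩ | ⟨q, q', h, rfl⟩
    · by_cases hq : q ∈ Set.range T.emb
      · obtain ⟨p, rfl⟩ := hq
        rw [map_pow, collapse_emb, Derivation.leibniz_pow, deriv_emb, smul_zero, smul_zero,
          map_zero]
        exact ⟨Ideal.subset_span (Or.inl ⟨p, rfl⟩), zero_mem _⟩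
      · rw [map_pow, collapse_off T hq, Derivation.leibniz_pow, deriv_off T hq, smul_eq_mul,
          mul_one, map_nsmul, map_pow, collapse_off T hq]
        simp
    · rcases T.circles_cup h with ⟨p, p', rfl, rfl, hp⟩ | ⟨hq, hq'⟩
      · rw [map_sub, collapse_emb, collapse_emb, map_sub, deriv_emb, deriv_emb, sub_zero, map_zero]
        exact ⟨Ideal.subset_span (Or.inr ⟨p, p', hp, rfl⟩), zero_mem _⟩
      · rw [map_sub, collapse_off T hq, collapse_off T hq', map_sub, deriv_off T hq,
          deriv_off T hq', sub_self, sub_self, map_zero]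
        exact ⟨zero_mem _, zero_mem _⟩
  | zero =>
    rw [map_zero, map_zero, map_zero]
    exact ⟨zero_mem _, zero_mem _⟩
  | add f g _ _ hf hg =>
    rw [map_add, map_add, map_add]
    exact ⟨add_mem hf.1 hg.1, add_mem hf.2 hg.2⟩
  | smul h f _ hf =>
    rw [smul_eq_mul, map_mul, Derivation.leibniz, map_add, smul_eq_mul, smul_eq_mul, map_mul,
      map_mul]
    exact ⟨Ideal.mul_mem_left _ _ hf.1,
      add_mem (Ideal.mul_mem_left _ _ hf.2) (Ideal.mul_mem_right _ _ hf.1)⟩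

lemma coeff_mem (k : Fin 2) (b a : Matching P) {f : MvPolynomial Q ℤ}
    (hf : f ∈ relIdeal (circles (T.cup b) (T.cup a))) :
    TQFT.mk (circles b a) (T.coeff k f) = 0 := by
  rw [Ideal.Quotient.eq_zero_iff_mem]
  fin_cases k
  · exact (T.coeff_relIdeal b a hf).2
  · exact (T.coeff_relIdeal b a hf).1

/-- The two coefficients with respect to the variable of the cup, as maps
`ℱ(W(Tb)Ta) → ℱ(W(b)a)`. -/
noncomputable def circleCoeff (k : Fin 2) (b a : Matching P) :
    TQFT (circles (T.cup b) (T.cup a)) →+ TQFT (circles b a) :=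
  QuotientAddGroup.lift (relIdeal (circles (T.cup b) (T.cup a))).toAddSubgroup
    ((TQFT.mk (circles b a)).toAddMonoidHom.comp (T.coeff k)) (fun _ hf => T.coeff_mem k b a hf)

lemma circleCoeff_mk (k : Fin 2) (b a : Matching P) (f : MvPolynomial Q ℤ) :
    T.circleCoeff k b a (TQFT.mk _ f) = TQFT.mk _ (T.coeff k f) := rfl

/-- By `mk_theta_cup` the contraction polynomial can be replaced by one in the strand variables
alone, over which coefficients are linear. This gives left linearity of the projections over the arc
ring. -/
lemma circleCoeff_contract (k : Fin 2) (c b a : Matching P) (x : TQFT (circles c b))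
    (y : TQFT (circles (T.cup b) (T.cup a))) :
    T.circleCoeff k c a (contract T c b (T.cup a) x y) =
      contract (CupTangle.id P) c b a x (T.circleCoeff k b a y) := by
  obtain ⟨f, rfl⟩ := x.mk_surj
  obtain ⟨g, rfl⟩ := y.mk_surj
  rw [circleCoeff_mk, contract_mk T c b _ rfl (circles_comm _ _) (circles_comm _ _),
    contract_mk (CupTangle.id P) c b a rfl (circles_id _ _) (circles_id _ _)]
  -- The identity holds only modulo the relations of `W(Ta)Tc`, so the replacement is made before
  -- passing to coefficients.
  have hθ := mk_theta_cup T c b a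
  rw [circles_comm] at hθ
  rw [map_mul, hθ, ← map_mul, circleCoeff_mk, mul_assoc, coeff_rename_mul, mul_comm _
    (MvPolynomial.rename _ _), coeff_rename_mul]
  have : ((CupTangle.id P).emb : P → P) = _root_.id := rfl
  rw [this, MvPolynomial.rename_id_apply, mul_comm _ (T.coeff k g), mul_assoc]

section OneCup

variable {i : Q}

lemma cupSum_one (hi : i ∉ Set.range T.emb)
    (hT : ∀ q, q ∉ Set.range T.emb → q = i ∨ q = T.arc i) : T.cupSum (fun _ => 1) = 1 := by
  rw [cupSum, circleSum_one, numCircles]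
  have : Unique (Quotient (sameCircle T.cupArc T.cupArc)) :=
    { default := Quotient.mk _ ⟨i, hi⟩
      uniq := by
        rintro ⟨q, hq⟩
        refine Quotient.sound (Setoid.symm' _ ?_)
        rcases hT q hq with rfl | rfl
        · exact Setoid.refl' _ _
        · exact sameCircle_left _ _ _ }
  simp

lemma numCircles_cup (hi : i ∉ Set.range T.emb)
    (hT : ∀ q, q ∉ Set.range T.emb → q = i ∨ q = T.arc i) (b a : Matching P) :
    (numCircles (circles (T.cup b) (T.cup a)) : ℤ) = numCircles (circles b a) + 1 := by
  have := circleSum_cup T b a (fun _ => 1) (fun _ => rfl) (fun _ => rfl)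
  have e : ((fun _ => 1 : Q → ℤ) ∘ T.emb) = fun _ => 1 := rfl
  rwa [e, circleSum_one, circleSum_one, T.cupSum_one hi hT] at this

/-- Removing the circle raises the degree of a fixed polynomial by `1`. The constant coefficient
thus moves up by `1`, whereas the coefficient of `X` also loses one polynomial degree, worth `2`,
and moves down by `1`. -/
lemma circleCoeff_degree (hi : i ∉ Set.range T.emb)
    (hT : ∀ q, q ∉ Set.range T.emb → q = i ∨ q = T.arc i) (k : Fin 2) (b a : Matching P) {n : ℤ}
    {x : TQFT (circles (T.cup b) (T.cup a))} (hx : x ∈ TQFT.degree _ n) :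
    T.circleCoeff k b a x ∈ TQFT.degree (circles b a) (n - (![1, -1] : Fin 2 → ℤ) k) := by
  classical
  have hN := T.numCircles_cup hi hT b a
  induction hx using AddSubgroup.closure_induction with
  | mem x hx =>
    obtain ⟨f, m, hf, hm, rfl⟩ := hx
    rw [circleCoeff_mk]
    fin_cases k
    · change TQFT.mk _ (T.collapse (T.deriv f)) ∈ TQFT.degree _ (n - 1)
      rw [deriv_apply, map_sum, map_sum]
      refine sum_mem fun q _ => ?_
      -- Degree zero is separate because `m - 1` is truncated there; the derivative of a constant is
      -- zero in any case.
      rcases Nat.eq_zero_or_pos m with rfl | h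
      · rw [← MvPolynomial.totalDegree_zero_iff_isHomogeneous,
          MvPolynomial.totalDegree_eq_zero_iff_eq_C] at hf
        rw [hf, MvPolynomial.pderiv_C, map_zero, map_zero]
        exact zero_mem _
      · exact TQFT.mem_degree _ (T.collapse_homogeneous hf.pderiv) (by push_cast [h]; linarith)
    · change TQFT.mk _ (T.collapse f) ∈ TQFT.degree _ (n - -1)
      exact TQFT.mem_degree _ (T.collapse_homogeneous hf) (by linarith)
  | zero => rw [map_zero]; exact zero_mem _
  | add x y _ _ hx hy => rw [map_add]; exact add_mem hx hy
  | neg x _ hx => rw [map_neg]; exact neg_mem hx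

/-- The basis `X`, `1` of the ring of the additional circle. -/
noncomputable def circleBasis (i : Q) : Fin 2 → MvPolynomial Q ℤ := ![MvPolynomial.X i, 1]

lemma coeff_circleBasis (hi : i ∉ Set.range T.emb) (k l : Fin 2) :
    T.coeff k (circleBasis i l) = if k = l then 1 else 0 := by
  fin_cases k <;> fin_cases l
  · change T.collapse (T.deriv (MvPolynomial.X i)) = _
    rw [T.deriv_off hi]; simp
  · change T.collapse (T.deriv 1) = _
    rw [Derivation.map_one_eq_zero]; simp
  · change T.collapse (MvPolynomial.X i) = _
    rw [T.collapse_off hi]; simp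
  · change T.collapse 1 = _
    simp

/-- With a single cup, all cup variables become equal to `X_i` in the quotient, and `X_i ^ 2 = 0`
leaves a linear polynomial in `X_i` over the strand variables. The coefficients are read off by the
value and the derivative at zero. -/
lemma mk_eq_sum_coeff (hi : i ∉ Set.range T.emb)
    (hT : ∀ q, q ∉ Set.range T.emb → q = i ∨ q = T.arc i) (b a : Matching P)
    (f : MvPolynomial Q ℤ) :
    TQFT.mk (circles (T.cup b) (T.cup a)) f = TQFT.mk _
      (MvPolynomial.rename T.emb (T.coeff 0 f) * MvPolynomial.X i +
        MvPolynomial.rename T.emb (T.coeff 1 f)) := by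
  rw [coeff_zero, coeff_one]
  induction f using MvPolynomial.induction_on with
  | C c =>
    rw [MvPolynomial.derivation_C, map_zero, map_zero, zero_mul, zero_add]
    simp [← MvPolynomial.algebraMap_eq]
  | add f g hf hg =>
    rw [map_add, hf, hg]
    simp only [map_add, map_mul]
    ring
  | mul_X f q hf =>
    rw [(TQFT.mk _).map_mul, hf, Derivation.leibniz, smul_eq_mul, smul_eq_mul]
    by_cases hq : q ∈ Set.range T.emb
    · obtain ⟨p, rfl⟩ := hq
      simp only [deriv_emb, map_add, map_mul, collapse_emb, MvPolynomial.rename_X, mul_zero,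
        map_zero]
      ring
    · have hqi : TQFT.mk (circles (T.cup b) (T.cup a)) (MvPolynomial.X q) =
          TQFT.mk _ (MvPolynomial.X i) := by
        rcases hT q hq with rfl | rfl
        · rfl
        · refine TQFT.mk_X (Setoid.symm' _ ?_)
          rw [← T.cup_off b i hi]
          exact sameCircle_left _ _ _
      have hi2 := TQFT.mk_X_sq (circles (T.cup b) (T.cup a)) i
      simp only [T.deriv_off hq, T.collapse_off hq, hqi, map_add, map_mul, map_zero, map_one,
        map_pow] at hi2 ⊢
      -- Multiplying by the cup variable turns the constant coefficient into the coefficient of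
      -- `X_i`; the old linear term acquires `X_i ^ 2` and dies.
      linear_combination
        TQFT.mk _ (MvPolynomial.rename T.emb (T.collapse (T.deriv f))) * hi2

/-- Contracting with a basis vector in a closure `W(Ta)Ta` is plain multiplication, so the sum is
the expansion in powers of `X_i`, now expressed through the module action. -/
lemma eq_sum_circleCoeff (hi : i ∉ Set.range T.emb)
    (hT : ∀ q, q ∉ Set.range T.emb → q = i ∨ q = T.arc i) (b a : Matching P)
    (z : TQFT (circles (T.cup b) (T.cup a))) :
    z = ∑ k, contract T b a (T.cup a) (T.circleCoeff k b a z)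
      (TQFT.mk (circles (T.cup a) (T.cup a)) (circleBasis i k)) := by
  obtain ⟨f, rfl⟩ := z.mk_surj
  simp only [circleCoeff_mk, contract_self T b a rfl rfl rfl (circles_comm _ _)]
  rw [Fin.sum_univ_two, ← map_add, mk_eq_sum_coeff T hi hT]
  simp [circleBasis]

end OneCup
end CupTangle

namespace CapBimod

/-- The two projections of `ℱ(W(T))` to the arc ring. -/
noncomputable def circleProj (k : Fin 2) : CapBimod T →ₗ[ArcRing P] ArcRing P where
  toFun z b a := T.circleCoeff k b a (z b (T.cup a))
  map_add' y z := funext fun b => funext fun a => map_add (T.circleCoeff k b a) _ _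
  -- Only the columns `Ta` are read, and there each entry is handled by `circleCoeff_contract`.
  map_smul' x z := by
    funext b a
    change T.circleCoeff k b a ((x • z) b (T.cup a)) =
      ∑ c, contract (CupTangle.id P) b c a (x b c) (T.circleCoeff k c a (z c (T.cup a)))
    rw [CapBimod.smul_apply, map_sum]
    exact Finset.sum_congr rfl fun c _ => T.circleCoeff_contract k b c a _ _

lemma circleProj_apply (k : Fin 2) (z : CapBimod T) (b a : Matching P) :
    circleProj T k z b a = T.circleCoeff k b a (z b (T.cup a)) := rfl

/-- The basis of the part of `ℱ(W(T))` with arc diagrams that contain the cup. -/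
noncomputable def circleElt (i : Q) (k : Fin 2) : CapBimod T := fun b c =>
  if c = T.cup b then TQFT.mk _ (CupTangle.circleBasis i k) else 0

lemma circleElt_cup (i : Q) (k : Fin 2) (b : Matching P) :
    circleElt T i k b (T.cup b) = TQFT.mk _ (CupTangle.circleBasis i k) := if_pos rfl

lemma circleElt_ne (i : Q) (k : Fin 2) {b : Matching P} {c : Matching Q} (h : c ≠ T.cup b) :
    circleElt T i k b c = 0 := if_neg h

lemma smul_circleElt_cup (i : Q) (k : Fin 2) (x : ArcRing P) (b a : Matching P) :
    (x • circleElt T i k) b (T.cup a) = contract T b a (T.cup a) (x b a)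
      (TQFT.mk (circles (T.cup a) (T.cup a)) (CupTangle.circleBasis i k)) := by
  rw [CapBimod.smul_apply, Finset.sum_eq_single a, circleElt_cup]
  · intro b' _ hb
    rw [circleElt_ne T i k (fun h => hb (T.cup_injective h).symm)]
    exact contract_zero_right T (T.cup a) (r := fun b => circles (T.cup b) (T.cup a))
      (fun _ => circles_comm _ _) rfl _
  · intro h; exact absurd (Finset.mem_univ _) h

lemma smul_circleElt_off (i : Q) (k : Fin 2) (x : ArcRing P) (b : Matching P) {c : Matching Q}
    (hc : c ∉ Set.range T.cup) : (x • circleElt T i k) b c = 0 := by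
  rw [CapBimod.smul_apply]
  refine Finset.sum_eq_zero fun b' _ => ?_
  rw [circleElt_ne T i k (fun h => hc ⟨b', h.symm⟩)]
  exact contract_zero_right T c (r := fun b => circles (T.cup b) c)
    (fun _ => circles_comm _ _) rfl _

/-- Right multiplication by an element supported in the columns `Ta` has its result supported there
too. This discards the other columns of `ℱ(W(T))`, on which the two basis elements could not
generate. -/
lemma op_coord_smul_off (y : CupBimod T) (z : CapBimod T) (b : Matching P) {c : Matching Q}
    (hc : c ∉ Set.range T.cup) : (op (CupBimod.coord T y) • z) b c = 0 := by
  rw [CapBimod.op_smul_apply]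
  refine Finset.sum_eq_zero fun d _ => ?_
  rw [unop_op, CupBimod.coord_off T _ _ _ hc]
  exact contract_zero_left (CupTangle.id Q) (T.cup b) (r := fun c => circles (T.cup b) c)
    (fun _ => by rw [CupTangle.id_cup]) (circles_comm _ _) _

lemma circle_expand {i : Q} (hi : i ∉ Set.range T.emb)
    (hT : ∀ q, q ∉ Set.range T.emb → q = i ∨ q = T.arc i) (z : CapBimod T)
    (hz : ∀ b c, c ∉ Set.range T.cup → z b c = 0) :
    z = ∑ k, circleProj T k z • circleElt T i k := by
  rw [Fin.sum_univ_two]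
  funext b c
  rw [CapBimod.add_apply]
  by_cases hc : c ∈ Set.range T.cup
  · obtain ⟨a, rfl⟩ := hc
    rw [smul_circleElt_cup, smul_circleElt_cup]
    exact (T.eq_sum_circleCoeff hi hT b a _).trans (Fin.sum_univ_two _)
  · rw [hz b c hc, smul_circleElt_off T i _ _ _ hc, smul_circleElt_off T i _ _ _ hc, add_zero]

/-- In position `(b, Ta)` the element is the entry of `x`, renamed along the strands, times the
basis vector in `X_i`. Strand variables pass through the coefficient maps, which are dual to the
basis. -/
lemma circle_dual {i : Q} (hi : i ∉ Set.range T.emb) (k l : Fin 2) (x : ArcRing P) :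
    circleProj T k (op (CupBimod.coord T (op x • CupBimod.gen T)) • circleElt T i l) =
      if k = l then x else 0 := by
  have key : ∀ b a, circleProj T k (op (CupBimod.coord T (op x • CupBimod.gen T)) •
      circleElt T i l) b a = if k = l then x b a else 0 := by
    intro b a
    rw [circleProj_apply, CapBimod.op_smul_apply, Finset.sum_eq_single (T.cup b), circleElt_cup,
      unop_op, CupBimod.coord_op_smul_gen]
    · obtain ⟨f, hf⟩ := (x b a).mk_surj
      have hid : ((CupTangle.id Q).emb : Q → Q) = id := rfl
      rw [← hf, ← map_one (TQFT.mk _), contract_self T a b rfl (circles_comm _ _) rfl rfl,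
        contract_self (CupTangle.id Q) (T.cup a) (T.cup b) (by simp) (circles_comm _ _)
          (by simp) (by simp), T.circleCoeff_mk, hid, MvPolynomial.rename_id_apply, mul_one,
        T.coeff_rename_mul, T.coeff_circleBasis hi]
      split_ifs <;> simp
    · intro c _ hc
      rw [circleElt_ne T i l hc]
      exact contract_zero_right (CupTangle.id Q) (T.cup b) (r := fun c => circles (T.cup b) c)
        (fun _ => by rw [CupTangle.id_cup]) (circles_comm _ _) _
    · intro h; exact absurd (Finset.mem_univ _) h
  funext b a
  rw [key]
  split_ifs <;> rfl

end CapBimod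

/-- A cup followed by its mirror image adds a circle. -/
noncomputable def circleSplitting {i : Q} (hi : i ∉ Set.range T.emb)
    (hT : ∀ q, q ∉ Set.range T.emb → q = i ∨ q = T.arc i) :
    GrBimod.Splitting T.mirrorBimod T.bimod (![1, -1] : Fin 2 → ℤ) where
  coord := CupBimod.coord T
  gen := CupBimod.gen T
  coord_smul := CupBimod.coord_smul T
  proj := CapBimod.circleProj T
  elt := CapBimod.circleElt T i
  expand b c := CapBimod.circle_expand T hi hT _
    (fun _ _ => CapBimod.op_coord_smul_off T _ _ _)
  dual k l a := CapBimod.circle_dual T hi k l a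
  shift := half Q - half P
  coord_mem := CupBimod.coord_mem T
  proj_mem {k n z} hz b a := by
    rw [show n - ((half Q : ℤ) - half P) - (![1, -1] : Fin 2 → ℤ) k - half P =
      n - half Q - (![1, -1] : Fin 2 → ℤ) k by ring]
    exact T.circleCoeff_degree hi hT k b a (hz b (T.cup a))

end Circle
end ArcAlgebra

namespace ArcAlgebra

open CategoryTheory CategoryTheory.Limits MulOpposite

/-! ### Zero objects and tensor functors. -/

section ZeroObjects

variable {A R : Type} [Ring A] [Ring R] {𝒜 : ℤ → AddSubgroup A} {ℛ : ℤ → AddSubgroup R}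

lemma GrMod.isZero_iff (M : GrMod 𝒜) : IsZero M ↔ Subsingleton M.carrier := by
  rw [IsZero.iff_id_eq_zero]
  constructor
  · intro h
    exact ⟨fun x y => (congrArg (fun φ => φ.1 x) h).trans (congrArg (fun φ => φ.1 y) h).symm⟩
  · intro h
    exact GrMod.hom_ext fun x => Subsingleton.elim _ _

lemma GrBimod.tensor_isZero [GradedRing ℛ] (B : GrBimod 𝒜 ℛ) {M : GrMod ℛ} (h : IsZero M) :
    IsZero (B.tensor.obj M) := by
  rw [GrMod.isZero_iff] at h ⊢
  have h0 : ∀ x : B.Tensor M, x = 0 := fun x =>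
    B.tensor_induction (C := fun x => x = 0)
      (fun b m => by rw [Subsingleton.elim m 0, B.tmul_zero]) rfl
      (fun x y hx hy => by rw [hx, hy, add_zero]) x
  exact ⟨fun x y => (h0 x).trans (h0 y).symm⟩

lemma GrMod.zero_isZero : IsZero (GrMod.zero 𝒜) :=
  (GrMod.isZero_iff _).2 (inferInstanceAs (Subsingleton PUnit))

end ZeroObjects

/-! ### Components of the functors on the total category. -/

section Components

variable {n k : ℕ} {i j : Fin n}

lemma TotalCat.isZero_iff (X : TotalCat n k) : IsZero X ↔ ∀ m, IsZero (X m) := by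
  simp only [IsZero.iff_id_eq_zero]
  exact ⟨fun h m => congrFun h m, fun h => funext h⟩

lemma stepE_isZero {l m : Fin n → ℤ} (hij : (i : ℕ) + 1 = j) (hm : m = l + eps i j)
    {M : WeightCat l} (h : IsZero M) : IsZero ((stepE hij hm).obj M) := by
  unfold stepE
  split_ifs
  exacts [GrBimod.tensor_isZero _ h, GrBimod.tensor_isZero _ h, GrBimod.tensor_isZero _ h,
    GrMod.zero_isZero]

lemma stepF_isZero {l m : Fin n → ℤ} (hij : (i : ℕ) + 1 = j) (hm : m = l - eps i j)
    {M : WeightCat l} (h : IsZero M) : IsZero ((stepF hij hm).obj M) := by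
  unfold stepF
  split_ifs
  exacts [GrBimod.tensor_isZero _ h, GrBimod.tensor_isZero _ h, GrBimod.tensor_isZero _ h,
    GrMod.zero_isZero]

lemma incl_isZero {l m : Weight n k} (h : m ≠ l) (M : WeightCat l.1) :
    IsZero ((incl l).obj M m) := by
  have h' : ¬ l.1 = m.1 := fun e => h (Subtype.ext e.symm)
  have : incl l ⋙ Pi.eval (fun m : Weight n k => WeightCat m.1) m = zeroFunctor _ m.1 := dif_neg h'
  exact (congrArg (fun F => IsZero (F.obj M)) this).mpr GrMod.zero_isZero

lemma incl_eval (l : Weight n k) :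
    incl l ⋙ Pi.eval (fun m : Weight n k => WeightCat m.1) l = 𝟭 _ := dif_pos rfl

/-- The component of weight `m` sees only the summand of weight `m - eps i j`, and is zero by
definition if that weight is not admissible. -/
lemma functorE_isZero (hij : (i : ℕ) + 1 = j) (X : TotalCat n k) (m : Weight n k)
    (h : ∀ l : Weight n k, m.1 = l.1 + eps i j → IsZero (X l)) :
    IsZero ((functorE k hij).obj X m) := by
  by_cases hm : Admissible k (m.1 - eps i j)
  · have : functorE k hij ⋙ Pi.eval (fun m : Weight n k => WeightCat m.1) m =
        Pi.eval (fun l : Weight n k => WeightCat l.1) ⟨m.1 - eps i j, hm⟩ ⋙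
          stepE hij (sub_add_cancel m.1 (eps i j)).symm := dif_pos hm
    exact (congrArg (fun F => IsZero (F.obj X)) this).mpr
      (stepE_isZero hij _ (h ⟨_, hm⟩ (sub_add_cancel m.1 (eps i j)).symm))
  · have : functorE k hij ⋙ Pi.eval (fun m : Weight n k => WeightCat m.1) m =
        zeroFunctor _ m.1 := dif_neg hm
    exact (congrArg (fun F => IsZero (F.obj X)) this).mpr GrMod.zero_isZero

lemma functorF_isZero (hij : (i : ℕ) + 1 = j) (X : TotalCat n k) (m : Weight n k)
    (h : ∀ l : Weight n k, m.1 = l.1 - eps i j → IsZero (X l)) :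
    IsZero ((functorF k hij).obj X m) := by
  by_cases hm : Admissible k (m.1 + eps i j)
  · have : functorF k hij ⋙ Pi.eval (fun m : Weight n k => WeightCat m.1) m =
        Pi.eval (fun l : Weight n k => WeightCat l.1) ⟨m.1 + eps i j, hm⟩ ⋙
          stepF hij (add_sub_cancel_right m.1 (eps i j)).symm := dif_pos hm
    exact (congrArg (fun F => IsZero (F.obj X)) this).mpr
      (stepF_isZero hij _ (h ⟨_, hm⟩ (add_sub_cancel_right m.1 (eps i j)).symm))
  · have : functorF k hij ⋙ Pi.eval (fun m : Weight n k => WeightCat m.1) m =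
        zeroFunctor _ m.1 := dif_neg hm
    exact (congrArg (fun F => IsZero (F.obj X)) this).mpr GrMod.zero_isZero

lemma functorE_eval (hij : (i : ℕ) + 1 = j) (l m : Weight n k) (hm : m.1 = l.1 + eps i j) :
    functorE k hij ⋙ Pi.eval (fun m : Weight n k => WeightCat m.1) m =
      Pi.eval (fun l : Weight n k => WeightCat l.1) l ⋙ stepE hij hm := by
  have h : m.1 - eps i j = l.1 := by rw [hm, add_sub_cancel_right]
  have ha : Admissible k (m.1 - eps i j) := h ▸ l.2
  -- The source weight in the definition is `m - eps i j`, which agrees with `l` only up to a proof;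
  -- after this substitution the definition applies verbatim.
  obtain rfl : l = ⟨m.1 - eps i j, ha⟩ := Subtype.ext h.symm
  exact dif_pos ha

lemma functorF_eval (hij : (i : ℕ) + 1 = j) (l m : Weight n k) (hm : m.1 = l.1 - eps i j) :
    functorF k hij ⋙ Pi.eval (fun m : Weight n k => WeightCat m.1) m =
      Pi.eval (fun l : Weight n k => WeightCat l.1) l ⋙ stepF hij hm := by
  have h : m.1 + eps i j = l.1 := by rw [hm, sub_add_cancel]
  have ha : Admissible k (m.1 + eps i j) := h ▸ l.2
  obtain rfl : l = ⟨m.1 + eps i j, ha⟩ := Subtype.ext h.symm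
  exact dif_pos ha

/-- A functor to the total category is determined componentwise. In weight `m` the two composites
are equal functors, and in any other weight both take only zero objects as values. -/
lemma incl_comp_iso {G : TotalCat n k ⥤ TotalCat n k} {l m : Weight n k}
    {K : WeightCat l.1 ⥤ WeightCat m.1}
    (h1 : G ⋙ Pi.eval (fun m : Weight n k => WeightCat m.1) m =
      Pi.eval (fun l : Weight n k => WeightCat l.1) l ⋙ K)
    (h2 : ∀ X m', m' ≠ m → (∀ l', l' ≠ l → IsZero (X l')) → IsZero (G.obj X m')) :
    Nonempty (incl l ⋙ G ≅ K ⋙ incl m) := by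
  have h : ∀ m', Nonempty ((incl l ⋙ G) ⋙ Pi.eval (fun m : Weight n k => WeightCat m.1) m' ≅
      (K ⋙ incl m) ⋙ Pi.eval (fun m : Weight n k => WeightCat m.1) m') := by
    intro m'
    by_cases hm : m' = m
    · subst hm
      exact ⟨eqToIso (by
        rw [Functor.assoc, h1, ← Functor.assoc, incl_eval, Functor.assoc, incl_eval]
        rfl)⟩
    · exact ⟨IsZero.iso
        (Functor.isZero _ fun M => h2 _ _ hm fun l' hl => incl_isZero hl M)
        (Functor.isZero _ fun M => incl_isZero hm _)⟩
  exact ⟨NatIso.pi' fun m' => (h m').some⟩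

lemma incl_functorE (hij : (i : ℕ) + 1 = j) (l m : Weight n k) (hm : m.1 = l.1 + eps i j) :
    Nonempty (incl l ⋙ functorE k hij ≅ stepE hij hm ⋙ incl m) :=
  incl_comp_iso (functorE_eval hij l m hm) fun X m' hm' hX =>
    functorE_isZero hij X m' fun l' hl => hX l' fun e => hm' (Subtype.ext (by rw [hl, e, hm]))

lemma incl_functorF (hij : (i : ℕ) + 1 = j) (l m : Weight n k) (hm : m.1 = l.1 - eps i j) :
    Nonempty (incl l ⋙ functorF k hij ≅ stepF hij hm ⋙ incl m) :=
  incl_comp_iso (functorF_eval hij l m hm) fun X m' hm' hX =>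
    functorF_isZero hij X m' fun l' hl => hX l' fun e => hm' (Subtype.ext (by rw [hl, e, hm]))

lemma incl_functorF_functorE (hij : (i : ℕ) + 1 = j) (l m : Weight n k)
    (hm : m.1 = l.1 - eps i j) (hl : l.1 = m.1 + eps i j) :
    Nonempty (incl l ⋙ functorF k hij ⋙ functorE k hij ≅
      (stepF hij hm ⋙ stepE hij hl) ⋙ incl l) := by
  obtain ⟨e⟩ := incl_functorF hij l m hm
  obtain ⟨e'⟩ := incl_functorE hij m l hl
  exact ⟨Functor.isoWhiskerRight e (functorE k hij) ≪≫ Functor.isoWhiskerLeft (stepF hij hm) e'⟩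

lemma incl_functorE_functorF (hij : (i : ℕ) + 1 = j) (l m : Weight n k)
    (hm : m.1 = l.1 + eps i j) (hl : l.1 = m.1 - eps i j) :
    Nonempty (incl l ⋙ functorE k hij ⋙ functorF k hij ≅
      (stepE hij hm ⋙ stepF hij hl) ⋙ incl l) := by
  obtain ⟨e⟩ := incl_functorE hij l m hm
  obtain ⟨e'⟩ := incl_functorF hij m l hl
  exact ⟨Functor.isoWhiskerRight e (functorF k hij) ≪≫ Functor.isoWhiskerLeft (stepE hij hm) e'⟩

/-- A nonzero result would have to pass through the weight `l - eps i j`. If that weight is not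
admissible, the first functor already kills everything concentrated in weight `l`. -/
lemma isZero_incl_functorF_functorE (hij : (i : ℕ) + 1 = j) (l : Weight n k)
    (h : ¬ Admissible k (l.1 - eps i j)) :
    IsZero (incl l ⋙ functorF k hij ⋙ functorE k hij) :=
  Functor.isZero _ fun M => (TotalCat.isZero_iff _).2 fun m => functorE_isZero hij _ m fun l' _ =>
    functorF_isZero hij _ l' fun l'' hl => incl_isZero (fun e => h (by rw [← e, ← hl]; exact l'.2)) M

lemma isZero_incl_functorE_functorF (hij : (i : ℕ) + 1 = j) (l : Weight n k)
    (h : ¬ Admissible k (l.1 + eps i j)) :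
    IsZero (incl l ⋙ functorE k hij ⋙ functorF k hij) :=
  Functor.isZero _ fun M => (TotalCat.isZero_iff _).2 fun m => functorF_isZero hij _ m fun l' _ =>
    functorE_isZero hij _ l' fun l'' hl => incl_isZero (fun e => h (by rw [← e, ← hl]; exact l'.2)) M

/-- Each component of the inclusion is an identification or the zero functor. The weight is
generalised first, so that the equality of weights can be eliminated. -/
lemma incl_map_add (l : Weight n k) {M N : WeightCat l.1} (f g : M ⟶ N) :
    (incl l).map (f + g) = (incl l).map f + (incl l).map g := by
  have key : ∀ (m : Fin n → ℤ) (F : WeightCat l.1 ⥤ WeightCat m),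
      ((∃ h : l.1 = m, F = castFunctor h) ∨ F = zeroFunctor _ m) →
      F.map (f + g) = F.map f + F.map g := by
    rintro m F (⟨h, rfl⟩ | rfl)
    · subst h; rfl
    · exact GrMod.zero_isZero.eq_of_src _ _
  funext m
  refine key m.1 (incl l ⋙ Pi.eval (fun m : Weight n k => WeightCat m.1) m) ?_
  by_cases h : l.1 = m.1
  · exact Or.inl ⟨h, dif_pos h⟩
  · exact Or.inr (dif_neg h)

/-- The inclusion of a summand preserves direct sums. -/
lemma prodFunctor_incl (l : Weight n k) (F G : WeightCat l.1 ⥤ WeightCat l.1) :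
    Nonempty (GrMod.prodFunctor F G ⋙ incl l ≅ (F ⋙ incl l) ⊞ (G ⋙ incl l)) := by
  let p : GrMod.prodFunctor F G ⟶ F := { app := fun M => (GrMod.bicone (F.obj M) (G.obj M)).fst }
  let q : GrMod.prodFunctor F G ⟶ G := { app := fun M => (GrMod.bicone (F.obj M) (G.obj M)).snd }
  let u : F ⟶ GrMod.prodFunctor F G :=
    { app := fun M => (GrMod.bicone (F.obj M) (G.obj M)).inl
      naturality := fun M N f => GrMod.hom_ext fun x => Prod.ext rfl (map_zero (G.map f).1).symm }
  let v : G ⟶ GrMod.prodFunctor F G :=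
    { app := fun M => (GrMod.bicone (F.obj M) (G.obj M)).inr
      naturality := fun M N f => GrMod.hom_ext fun x => Prod.ext (map_zero (F.map f).1).symm rfl }
  -- Whiskering respects composition, identities, sums and therefore zero, so it carries the
  -- equations of a biproduct to equations of a biproduct.
  let W {X Y : WeightCat l.1 ⥤ WeightCat l.1} (α : X ⟶ Y) := Functor.whiskerRight α (incl l)
  have hW : ∀ {X Y Z : WeightCat l.1 ⥤ WeightCat l.1} (α : X ⟶ Y) (β : Y ⟶ Z),
      W α ≫ W β = W (α ≫ β) := fun α β => (Functor.whiskerRight_comp α β _).symm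
  have hadd : ∀ {X Y : WeightCat l.1 ⥤ WeightCat l.1} (α β : X ⟶ Y), W (α + β) = W α + W β :=
    fun α β => NatTrans.ext (funext fun M => incl_map_add l _ _)
  have hz : ∀ {X Y : WeightCat l.1 ⥤ WeightCat l.1}, W (0 : X ⟶ Y) = 0 := fun {X Y} => by
    have := hadd (0 : X ⟶ Y) 0
    rw [add_zero] at this
    exact left_eq_add.1 this
  have hid : ∀ X : WeightCat l.1 ⥤ WeightCat l.1, W (𝟙 X) = 𝟙 _ := fun X =>
    Functor.whiskerRight_id' _
  have h1 : p ≫ u + q ≫ v = 𝟙 _ := NatTrans.ext (funext fun M => GrMod.hom_ext fun x =>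
    Prod.ext (add_zero _) (zero_add _))
  have h2 : u ≫ p = 𝟙 _ := rfl
  have h3 : v ≫ q = 𝟙 _ := rfl
  have h4 : u ≫ q = 0 := rfl
  have h5 : v ≫ p = 0 := rfl
  refine ⟨⟨biprod.lift (W p) (W q), biprod.desc (W u) (W v), ?_, ?_⟩⟩
  · rw [biprod.lift_desc, hW, hW, ← hadd, h1, hid]
  · refine biprod.hom_ext' _ _ (biprod.hom_ext _ _ ?_ ?_) (biprod.hom_ext _ _ ?_ ?_)
    · simp only [biprod.inl_desc_assoc, Category.assoc, biprod.lift_fst, hW, h2, hid]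
      simp
    · simp only [biprod.inl_desc_assoc, Category.assoc, biprod.lift_snd, hW, h4, hz]
      simp
    · simp only [biprod.inr_desc_assoc, Category.assoc, biprod.lift_fst, hW, h5, hz]
      simp
    · simp only [biprod.inr_desc_assoc, Category.assoc, biprod.lift_snd, hW, h3, hid]
      simp

end Components
end ArcAlgebra

namespace ArcAlgebra

open CategoryTheory CategoryTheory.Limits MulOpposite

/-! ### Admissibility and the three tangle identities. -/

section Relations

variable {n k : ℕ} {i j : Fin n} {l m : Fin n → ℤ}

lemma sum_eps (i j : Fin n) : ∑ x, eps i j x = 0 := by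
  simp [eps]

/-- The root has sum zero, so only the bounds at `i` and `j` can fail: an entry `2` cannot be raised
and an entry `0` cannot be lowered. -/
lemma Admissible.add_eps (hij : (i : ℕ) + 1 = j) (hl : Admissible k l) :
    Admissible k (l + eps i j) ↔ l i ≤ 1 ∧ 1 ≤ l j := by
  constructor
  · intro h
    have h1 := (h.1 i).2
    have h2 := (h.1 j).1
    rw [Pi.add_apply, eps_left hij] at h1
    rw [Pi.add_apply, eps_right hij] at h2
    omega
  · rintro ⟨h1, h2⟩
    refine ⟨fun x => ?_, ?_⟩
    · have hx := hl.1 x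
      rw [Pi.add_apply]
      by_cases hi : x = i
      · subst hi; rw [eps_left hij]; omega
      · by_cases hj : x = j
        · subst hj; rw [eps_right hij]; omega
        · rw [eps_other hi hj]; omega
    · simp only [Pi.add_apply]
      rw [Finset.sum_add_distrib, sum_eps, add_zero, hl.2]

lemma Admissible.sub_eps (hij : (i : ℕ) + 1 = j) (hl : Admissible k l) :
    Admissible k (l - eps i j) ↔ 1 ≤ l i ∧ l j ≤ 1 := by
  constructor
  · intro h
    have h1 := (h.1 i).1
    have h2 := (h.1 j).2
    rw [Pi.sub_apply, eps_left hij] at h1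
    rw [Pi.sub_apply, eps_right hij] at h2
    omega
  · rintro ⟨h1, h2⟩
    refine ⟨fun x => ?_, ?_⟩
    · have hx := hl.1 x
      rw [Pi.sub_apply]
      by_cases hi : x = i
      · subst hi; rw [eps_left hij]; omega
      · by_cases hj : x = j
        · subst hj; rw [eps_right hij]; omega
        · rw [eps_other hi hj]; omega
    · simp only [Pi.sub_apply]
      rw [Finset.sum_sub_distrib, sum_eps, sub_zero, hl.2]

/-- Both slides move points by the transposition of `i` and `j`, which is its own inverse. -/
lemma slide_comp_slide (hij : (i : ℕ) + 1 = j) (hl : ¬ (l i = 1 ∧ l j = 1))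
    (hm : ∀ x, m x = l (Equiv.swap i j x)) (hl' : ¬ (m i = 1 ∧ m j = 1))
    (hm' : ∀ x, l x = m (Equiv.swap i j x)) :
    Nonempty ((slide hij hl hm).bimod.tensor ⋙ (slide hij hl' hm').bimod.tensor ≅
      𝟭 (WeightCat l)) :=
  (slideSplitting (slide hij hl hm) (slide hij hl' hm')
    (fun p => Subtype.ext (Equiv.swap_apply_self i j p.1))
    (fun q => Subtype.ext (Equiv.swap_apply_self i j q.1))).nonempty_iso_id

lemma cupAt_range (hij : (i : ℕ) + 1 = j) (hi : l i ≠ 1) (hj : l j ≠ 1) (hi' : m i = 1)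
    (hj' : m j = 1) (hm : ∀ x, x ≠ i → x ≠ j → m x = l x) (q : Ones m) :
    q ∉ Set.range (cupAt hij hi hj hi' hj' hm).emb ↔ q.1 = i ∨ q.1 = j := by
  constructor
  · intro h
    by_contra! h'
    exact h ⟨⟨q.1, by rw [← hm _ h'.1 h'.2]; exact q.2⟩, rfl⟩
  · rintro h ⟨x, rfl⟩
    exact h.elim (fun e => hi (e ▸ x.2)) (fun e => hj (e ▸ x.2))

/-- The only top points off the strands are `i` and `j`, the two ends of one cup. The variable at
`i` represents the circle. -/
lemma cup_comp_cap (hij : (i : ℕ) + 1 = j) (hi : l i ≠ 1) (hj : l j ≠ 1) (hi' : m i = 1)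
    (hj' : m j = 1) (hm : ∀ x, x ≠ i → x ≠ j → m x = l x) :
    Nonempty ((cupAt hij hi hj hi' hj' hm).bimod.tensor ⋙
      (cupAt hij hi hj hi' hj' hm).mirrorBimod.tensor ≅
        GrMod.prodFunctor (gradeShift l 1) (gradeShift l (-1))) :=
  (circleSplitting (cupAt hij hi hj hi' hj' hm) (i := ⟨i, hi'⟩)
    ((cupAt_range hij hi hj hi' hj' hm _).2 (Or.inl rfl))
    (fun q hq => ((cupAt_range hij hi hj hi' hj' hm q).1 hq).imp (fun h => Subtype.ext h)
      (fun h => Subtype.ext (h.trans (Equiv.swap_apply_left i j).symm)))).nonempty_iso_prod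

/-- A cap followed by a cup depends only on the set of points between them. -/
lemma cap_comp_cup_congr {V Q : Type} [LinearOrder V] [LinearOrder Q] [Fintype Q]
    {p p' : V → Prop} [hp : Fintype {x // p x}] [hp' : Fintype {x // p' x}]
    (T : CupTangle {x // p x} Q) (T' : CupTangle {x // p' x} Q) (h : p = p')
    (hemb : ∀ x hx hx', T.emb ⟨x, hx⟩ = T'.emb ⟨x, hx'⟩) (harc : T.arc = T'.arc) :
    Nonempty (T.mirrorBimod.tensor ⋙ T.bimod.tensor ≅
      T'.mirrorBimod.tensor ⋙ T'.bimod.tensor) := by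
  subst h
  -- The bimodules also depend on the chosen enumerations of the points, which agree because
  -- finiteness data are unique.
  obtain rfl : hp = hp' := Subsingleton.elim _ _
  obtain rfl : T = T' := by
    have he : T.emb = T'.emb := RelEmbedding.ext fun x => hemb x.1 x.2 x.2
    cases T
    cases T'
    simp only at he harc
    subst he harc
    rfl
  exact ⟨Iso.refl _⟩

/-- The weights `l` and `l'` may differ at `i` and `j`, but neither has a `1` there and they agree
elsewhere, so they mark the same points. -/
lemma cap_comp_cup {l' : Fin n → ℤ} (hij : (i : ℕ) + 1 = j) (hi : l i ≠ 1) (hj : l j ≠ 1)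
    (hli : l' i ≠ 1) (hlj : l' j ≠ 1) (hi' : m i = 1) (hj' : m j = 1)
    (hm : ∀ x, x ≠ i → x ≠ j → m x = l x) (hm' : ∀ x, x ≠ i → x ≠ j → m x = l' x) :
    Nonempty ((cupAt hij hi hj hi' hj' hm).mirrorBimod.tensor ⋙
        (cupAt hij hi hj hi' hj' hm).bimod.tensor ≅
      (cupAt hij hli hlj hi' hj' hm').mirrorBimod.tensor ⋙
        (cupAt hij hli hlj hi' hj' hm').bimod.tensor) :=
  cap_comp_cup_congr _ _ (by
    funext x
    by_cases h : x = i
    · subst h; simp [hi, hli]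
    · by_cases h' : x = j
      · subst h'; simp [hj, hlj]
      · rw [← hm x h h', ← hm' x h h']) (fun _ _ _ => rfl) rfl

lemma step_slide (hij : (i : ℕ) + 1 = j) (hm : m = l - eps i j) (hl : l = m + eps i j)
    (h : (l i = 1 ∧ l j = 0) ∨ (l i = 2 ∧ l j = 1)) :
    Nonempty (stepF hij hm ⋙ stepE hij hl ≅ 𝟭 (WeightCat l)) := by
  have mi : m i = l i - 1 := by rw [hm, Pi.sub_apply, eps_left hij]
  have mj : m j = l j + 1 := by rw [hm, Pi.sub_apply, eps_right hij]; ring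
  rw [stepF, dif_pos h, stepE, dif_pos (by omega)]
  exact slide_comp_slide hij _ _ _ _

lemma step_slide' (hij : (i : ℕ) + 1 = j) (hm : m = l + eps i j) (hl : l = m - eps i j)
    (h : (l i = 1 ∧ l j = 2) ∨ (l i = 0 ∧ l j = 1)) :
    Nonempty (stepE hij hm ⋙ stepF hij hl ≅ 𝟭 (WeightCat l)) := by
  have mi : m i = l i + 1 := by rw [hm, Pi.add_apply, eps_left hij]
  have mj : m j = l j - 1 := by rw [hm, Pi.add_apply, eps_right hij]; ring
  rw [stepE, dif_pos h, stepF, dif_pos (by omega)]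
  exact slide_comp_slide hij _ _ _ _

lemma step_circle (hij : (i : ℕ) + 1 = j) (hm : m = l - eps i j) (hl : l = m + eps i j)
    (h : l i = 2 ∧ l j = 0) :
    Nonempty (stepF hij hm ⋙ stepE hij hl ≅
      GrMod.prodFunctor (gradeShift l 1) (gradeShift l (-1))) := by
  have mi : m i = l i - 1 := by rw [hm, Pi.sub_apply, eps_left hij]
  have mj : m j = l j + 1 := by rw [hm, Pi.sub_apply, eps_right hij]; ring
  rw [stepF, dif_neg (by omega), dif_pos h, stepE, dif_neg (by omega), dif_neg (by omega),
    dif_pos (by omega)]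
  exact cup_comp_cap hij _ _ _ _ _

lemma step_circle' (hij : (i : ℕ) + 1 = j) (hm : m = l + eps i j) (hl : l = m - eps i j)
    (h : l i = 0 ∧ l j = 2) :
    Nonempty (stepE hij hm ⋙ stepF hij hl ≅
      GrMod.prodFunctor (gradeShift l 1) (gradeShift l (-1))) := by
  have mi : m i = l i + 1 := by rw [hm, Pi.add_apply, eps_left hij]
  have mj : m j = l j - 1 := by rw [hm, Pi.add_apply, eps_right hij]; ring
  rw [stepE, dif_neg (by omega), dif_pos h, stepF, dif_neg (by omega), dif_neg (by omega),
    dif_pos (by omega)]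
  exact cup_comp_cap hij _ _ _ _ _

/-- One composite passes through entries `(0,2)` and the other through `(2,0)`; both are the cap
followed by the cup, with the same points in between. -/
lemma step_cap_cup {m' : Fin n → ℤ} (hij : (i : ℕ) + 1 = j) (hm : m = l - eps i j)
    (hl : l = m + eps i j) (hm' : m' = l + eps i j) (hl' : l = m' - eps i j)
    (h : l i = 1 ∧ l j = 1) :
    Nonempty (stepF hij hm ⋙ stepE hij hl ≅ stepE hij hm' ⋙ stepF hij hl') := by
  have mi : m i = l i - 1 := by rw [hm, Pi.sub_apply, eps_left hij]
  have mj : m j = l j + 1 := by rw [hm, Pi.sub_apply, eps_right hij]; ring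
  have mi' : m' i = l i + 1 := by rw [hm', Pi.add_apply, eps_left hij]
  have mj' : m' j = l j - 1 := by rw [hm', Pi.add_apply, eps_right hij]; ring
  rw [stepF, dif_neg (by omega), dif_neg (by omega), dif_pos h, stepE, dif_neg (by omega),
    dif_pos (by omega), stepE, dif_neg (by omega), dif_neg (by omega), dif_pos h, stepF,
    dif_neg (by omega), dif_pos (by omega)]
  exact cap_comp_cup hij _ _ _ _ _ _ _ _

end Relations
end ArcAlgebra

open CategoryTheory CategoryTheory.Limits ArcAlgebra

theorem mainTheorem3 (n k : ℕ) (hk : 1 ≤ k) (hkn : k + 1 ≤ n) (i j : Fin n)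
    (hij : (i : ℕ) + 1 = j) (l : Weight n k) :
    ((l.1 i = 2 ∧ l.1 j = 0) →
      Nonempty (incl l ⋙ functorF k hij ⋙ functorE k hij ≅
        (incl l ⋙ functorE k hij ⋙ functorF k hij) ⊞
          ((gradeShift l.1 1 ⋙ incl l) ⊞ (gradeShift l.1 (-1) ⋙ incl l)))) ∧
    (l.1 i - l.1 j = 1 →
      Nonempty (incl l ⋙ functorF k hij ⋙ functorE k hij ≅
        (incl l ⋙ functorE k hij ⋙ functorF k hij) ⊞ incl l)) ∧
    (l.1 i = l.1 j →
      Nonempty (incl l ⋙ functorF k hij ⋙ functorE k hij ≅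
        incl l ⋙ functorE k hij ⋙ functorF k hij)) ∧
    (l.1 i - l.1 j = -1 →
      Nonempty ((incl l ⋙ functorF k hij ⋙ functorE k hij) ⊞ incl l ≅
        incl l ⋙ functorE k hij ⋙ functorF k hij)) ∧
    ((l.1 i = 0 ∧ l.1 j = 2) →
      Nonempty ((incl l ⋙ functorF k hij ⋙ functorE k hij) ⊞
          ((gradeShift l.1 1 ⋙ incl l) ⊞ (gradeShift l.1 (-1) ⋙ incl l)) ≅
        incl l ⋙ functorE k hij ⋙ functorF k hij)) := by
  have hadd : ∀ m : Fin n → ℤ, m = m - eps i j + eps i j := fun m => (sub_add_cancel _ _).symm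
  have hsub : ∀ m : Fin n → ℤ, m = m + eps i j - eps i j :=
    fun m => (add_sub_cancel_right _ _).symm
  have hi := l.2.1 i
  have hj := l.2.1 j
  refine ⟨fun h => ?_, fun h => ?_, fun h => ?_, fun h => ?_, fun h => ?_⟩
  · have ha : Admissible k (l.1 - eps i j) := (l.2.sub_eps hij).2 (by omega)
    -- Adding the root would produce an entry `3` at `i`, so the other composite contributes a zero
    -- summand.
    have hz := isZero_incl_functorE_functorF hij l (mt (l.2.add_eps hij).1 (by omega))
    obtain ⟨e⟩ := incl_functorF_functorE hij l ⟨_, ha⟩ rfl (hadd _)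
    obtain ⟨e'⟩ := step_circle hij rfl (hadd l.1) h
    obtain ⟨e''⟩ := prodFunctor_incl l (gradeShift l.1 1) (gradeShift l.1 (-1))
    exact ⟨e ≪≫ Functor.isoWhiskerRight e' (incl l) ≪≫ e'' ≪≫ isoZeroBiprod hz⟩
  · have ha : Admissible k (l.1 - eps i j) := (l.2.sub_eps hij).2 (by omega)
    -- The entries are `(1,0)` or `(2,1)`; adding the root would give `-1` at `j` or `3` at `i`.
    have hz := isZero_incl_functorE_functorF hij l (mt (l.2.add_eps hij).1 (by omega))
    obtain ⟨e⟩ := incl_functorF_functorE hij l ⟨_, ha⟩ rfl (hadd _)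
    obtain ⟨e'⟩ := step_slide hij rfl (hadd l.1) (by omega)
    exact ⟨e ≪≫ Functor.isoWhiskerRight e' (incl l) ≪≫ Functor.leftUnitor _ ≪≫ isoZeroBiprod hz⟩
  · by_cases h1 : l.1 i = 1
    · have ha : Admissible k (l.1 - eps i j) := (l.2.sub_eps hij).2 (by omega)
      have ha' : Admissible k (l.1 + eps i j) := (l.2.add_eps hij).2 (by omega)
      obtain ⟨e⟩ := incl_functorF_functorE hij l ⟨_, ha⟩ rfl (hadd _)
      obtain ⟨e'⟩ := incl_functorE_functorF hij l ⟨_, ha'⟩ rfl (hsub _)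
      obtain ⟨e''⟩ := step_cap_cup hij rfl (hadd l.1) rfl (hsub l.1) ⟨h1, h ▸ h1⟩
      exact ⟨e ≪≫ Functor.isoWhiskerRight e'' (incl l) ≪≫ e'.symm⟩
    -- Equal entries other than `1` are `(0,0)` or `(2,2)`. Neither adding nor subtracting the root
    -- is then admissible, and both composites vanish.
    · exact ⟨IsZero.iso
        (isZero_incl_functorF_functorE hij l (mt (l.2.sub_eps hij).1 (by omega)))
        (isZero_incl_functorE_functorF hij l (mt (l.2.add_eps hij).1 (by omega)))⟩
  · have ha : Admissible k (l.1 + eps i j) := (l.2.add_eps hij).2 (by omega)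
    -- For `(0,1)` and `(1,2)`, and likewise for `(0,2)` below, subtracting the root leaves the
    -- admissible range, so the roles of the two composites are exchanged.
    have hz := isZero_incl_functorF_functorE hij l (mt (l.2.sub_eps hij).1 (by omega))
    obtain ⟨e⟩ := incl_functorE_functorF hij l ⟨_, ha⟩ rfl (hsub _)
    obtain ⟨e'⟩ := step_slide' hij rfl (hsub l.1) (by omega)
    exact ⟨(e ≪≫ Functor.isoWhiskerRight e' (incl l) ≪≫ Functor.leftUnitor _ ≪≫
      isoZeroBiprod hz).symm⟩
  · have ha : Admissible k (l.1 + eps i j) := (l.2.add_eps hij).2 (by omega)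
    have hz := isZero_incl_functorF_functorE hij l (mt (l.2.sub_eps hij).1 (by omega))
    obtain ⟨e⟩ := incl_functorE_functorF hij l ⟨_, ha⟩ rfl (hsub _)
    obtain ⟨e'⟩ := step_circle' hij rfl (hsub l.1) h
    obtain ⟨e''⟩ := prodFunctor_incl l (gradeShift l.1 1) (gradeShift l.1 (-1))
    exact ⟨(e ≪≫ Functor.isoWhiskerRight e' (incl l) ≪≫ e'' ≪≫ isoZeroBiprod hz).symm⟩
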